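/- Let $K$ be a field with $\operatorname{char}K\neq 2$. All commutators are supercommutators $[a,b]=ab-(-1)^{|a||b|}ba$. Let $\Lambda=\Lambda(x_i\mid i\ge 0)$ be the Grassmann algebra over $K$ with odd generators, and let $\partial_i$ be the superderivative of $\Lambda$ with $\partial_i(x_j)=\delta_{ij}$. Put $$v_i=\partial_i+x_ix_{i+1}\bigl(\partial_{i+3}+x_{i+3}x_{i+4}(\partial_{i+6}+\cdots)\bigr)\in\operatorname{End}\Lambda,\qquad i\ge 0,$$ where $x_i$ acts by left multiplication. Let $\mathbf Q=\mathrm{Lie}(v_0,v_1,v_2)$ be the Lie superalgebra generated by $v_0,v_1,v_2$, and let $\mathbf A\subset\operatorname{End}\Lambda$ be the associative algebra with unit generated by $v_0,v_1,v_2$. Consider formal (possibly infinite) linear combinations of the monomials $x^\alpha y^\beta$ in odd, supercommuting variables $x_i,y_i$ $(i\ge0)$ such that either $x^\alpha y^\beta=1$, or $\beta\ne0$ and every index of an $x$ in the monomial is smaller than the largest index of a $y$ in it, the number of $y$'s being bounded. They form a superalgebra $\mathcal H$ with the supercommutative product and the bracket determined by $\{y_i,x_j\}=\delta_{ij}$,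 $\{x_i,x_j\}=\{y_i,y_j\}=0$, that is, $$\{f,g\}=(-1)^{|f|-1}\sum_{i\ge0}\Bigl(\frac{\partial f}{\partial x_i}\frac{\partial g}{\partial y_i}+\frac{\partial f}{\partial y_i}\frac{\partial g}{\partial x_i}\Bigr).$$ Put $V_i=y_i+x_ix_{i+1}(y_{i+3}+x_{i+3}x_{i+4}(y_{i+6}+\cdots))\in\mathcal H$, and let $\mathbf P=\mathbf P_{\bar0}\oplus\mathbf P_{\bar1}\subset\mathcal H$ be the Poisson superalgebra with unit generated by $V_0,V_1,V_2$. An element $a=\sum\lambda_{\alpha,j}\,x^\alpha\partial_j$ of $\mathbf Q$ acts on $\Lambda^{(t)}=K[t]\otimes_K\Lambda$ by the operator $a^{(t)}$ obtained on replacing every $x_i$ by $x_i^{(t)}$, the left multiplication by $tx_i$, and keeping the $\partial_j$. Let $\mathbf A^{(t)}\subset\operatorname{End}_{K[t]}\Lambda^{(t)}$ be the associative $K[t]$-algebra with unit generated by all $a^{(t)}$, $a\in\mathbf Q$. **Theorem.** The Poisson superalgebra $\mathbf P$ admits an algebraic quantization, which is realized by $\mathbf A^{(t)}$. Precisely: $\mathbf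 P$ is a Poisson superalgebra, and there is a set $I$ of pairs $(\alpha,\beta)$ of finite subsets of $\{0,1,2,\dots\}$ such that (all products being taken in increasing order of indices) 1. the monomials $\prod_{i\in\alpha}x_i\prod_{j\in\beta}V_j$, $(\alpha,\beta)\in I$, form a basis of $\mathbf P$, and the monomials $\prod_{i\in\alpha}x_i\prod_{j\in\beta}v_j$, $(\alpha,\beta)\in I$, form a basis of $\mathbf A$; 2. there are isomorphisms of $K[t]$-modules $\Psi:K[t]\otimes_K\mathbf A\to\mathbf A^{(t)}$ and $\Phi:\mathbf P[t]\to\mathbf A^{(t)}$ that send the basis monomial of $\mathbf A$, respectively of $\mathbf P$, with index $(\alpha,\beta)\in I$ to $\prod_{i\in\alpha}x_i^{(t)}\prod_{j\in\beta}v_j^{(t)}$; moreover, for each $p\in\mathbb Z_2$, an element $f\in\mathbf P[t]$ lies in $\mathbf P_p[t]$ if and only if the operator $\Phi(f)$ is homogeneous of parity $p$; 3. the product $f*g=\Phi^{-1}(\Phi(f)\Phi(g))$ on $\mathbf P[t]$ is $K$-bilinear and associative, it agrees with the grading $\mathbf P[t]=\mathbf P_{\bar0}[t]\oplus\mathbf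 P_{\bar1}[t]$, and - $a*b\equiv a\cdot b\pmod t$ for all $a,b\in\mathbf P$; - $a*b-(-1)^{|a||b|}\,b*a\equiv t\{a,b\}\pmod{t^2}$ for all homogeneous $a,b\in\mathbf P$; - $f*t=t*f=ft$ for all $f\in\mathbf P[t]$. -/

import Mathlib

open scoped Polynomial

noncomputable section

namespace FractalSuper

/-! ### The Grassmann algebra and operators on it -/

section Grassmann

variable (R : Type*) [CommRing R]

/-- The Grassmann algebra `Λ(x_i | i ≥ 0)` over a commutative ring `R`. For `R = K[X]` this is
`K[t] ⊗ Λ(x_i | i ≥ 0)`, where `t = X` commutes with the Grassmann variables. -/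
abbrev Grassmann : Type _ := ExteriorAlgebra R (ℕ →₀ R)

/-- The Grassmann variable `x_i`. -/
def gx (i : ℕ) : Grassmann R := ExteriorAlgebra.ι R (Finsupp.single i 1)

/-- The superderivative `∂_i` with `∂_i (x_j) = δ_{ij}`. -/
def gd (i : ℕ) : Module.End R (Grassmann R) :=
  CliffordAlgebra.contractLeft (Q := (0 : QuadraticForm R (ℕ →₀ R))) (Finsupp.lapply i)

/-- The even (`p = 0`) or odd (`p = 1`) part of the Grassmann algebra. -/
def gParity (p : ZMod 2) : Submodule R (Grassmann R) :=
  CliffordAlgebra.evenOdd (0 : QuadraticForm R (ℕ →₀ R)) p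

/-- An endomorphism of `Λ` is homogeneous of parity `p`. -/
def IsHomogeneousEnd (p : ZMod 2) (φ : Module.End R (Grassmann R)) : Prop :=
  ∀ q : ZMod 2, ∀ f ∈ gParity R q, φ f ∈ gParity R (p + q)

variable {R}

theorem gd_support_finite (f : Grassmann R) : {j : ℕ | gd R j f ≠ 0}.Finite := by
  induction f using CliffordAlgebra.left_induction with
  | algebraMap r =>
    have : {j : ℕ | gd R j (algebraMap R (Grassmann R) r) ≠ 0} = ∅ := by
      ext j
      simp [gd, CliffordAlgebra.contractLeft_algebraMap]
    exact this ▸ Set.finite_empty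
  | add a b ha hb =>
    refine (ha.union hb).subset fun j hj => ?_
    by_contra h
    simp only [Set.mem_union, Set.mem_ofPred_eq, not_or, not_not] at h
    exact hj (by rw [map_add, h.1, h.2, add_zero])
  | ι_mul a m ha =>
    refine (ha.union m.hasFiniteSupport).subset fun j hj => ?_
    by_contra h
    simp only [Set.mem_union, Set.mem_ofPred_eq, not_or, not_not] at h
    refine hj ?_
    have hm : m j = 0 := by simpa using h.2
    have h1 := h.1
    simp only [gd] at h1 ⊢
    rw [CliffordAlgebra.contractLeft_ι_mul, h1]
    simp [hm]

theorem specialDer_finite (c : ℕ → Grassmann R) (f : Grassmann R) :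
    (Function.support fun j => c j * gd R j f).Finite :=
  (gd_support_finite f).subset fun j hj h => hj (by simp only [h, mul_zero])

/-- The (possibly infinite) formal sum `∑_j c_j ∂_j` as an operator on `Λ`; on every element of `Λ`
only finitely many of its terms are nonzero. -/
def specialDer (c : ℕ → Grassmann R) : Module.End R (Grassmann R) where
  toFun f := ∑ᶠ j, c j * gd R j f
  map_add' f g := by
    rw [← finsum_add_distrib (specialDer_finite c f) (specialDer_finite c g)]
    simp only [map_add, mul_add]
  map_smul' r f := by
    rw [RingHom.id_apply, smul_finsum' r (specialDer_finite c f)]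
    simp only [map_smul, mul_smul_comm]

end Grassmann

/-! ### The Lie superalgebra `Q` and its associative hull `A` -/

section LieAndAssociative

variable (K : Type*) [Field K]

/-- `x_i x_{i+1} · x_{i+3} x_{i+4} ⋯ x_{i+3l-3} x_{i+3l-2}`. -/
def pivotTail (i : ℕ) : ℕ → Grassmann K
  | 0 => 1
  | l + 1 => pivotTail i l * (gx K (i + 3 * l) * gx K (i + 3 * l + 1))

/-- The pivot element
`v_i = ∂_i + x_i x_{i+1} (∂_{i+3} + x_{i+3} x_{i+4} (∂_{i+6} + x_{i+6} x_{i+7} (∂_{i+9} + ⋯)))`. -/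
def v (i : ℕ) : Module.End K (Grassmann K) :=
  specialDer fun j => if i ≤ j ∧ 3 ∣ j - i then pivotTail K i ((j - i) / 3) else 0

/-- The Lie monomials in the odd elements `v_0, v_1, v_2`, formed with the supercommutator
`[a, b] = a b - (-1)^{|a||b|} b a`, together with their parity. -/
inductive IsLieMonomial : ZMod 2 → Module.End K (Grassmann K) → Prop
  | gen (i : ℕ) (hi : i < 3) : IsLieMonomial 1 (v K i)
  | bracket (p q : ZMod 2) (a b : Module.End K (Grassmann K)) :
      IsLieMonomial p a → IsLieMonomial q b →
        IsLieMonomial (p + q) (a * b - (-1 : K) ^ (p.val * q.val) • (b * a))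

/-- The Lie superalgebra `Q = Lie(v_0, v_1, v_2)` (in characteristic different from `2`, so that
the formal squares of odd elements need no separate treatment). -/
def Q : Submodule K (Module.End K (Grassmann K)) :=
  Submodule.span K {a | ∃ p, IsLieMonomial K p a}

/-- The associative hull `A = Alg(v_0, v_1, v_2)` of `Q`, with unit. -/
def A : Subalgebra K (Module.End K (Grassmann K)) :=
  Algebra.adjoin K {v K 0, v K 1, v K 2}

/-- The monomial `x_{i_1} ⋯ x_{i_r} v_{j_1} ⋯ v_{j_s}` in `End Λ`, where `α = {i_1 < ⋯ < i_r}` and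
`β = {j_1 < ⋯ < j_s}`; here `x_i` is the operator of left multiplication. -/
def monoA (α β : Finset ℕ) : Module.End K (Grassmann K) :=
  ((α.sort (· ≤ ·)).map fun i => LinearMap.mulLeft K (gx K i)).prod *
    ((β.sort (· ≤ ·)).map fun j => v K j).prod

/-! ### The deformed superalgebra `A^(t)` -/

/-- The homomorphism `Λ → K[t] ⊗ Λ` of `K`-algebras with `x_i ↦ t x_i`. -/
def scaleX : Grassmann K →ₐ[K] Grassmann K[X] :=
  ExteriorAlgebra.lift K
    ⟨((Polynomial.X : K[X]) • ExteriorAlgebra.ι K[X] (M := ℕ →₀ K[X])).restrictScalars K ∘ₗ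
        Finsupp.mapRange.linearMap (Algebra.linearMap K K[X]), fun m => by simp⟩

/-- The action on `K[t] ⊗ Λ` of an element `a = ∑ λ x^α ∂_j` of `Q`, in which every `x_i` is
replaced with the operator of left multiplication by `t x_i`, while the `∂_j` are kept. The
coefficient of `∂_j` in `a` is `a(x_j)`. -/
def deform (a : Module.End K (Grassmann K)) : Module.End K[X] (Grassmann K[X]) :=
  specialDer fun j => scaleX K (a (gx K j))

/-- The deformed superalgebra `A^(t)`: the `K[t]`-algebra of operators on `K[t] ⊗ Λ` that is
generated by the action of `Q`. -/
def At : Subalgebra K[X] (Module.End K[X] (Grassmann K[X])) :=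
  Algebra.adjoin K[X] {b | ∃ a ∈ Q K, deform K a = b}

/-- The deformed monomial: as `monoA`, with `t x_i` for `x_i` and the deformed pivot elements. -/
def monoAt (α β : Finset ℕ) : Module.End K[X] (Grassmann K[X]) :=
  ((α.sort (· ≤ ·)).map fun i =>
      LinearMap.mulLeft K[X] ((Polynomial.X : K[X]) • gx K[X] i)).prod *
    ((β.sort (· ≤ ·)).map fun j => deform K (v K j)).prod

end LieAndAssociative

/-! ### The Poisson superalgebra `P` -/

/-- Indices of the Grassmann variables `x_0, x_1, …, y_0, y_1, …`; every `x_i` precedes every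
`y_j`. -/
abbrev Letter : Type := ℕ ⊕ₗ ℕ

/-- The index of `x_i`. -/
def ix (i : ℕ) : Letter := toLex (Sum.inl i)

/-- The index of `y_i`. -/
def iy (i : ℕ) : Letter := toLex (Sum.inr i)

/-- Formal, possibly infinite, sums `∑_S λ_S e_S` of the monomials `e_S = x^α y^β`, where `e_S` is
the product of the letters of `S` in increasing order, as coefficient functions `S ↦ λ_S`. -/
def FormalSum (K : Type*) : Type _ := Finset Letter → K

section Poisson

variable {K : Type*} [Field K]

instance : AddCommGroup (FormalSum K) := inferInstanceAs (AddCommGroup (Finset Letter → K))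

instance : Module K (FormalSum K) := inferInstanceAs (Module K (Finset Letter → K))

/-- The monomial `e_S`. -/
def single (S : Finset Letter) : FormalSum K := fun T => if T = S then 1 else 0

instance : One (FormalSum K) := ⟨single ∅⟩

/-- The number of transpositions that put `e_S e_T` in increasing order. -/
def inversions (S T : Finset Letter) : ℕ := ((S ×ˢ T).filter fun p => p.2 < p.1).card

/-- The supercommutative product, determined by `e_S e_T = ± e_{S ∪ T}` for disjoint `S`, `T`, the
sign being that of the reordering, and `e_S e_T = 0` otherwise. -/
instance : Mul (FormalSum K) :=
  ⟨fun f g S => ∑ T ∈ S.powerset, (-1) ^ inversions T (S \ T) * f T * g (S \ T)⟩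

/-- The superderivative `∂/∂s` with respect to the letter `s`. -/
def pd (s : Letter) (f : FormalSum K) : FormalSum K := fun S =>
  if s ∈ S then 0 else (-1) ^ (S.filter (· < s)).card * f (insert s S)

/-- The operator `f ↦ (-1)^{|f| - 1} f`. -/
def twist (f : FormalSum K) : FormalSum K := fun S => (-1) ^ (S.card + 1) * f S

/-- The Poisson bracket
`{f, g} = (-1)^{|f| - 1} ∑_i (∂f/∂x_i ∂g/∂y_i + ∂f/∂y_i ∂g/∂x_i)`. For `f` and `g` in the
completion below every coefficient of the sum has only finitely many nonzero contributions. -/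
def bracket (f g : FormalSum K) : FormalSum K := fun S =>
  ∑ᶠ i : ℕ, (pd (ix i) (twist f) * pd (iy i) g + pd (iy i) (twist f) * pd (ix i) g) S

/-- The monomial `x^α y^β` is `1`, or `β ≠ 0` and the largest index of an `x` is smaller than the
largest index of a `y`. -/
def Admissible (S : Finset Letter) : Prop :=
  S = ∅ ∨ ∃ j, iy j ∈ S ∧ ∀ i, ix i ∈ S → i < j

/-- The number of letters `y` in the monomial. -/
def order (S : Finset Letter) : ℕ := (S.filter fun s => (ofLex s).isRight).card

variable (K) in
/-- The completion: formal sums of admissible monomials with bounded order. -/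
def HH : Submodule K (FormalSum K) where
  carrier := {f | (∀ S, f S ≠ 0 → Admissible S) ∧ ∃ k, ∀ S, f S ≠ 0 → order S ≤ k}
  zero_mem' := ⟨fun _ h => absurd rfl h, 0, fun _ h => absurd rfl h⟩
  add_mem' := by
    rintro f g ⟨hf, k, hk⟩ ⟨hg, m, hm⟩
    have key : ∀ S, (f + g) S ≠ 0 → f S ≠ 0 ∨ g S ≠ 0 := by
      intro S h
      by_contra h'
      simp only [not_or, not_not] at h'
      exact h (show f S + g S = 0 by rw [h'.1, h'.2, add_zero])
    exact ⟨fun S h => (key S h).elim (hf S) (hg S), max k m, fun S h =>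
      (key S h).elim (fun h => (hk S h).trans (le_max_left _ _))
        (fun h => (hm S h).trans (le_max_right _ _))⟩
  smul_mem' := by
    rintro c f ⟨hf, k, hk⟩
    have key : ∀ S, (c • f) S ≠ 0 → f S ≠ 0 := fun S h h' =>
      h (show c * f S = 0 by rw [h', mul_zero])
    exact ⟨fun S h => hf S (key S h), k, fun S h => hk S (key S h)⟩

/-- The monomial `x_i x_{i+1} x_{i+3} x_{i+4} ⋯ x_{i+3l-3} x_{i+3l-2} y_{i+3l}`. -/
def pivotTerm (i l : ℕ) : Finset Letter :=
  insert (iy (i + 3 * l))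
    ((Finset.range l).biUnion fun m => {ix (i + 3 * m), ix (i + 3 * m + 1)})

open Classical in
variable (K) in
/-- The pivot element
`V_i = y_i + x_i x_{i+1} (y_{i+3} + x_{i+3} x_{i+4} (y_{i+6} + x_{i+6} x_{i+7} (y_{i+9} + ⋯)))`. -/
def V (i : ℕ) : FormalSum K := fun S => if ∃ l, S = pivotTerm i l then 1 else 0

/-- `M` is a unital Poisson subalgebra of the completion that contains `V_0, V_1, V_2`. -/
structure IsPoissonSubalgebra (M : Submodule K (FormalSum K)) : Prop where
  le : M ≤ HH K
  one_mem : 1 ∈ M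
  gen_mem : ∀ i < 3, V K i ∈ M
  mul_mem : ∀ f ∈ M, ∀ g ∈ M, f * g ∈ M
  bracket_mem : ∀ f ∈ M, ∀ g ∈ M, bracket f g ∈ M

theorem order_split {S T : Finset Letter} (h : T ⊆ S) : order S = order T + order (S \ T) := by
  rw [order, order, order, ← Finset.card_union_of_disjoint
    (Finset.disjoint_filter_filter Finset.disjoint_sdiff), ← Finset.filter_union,
    Finset.union_sdiff_of_subset h]

theorem Admissible.of_split {S T : Finset Letter} (h : T ⊆ S) (h1 : Admissible T)
    (h2 : Admissible (S \ T)) : Admissible S := by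
  rcases h1 with rfl | ⟨j, hj, hj'⟩
  · simpa using h2
  rcases h2 with h2 | ⟨k, hk, hk'⟩
  · have : S = T := Finset.Subset.antisymm (Finset.sdiff_eq_empty_iff_subset.1 h2) h
    exact this ▸ Or.inr ⟨j, hj, hj'⟩
  · have aux : ∀ i, ix i ∈ S → i < j ∨ i < k := fun i hi => by
      by_cases hT : ix i ∈ T
      · exact Or.inl (hj' i hT)
      · exact Or.inr (hk' i (Finset.mem_sdiff.2 ⟨hi, hT⟩))
    rcases le_total j k with hjk | hjk
    · exact Or.inr ⟨k, (Finset.mem_sdiff.1 hk).1, fun i hi => by have := aux i hi; omega⟩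
    · exact Or.inr ⟨j, h hj, fun i hi => by have := aux i hi; omega⟩

/-- The monomials that contribute to a bracket: `T x_i` and `U y_i` give `T U`. -/
theorem Admissible.contract {T U : Finset Letter} {i : ℕ} (h1 : Admissible (insert (ix i) T))
    (h2 : Admissible (insert (iy i) U)) : Admissible (T ∪ U) := by
  rcases h1 with h1 | ⟨j, hj, hj'⟩
  · exact absurd h1 (Finset.insert_ne_empty _ _)
  rcases h2 with h2 | ⟨k, hk, hk'⟩
  · exact absurd h2 (Finset.insert_ne_empty _ _)
  have hij : i < j := hj' i (Finset.mem_insert_self _ _)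
  have hjT : iy j ∈ T := (Finset.mem_insert.1 hj).resolve_left (by simp [ix, iy])
  have aux : ∀ n, ix n ∈ T ∪ U → n < j ∨ n < k := fun n hn => by
    rcases Finset.mem_union.1 hn with h | h
    · exact Or.inl (hj' n (Finset.mem_insert_of_mem h))
    · exact Or.inr (hk' n (Finset.mem_insert_of_mem h))
  rcases le_or_gt k j with hkj | hkj
  · exact Or.inr ⟨j, Finset.mem_union_left _ hjT, fun n hn => by have := aux n hn; omega⟩
  · have hkU : iy k ∈ U := (Finset.mem_insert.1 hk).resolve_left (by
      simp only [iy, toLex_inj, Sum.inr.injEq]; omega)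
    exact Or.inr ⟨k, Finset.mem_union_right _ hkU, fun n hn => by have := aux n hn; omega⟩

theorem order_le_insert (S : Finset Letter) (s : Letter) : order S ≤ order (insert s S) :=
  Finset.card_le_card (Finset.filter_subset_filter _ (Finset.subset_insert _ _))

theorem pd_twist_ne {s : Letter} {f : FormalSum K} {S : Finset Letter}
    (h : pd s (twist f) S ≠ 0) : f (insert s S) ≠ 0 := by
  unfold pd twist at h
  split_ifs at h
  · exact absurd rfl h
  · exact right_ne_zero_of_mul (right_ne_zero_of_mul h)

theorem pd_ne {s : Letter} {f : FormalSum K} {S : Finset Letter}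
    (h : pd s f S ≠ 0) : f (insert s S) ≠ 0 := by
  unfold pd at h
  split_ifs at h
  · exact absurd rfl h
  · exact right_ne_zero_of_mul h

theorem exists_of_mul_ne {f g : FormalSum K} {S : Finset Letter} (h : (f * g) S ≠ 0) :
    ∃ T ⊆ S, f T ≠ 0 ∧ g (S \ T) ≠ 0 := by
  obtain ⟨T, hT, h⟩ := Finset.exists_ne_zero_of_sum_ne_zero h
  exact ⟨T, Finset.mem_powerset.1 hT, right_ne_zero_of_mul (left_ne_zero_of_mul h),
    right_ne_zero_of_mul h⟩

/-- The completion is closed under both operations and contains the pivot elements. -/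
theorem isPoissonSubalgebra_HH : IsPoissonSubalgebra (HH K) where
  le := le_rfl
  one_mem := by
    refine ⟨fun S h => Or.inl ?_, 0, fun S h => ?_⟩
    · by_contra h'
      exact h (if_neg h')
    · have : S = ∅ := by
        by_contra h'
        exact h (if_neg h')
      simp [this, order]
  gen_mem := by
    intro i _
    have key : ∀ S, V K i S ≠ 0 → ∃ l, S = pivotTerm i l := by
      intro S h
      by_contra h'
      exact h (if_neg h')
    refine ⟨fun S h => ?_, 1, fun S h => ?_⟩
    · obtain ⟨l, rfl⟩ := key S h
      refine Or.inr ⟨i + 3 * l, by simp [pivotTerm], fun n hn => ?_⟩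
      simp [pivotTerm, ix, iy] at hn
      omega
    · obtain ⟨l, rfl⟩ := key S h
      refine (Finset.card_le_one_iff (s := _)).2 ?_
      intro a b ha hb
      simp [pivotTerm, ix, iy] at ha hb
      have aux : ∀ c : Letter, (c = toLex (Sum.inr (i + 3 * l)) ∨ ∃ a < l,
          c = toLex (Sum.inl (i + 3 * a)) ∨ c = toLex (Sum.inl (i + 3 * a + 1))) ∧
          (ofLex c).isRight = true → c = toLex (Sum.inr (i + 3 * l)) := by
        rintro c ⟨rfl | ⟨a, _, rfl | rfl⟩, h⟩
        · rfl
        · simp at h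
        · simp at h
      rw [aux a ha, aux b hb]
  mul_mem := by
    rintro f ⟨hf, k, hk⟩ g ⟨hg, m, hm⟩
    refine ⟨fun S h => ?_, k + m, fun S h => ?_⟩
    · obtain ⟨T, hTS, h1, h2⟩ := exists_of_mul_ne h
      exact Admissible.of_split hTS (hf _ h1) (hg _ h2)
    · obtain ⟨T, hTS, h1, h2⟩ := exists_of_mul_ne h
      rw [order_split hTS]
      exact add_le_add (hk _ h1) (hm _ h2)
  bracket_mem := by
    rintro f ⟨hf, k, hk⟩ g ⟨hg, m, hm⟩
    have key : ∀ S, bracket f g S ≠ 0 → ∃ i, ∃ T ⊆ S,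
        (f (insert (ix i) T) ≠ 0 ∧ g (insert (iy i) (S \ T)) ≠ 0) ∨
        (f (insert (iy i) T) ≠ 0 ∧ g (insert (ix i) (S \ T)) ≠ 0) := by
      intro S h
      obtain ⟨i, hi⟩ : ∃ i : ℕ,
          (pd (ix i) (twist f) * pd (iy i) g + pd (iy i) (twist f) * pd (ix i) g) S ≠ 0 := by
        by_contra hc
        simp only [not_exists, not_not] at hc
        exact h ((finsum_congr hc).trans finsum_zero)
      by_cases h1 : (pd (ix i) (twist f) * pd (iy i) g) S = 0
      · have h2 : (pd (iy i) (twist f) * pd (ix i) g) S ≠ 0 := fun h2 => hi (by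
          change (pd (ix i) (twist f) * pd (iy i) g) S + (pd (iy i) (twist f) * pd (ix i) g) S = 0
          rw [h1, h2, add_zero])
        obtain ⟨T, hT, h3, h4⟩ := exists_of_mul_ne h2
        exact ⟨i, T, hT, Or.inr ⟨pd_twist_ne h3, pd_ne h4⟩⟩
      · obtain ⟨T, hT, h3, h4⟩ := exists_of_mul_ne h1
        exact ⟨i, T, hT, Or.inl ⟨pd_twist_ne h3, pd_ne h4⟩⟩
    refine ⟨fun S h => ?_, k + m, fun S h => ?_⟩
    · obtain ⟨i, T, hT, ⟨h1, h2⟩ | ⟨h1, h2⟩⟩ := key S h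
      · have := (hf _ h1).contract (hg _ h2)
        rwa [Finset.union_sdiff_of_subset hT] at this
      · have := (hg _ h2).contract (hf _ h1)
        rwa [Finset.sdiff_union_of_subset hT] at this
    · obtain ⟨i, T, hT, ⟨h1, h2⟩ | ⟨h1, h2⟩⟩ := key S h
      · rw [order_split hT]
        exact add_le_add ((order_le_insert _ _).trans (hk _ h1))
          ((order_le_insert _ _).trans (hm _ h2))
      · rw [order_split hT]
        exact add_le_add ((order_le_insert _ _).trans (hk _ h1))
          ((order_le_insert _ _).trans (hm _ h2))

variable (K) in
/-- The Poisson superalgebra `P = Poisson(V_0, V_1, V_2)`, generated by `V_0, V_1, V_2`. -/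
def P : Submodule K (FormalSum K) := sInf {M | IsPoissonSubalgebra M}

variable (K) in
/-- The even (`p = 0`) or odd (`p = 1`) part of `P`. -/
def Pparity (p : ZMod 2) : Submodule K (P K) where
  carrier := {f | ∀ S, (f : FormalSum K) S ≠ 0 → (S.card : ZMod 2) = p}
  zero_mem' := fun _ h => absurd rfl h
  add_mem' := by
    intro f g hf hg S h
    by_cases h1 : (f : FormalSum K) S = 0
    · by_cases h2 : (g : FormalSum K) S = 0
      · exact absurd (show (f : FormalSum K) S + (g : FormalSum K) S = 0 by rw [h1, h2, add_zero]) h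
      · exact hg S h2
    · exact hf S h1
  smul_mem' := by
    intro c f hf S h
    exact hf S fun h' => h (show c * (f : FormalSum K) S = 0 by rw [h', mul_zero])

/-- The unit of `P`. -/
def Pone : P K := ⟨1, Submodule.mem_sInf.2 fun _ hM => hM.one_mem⟩

/-- The associative product of `P`. -/
def Pmul (f g : P K) : P K :=
  ⟨f * g, Submodule.mem_sInf.2 fun M hM =>
    hM.mul_mem _ (Submodule.mem_sInf.1 f.2 M hM) _ (Submodule.mem_sInf.1 g.2 M hM)⟩

/-- The Poisson bracket of `P`. -/
def Pbracket (f g : P K) : P K :=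
  ⟨bracket f g, Submodule.mem_sInf.2 fun M hM =>
    hM.bracket_mem _ (Submodule.mem_sInf.1 f.2 M hM) _ (Submodule.mem_sInf.1 g.2 M hM)⟩

variable (K) in
/-- The monomial `x_{i_1} ⋯ x_{i_r} V_{j_1} ⋯ V_{j_s}`, where `α = {i_1 < ⋯ < i_r}` and
`β = {j_1 < ⋯ < j_s}`. -/
def monoP (α β : Finset ℕ) : FormalSum K :=
  ((α.sort (· ≤ ·)).map fun i => (single {ix i} : FormalSum K)).prod *
    ((β.sort (· ≤ ·)).map fun j => V K j).prod

end Poisson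

/-! ### Poisson superalgebras and their algebraic quantizations -/

section Quantization

variable (K : Type*) [Field K] {E : Type*} [AddCommGroup E] [Module K E]

/-- The sign `(-1)^{|a||b|}` for `|a| = p`, `|b| = q`. -/
def sgn (p q : ZMod 2) : K := (-1) ^ (p.val * q.val)

/-- `E`, with the parts `𝓔 0` (even) and `𝓔 1` (odd), the unit `e`, the product `mul` and the
bracket `br`, is a Poisson superalgebra over a field `K` of characteristic different from `2`. -/
structure IsPoissonSuperalgebra (𝓔 : ZMod 2 → Submodule K E) (e : E) (mul br : E → E → E) :
    Prop where
  isCompl : IsCompl (𝓔 0) (𝓔 1)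
  mul_bilin : IsBilinearMap K mul
  mul_mem : ∀ p q, ∀ a ∈ 𝓔 p, ∀ b ∈ 𝓔 q, mul a b ∈ 𝓔 (p + q)
  one_mul : ∀ a, mul e a = a
  mul_one : ∀ a, mul a e = a
  mul_assoc : ∀ a b c, mul (mul a b) c = mul a (mul b c)
  mul_comm : ∀ p q, ∀ a ∈ 𝓔 p, ∀ b ∈ 𝓔 q, mul a b = sgn K p q • mul b a
  br_bilin : IsBilinearMap K br
  br_mem : ∀ p q, ∀ a ∈ 𝓔 p, ∀ b ∈ 𝓔 q, br a b ∈ 𝓔 (p + q)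
  br_anticomm : ∀ p q, ∀ a ∈ 𝓔 p, ∀ b ∈ 𝓔 q, br a b = -(sgn K p q • br b a)
  br_jacobi : ∀ p q, ∀ a ∈ 𝓔 p, ∀ b ∈ 𝓔 q, ∀ c,
    br a (br b c) = br (br a b) c + sgn K p q • br b (br a c)
  /-- needed as an axiom in characteristic `3` only, and a consequence of the others otherwise -/
  br_odd : ∀ a ∈ 𝓔 1, br a (br a a) = 0
  leibniz : ∀ p q, ∀ a, ∀ b ∈ 𝓔 p, ∀ c ∈ 𝓔 q,
    br (mul a b) c = mul a (br b c) + sgn K p q • mul (br a c) b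

/-- The constant polynomial `a ∈ E ⊆ E[t]`. -/
abbrev const (a : E) : PolynomialModule K E := PolynomialModule.single K 0 a

/-- The parts `𝓔 p [t]` of `E[t]`. -/
def polyParity (𝓔 : ZMod 2 → Submodule K E) (p : ZMod 2) : Set (PolynomialModule K E) :=
  {f | ∀ n, f.coeff n ∈ 𝓔 p}

/-- The product `star` on `E[t]` is an algebraic quantization of the Poisson superalgebra `E`. -/
structure IsAlgebraicQuantization (𝓔 : ZMod 2 → Submodule K E) (e : E) (mul br : E → E → E)
    (star : PolynomialModule K E → PolynomialModule K E → PolynomialModule K E) : Prop where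
  poisson : IsPoissonSuperalgebra K 𝓔 e mul br
  bilin : IsBilinearMap K star
  assoc : ∀ f g h, star (star f g) h = star f (star g h)
  graded : ∀ p q, ∀ f ∈ polyParity K 𝓔 p, ∀ g ∈ polyParity K 𝓔 q,
    star f g ∈ polyParity K 𝓔 (p + q)
  mod_t : ∀ a b : E, ∃ r : PolynomialModule K E,
    star (const K a) (const K b) = const K (mul a b) + (Polynomial.X : K[X]) • r
  mod_t_sq : ∀ p q, ∀ a ∈ 𝓔 p, ∀ b ∈ 𝓔 q, ∃ r : PolynomialModule K E,
    star (const K a) (const K b) - sgn K p q • star (const K b) (const K a) =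
      (Polynomial.X : K[X]) • const K (br a b) + (Polynomial.X ^ 2 : K[X]) • r
  star_t : ∀ f, star f ((Polynomial.X : K[X]) • const K e) = (Polynomial.X : K[X]) • f
  t_star : ∀ f, star ((Polynomial.X : K[X]) • const K e) f = (Polynomial.X : K[X]) • f

end Quantization

end FractalSuper

end

noncomputable section

namespace FractalSuper

/-! ### Ordered products -/

/-! The relations between multiplications, derivatives and pivot elements depend on one parameter
`τ`, the value of the supercommutator of `D i` and `X i`. They are collected in `Pivot`. For `τ = 1`
they hold for the operators that generate `A`, for `τ = t` for those that generate `At`, and for `τ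
= 0` for the formal sums `x_i`, `y_i`, `V_i`. Whatever is deduced from `Pivot` alone holds in all
three settings with the same index sets.

A common basis. The recursion for `v i` shows that the supercommutator of two elements `x^α v_n` is
`τ` times a combination of such elements (`Pivot.vX_tail`, `Pivot.vv`, `Pivot.elt_bracket`). A
straightening argument (`Pivot.elt_mul_mono`, `Pivot.adjoin_eq_span`) then shows that the algebra
generated by a family of elements `x^α v_n` is spanned by the ordered monomials assembled from it,
provided the family is closed in the sense of `Closed`. The family used is `LieIndex`: a restriction
on the largest letters of `α`, and an inequality saying that the degree in `v_0` is not negative. It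
is closed (`closed_index`), and since `2` is invertible, explicit brackets produce all its elements
from `v_0, v_1, v_2` (`Generating.of_lieIndex`). The ordered monomials are linearly independent: for
operators by evaluation on suitable monomials of the Grassmann algebra, for formal sums by
comparison of leading terms. Hence `P`, `A` and `At` have bases with the same index set, and `Ψ` and
`Φ` match these bases.

The quantization. Let `t` act on formal sums by zero. Then the pairs (formal sum, operator over
`K[t]`) again satisfy `Pivot` with `τ = t`, so the span `Quant` of the paired monomials is closed
under multiplication (`quant_mul`). By independence, `Quant` is the graph of the map that sets `t =
0` in the expansion of an operator. Thus the operator product reduces to the supercommutative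
product modulo `t`. For two pairs in `Quant`, homogeneous for the grading, the supercommutator of
the operators is `t h`, where `h` is paired with the Poisson bracket of the formal sums. This is
checked on generators and spreads because both sides are derivations in each argument
(`Brackets.mul`, `brackets_mono_mono`). As `t` can be cancelled, the Jacobi identity for the bracket
on `P`, and the closure of the span under it, follow from the corresponding facts about operators.
-/

/-- The product of the `x i`, `i ∈ s`, in increasing order of indices. -/
def ordProd {B : Type*} [Monoid B] (x : ℕ → B) (s : Finset ℕ) : B :=
  ((s.sort (· ≤ ·)).map x).prod

section OrdProd

variable {B : Type*} [Monoid B] (x : ℕ → B)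

@[simp] theorem ordProd_empty : ordProd x ∅ = 1 := by simp [ordProd]

@[simp] theorem ordProd_singleton (i : ℕ) : ordProd x {i} = x i := by simp [ordProd]

theorem ordProd_insert {a : ℕ} {s : Finset ℕ} (h : ∀ b ∈ s, a < b) :
    ordProd x (insert a s) = x a * ordProd x s := by
  rw [ordProd, Finset.sort_insert (r := (· ≤ ·)) (fun b hb => (h b hb).le)
    fun ha => lt_irrefl _ (h a ha), List.map_cons, List.prod_cons, ordProd]

theorem map_ordProd {C : Type*} [Monoid C] (f : B →* C) (s : Finset ℕ) :
    f (ordProd x s) = ordProd (fun i => f (x i)) s := by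
  rw [ordProd, map_list_prod, List.map_map]
  rfl

end OrdProd

/-! ### The combinatorics of the pivot elements -/

/-- The indices `n, n + 1, n + 3, n + 4, …, n + 3 l - 3, n + 3 l - 2`. -/
def tail : ℕ → ℕ → Finset ℕ
  | _, 0 => ∅
  | n, l + 1 => insert n (insert (n + 1) (tail (n + 3) l))

/-- The monomial in the supercommutator of `v_j` and `v_{j+d}`. -/
def brX : ℕ → ℕ → Finset ℕ
  | j, 0 => {j + 1}
  | j, 1 => {j}
  | j, 2 => insert j (insert (j + 1) {j + 2})
  | j, d + 3 => insert j (insert (j + 1) (brX (j + 3) d))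

/-- The index of the pivot element in the supercommutator of `v_j` and `v_{j+d}`. -/
def brM : ℕ → ℕ → ℕ
  | j, 0 => j + 3
  | j, 1 => j + 3
  | j, 2 => j + 5
  | j, d + 3 => brM (j + 3) d

theorem mem_tail {n l i : ℕ} (h : i ∈ tail n l) : n ≤ i ∧ i + 2 ≤ n + 3 * l := by
  induction l generalizing n with
  | zero => simp [tail] at h
  | succ l ih =>
    simp only [tail, Finset.mem_insert] at h
    rcases h with rfl | rfl | h
    · omega
    · omega
    · have := ih h
      omega

theorem mem_tail_self (n l : ℕ) : n ∈ tail n (l + 1) := by simp [tail]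

theorem le_of_mem_brX {j d i : ℕ} (h : i ∈ brX j d) : j ≤ i := by
  induction j, d using brX.induct with
  | case1 j => simp [brX] at h; omega
  | case2 j => simp [brX] at h; omega
  | case3 j => simp [brX] at h; omega
  | case4 j d ih =>
    simp only [brX, Finset.mem_insert] at h
    rcases h with rfl | rfl | h
    · omega
    · omega
    · have := ih h
      omega

/-- The alternatives are the residues `0, 1, 2` of `d` modulo `3`. Measured from `m = brM j d`, the
first says `i + 5 ≤ m` or `i + 2 = m`, and the other two say `i + 3 ≤ m`. These are the two shapes
allowed by `LieIndex`. -/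
theorem brX_bound (j d : ℕ) :
    (brM j d = j + d + 3 ∧ ∀ i ∈ brX j d, i + 2 ≤ j + d ∨ i = j + d + 1) ∨
    (0 < d ∧ brM j d = j + d + 2 ∧ ∀ i ∈ brX j d, i + 1 ≤ j + d) ∨
    (0 < d ∧ brM j d = j + d + 3 ∧ ∀ i ∈ brX j d, i ≤ j + d) := by
  induction j, d using brX.induct with
  | case1 j => left; simp [brM, brX]
  | case2 j => right; left; simp [brM, brX]
  | case3 j => right; right; simp [brM, brX]
  | case4 j d ih =>
    simp only [brM, brX, Finset.mem_insert, forall_eq_or_imp]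
    rcases ih with ⟨h1, h2⟩ | ⟨h0, h1, h2⟩ | ⟨h0, h1, h2⟩
    · refine Or.inl ⟨by omega, by omega, by omega, fun i hi => ?_⟩
      have := h2 i hi
      omega
    · refine Or.inr (Or.inl ⟨by omega, by omega, by omega, by omega, fun i hi => ?_⟩)
      have := h2 i hi
      omega
    · refine Or.inr (Or.inr ⟨by omega, by omega, by omega, by omega, fun i hi => ?_⟩)
      have := h2 i hi
      omega

/-! ### Abstract pivot elements -/

/-- Elements `X i`, `D i`, `v i` of an algebra that satisfy the relations of `τ x_i`, `∂_i` and
the pivot elements. -/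
structure Pivot {R B : Type*} [CommRing R] [Ring B] [Algebra R B] (τ : R) (X D v : ℕ → B) :
    Prop where
  XX : ∀ i j, X i * X j = -(X j * X i)
  X_sq : ∀ i, X i * X i = 0
  DX : ∀ i j, i ≠ j → D i * X j = -(X j * D i)
  DX_self : ∀ i, D i * X i = τ • 1 - X i * D i
  D_sq : ∀ i, D i * D i = 0
  Dv : ∀ i j, i < j → D i * v j = -(v j * D i)
  vX : ∀ i j, i < j → v j * X i = -(X i * v j)
  v_eq : ∀ i, v i = D i + X i * X (i + 1) * v (i + 3)

namespace Pivot

variable {R B : Type*} [CommRing R] [Ring B] [Algebra R B] {τ : R} {X D v : ℕ → B}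

theorem X_sq_mul (h : Pivot τ X D v) (i : ℕ) (b : B) : X i * (X i * b) = 0 := by
  rw [← mul_assoc, h.X_sq, zero_mul]

/-- Only the summand `D j` of `v j` interacts with `X j`. The other summand already contains `X j`,
which anticommutes with its remaining factors and has square zero. -/
theorem vX_self (h : Pivot τ X D v) (j : ℕ) : v j * X j = τ • 1 - X j * v j := by
  have e1 : X j * v j = X j * D j := by
    rw [h.v_eq j, mul_add, mul_assoc (X j), h.X_sq_mul, add_zero]
  have e2 : X j * X (j + 1) * v (j + 3) * X j = 0 := by
    rw [mul_assoc, h.vX j (j + 3) (by omega), mul_neg, mul_assoc, ← mul_assoc (X (j + 1)),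
      h.XX (j + 1) j, neg_mul, mul_assoc, mul_neg, h.X_sq_mul]
    simp
  rw [e1, h.v_eq j, add_mul, e2, add_zero, h.DX_self]

theorem vX_succ (h : Pivot τ X D v) (j : ℕ) : v j * X (j + 1) = -(X (j + 1) * v j) := by
  have e1 : X j * X (j + 1) * v (j + 3) * X (j + 1) = 0 := by
    rw [mul_assoc, h.vX (j + 1) (j + 3) (by omega), mul_neg, mul_assoc, h.X_sq_mul]
    simp
  have e2 : X (j + 1) * (X j * X (j + 1) * v (j + 3)) = 0 := by
    rw [h.XX j (j + 1), neg_mul, mul_neg, mul_assoc, h.X_sq_mul, neg_zero]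
  rw [h.v_eq j, add_mul, mul_add, e1, e2, add_zero, add_zero, h.DX _ _ (by omega)]

theorem vX_two (h : Pivot τ X D v) (j : ℕ) : v j * X (j + 2) = -(X (j + 2) * v j) := by
  rw [h.v_eq j, add_mul, mul_add, h.DX _ _ (by omega), mul_assoc, h.vX (j + 2) (j + 3) (by omega),
    mul_neg, ← mul_assoc, mul_assoc (X j), h.XX (j + 1), mul_neg, ← mul_assoc (X j), h.XX j (j + 2)]
  noncomm_ring

/-- `D j` anticommutes with `X k`, and the even product `X j * X (j + 1)` commutes with it, so the
anticommutator is passed on to `v (j + 3)`. -/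
theorem vX_rec (h : Pivot τ X D v) (j k : ℕ) (hk : j + 2 < k) :
    v j * X k + X k * v j = X j * X (j + 1) * (v (j + 3) * X k + X k * v (j + 3)) := by
  have e : X k * (X j * X (j + 1)) = X j * X (j + 1) * X k := by
    rw [← mul_assoc, h.XX k j, neg_mul, mul_assoc, h.XX k (j + 1), mul_neg, neg_neg, mul_assoc]
  conv_lhs => rw [h.v_eq j]
  rw [add_mul, mul_add, h.DX _ _ (by omega), ← mul_assoc (X k), e]
  noncomm_ring

theorem vX_anti (h : Pivot τ X D v) (j k : ℕ) (hk : ∀ l, k ≠ j + 3 * l) :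
    v j * X k = -(X k * v j) := by
  rcases lt_or_ge k j with hlt | hle
  · exact h.vX _ _ hlt
  obtain ⟨d, rfl⟩ := Nat.exists_eq_add_of_le hle
  clear hle
  induction d using Nat.strong_induction_on generalizing j with
  | _ d ih =>
    match d with
    | 0 => exact absurd rfl (hk 0)
    | 1 => exact h.vX_succ j
    | 2 => exact h.vX_two j
    | d + 3 =>
      have e : j + (d + 3) = (j + 3) + d := by ring
      have h1 := ih d (by omega) (j + 3) (fun l hl => hk (l + 1) (by omega))
      rw [← e] at h1
      rw [eq_neg_iff_add_eq_zero] at h1 ⊢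
      rw [h.vX_rec _ _ (by omega), h1, mul_zero]

theorem ordProd_pair (x : ℕ → B) {j : ℕ} {s : Finset ℕ} (hs : ∀ i ∈ s, j + 1 < i) :
    ordProd x (insert j (insert (j + 1) s)) = x j * x (j + 1) * ordProd x s := by
  rw [ordProd_insert, ordProd_insert _ hs, mul_assoc]
  intro b hb
  rcases Finset.mem_insert.1 hb with rfl | hb
  · omega
  · have := hs b hb
    omega

/-- After `l` unrollings of `v j` the pivot that meets `X (j + 3 * l)` has the same index. The
factors collected on the way are the coefficient of `D (j + 3 * l)` in `v j`. -/
theorem vX_tail (h : Pivot τ X D v) (j l : ℕ) :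
    v j * X (j + 3 * l) + X (j + 3 * l) * v j = τ • ordProd X (tail j l) := by
  induction l generalizing j with
  | zero => simp [tail, h.vX_self]
  | succ l ih =>
    have e : j + 3 * (l + 1) = j + 3 + 3 * l := by ring
    rw [h.vX_rec _ _ (by omega), e, ih, tail, ordProd_pair, mul_smul_comm]
    intro i hi
    have := mem_tail hi
    omega

/-- Both summands of `v j` have square zero. What is left is their anticommutator, in which `D j`
removes the factor `X j`. The square is computed directly and not through the anticommutator of `v
j` with itself, so no division by `2` occurs. -/
theorem v_sq (h : Pivot τ X D v) (j : ℕ) : v j * v j = τ • (X (j + 1) * v (j + 3)) := by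
  have e1 : D j * v j = τ • (X (j + 1) * v (j + 3)) - X j * X (j + 1) * v (j + 3) * D j := by
    rw [h.v_eq j, mul_add, h.D_sq, zero_add, ← mul_assoc, ← mul_assoc, h.DX_self, sub_mul, sub_mul,
      smul_mul_assoc, smul_mul_assoc, one_mul, mul_assoc (X j), h.DX _ _ (by omega), mul_neg,
      neg_mul, sub_neg_eq_add, mul_assoc (X j * _), mul_assoc (X j), mul_assoc (X (j + 1)),
      h.Dv j (j + 3) (by omega)]
    noncomm_ring
  have e2 : X j * X (j + 1) * v (j + 3) * v j = X j * X (j + 1) * v (j + 3) * D j := by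
    have e3 : v (j + 3) * (X j * X (j + 1) * v (j + 3)) =
        X j * (X (j + 1) * (v (j + 3) * v (j + 3))) := by
      rw [← mul_assoc, ← mul_assoc, h.vX _ _ (by omega), neg_mul, mul_assoc (X j),
        h.vX _ _ (by omega)]
      noncomm_ring
    have e4 (b : B) : X j * X (j + 1) * (X j * b) = 0 := by
      rw [← mul_assoc, mul_assoc (X j), h.XX (j + 1) j, mul_neg, h.X_sq_mul, neg_zero, zero_mul]
    have e5 : X j * X (j + 1) * v (j + 3) * (X j * X (j + 1) * v (j + 3)) = 0 := by
      rw [mul_assoc _ (v (j + 3)), e3, e4]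
    conv_lhs => rw [h.v_eq j, mul_add, e5, add_zero]
  conv_lhs => rw [h.v_eq j, add_mul]
  rw [← h.v_eq j, e1, e2, sub_add_cancel]

theorem Dv_pair (h : Pivot τ X D v) (j k : ℕ) (hk : j < k) :
    v j * v k + v k * v j =
      X j * X (j + 1) * v (j + 3) * v k + v k * (X j * X (j + 1) * v (j + 3)) := by
  conv_lhs => rw [h.v_eq j, add_mul, mul_add, h.Dv j k hk]
  noncomm_ring

theorem vv_rec (h : Pivot τ X D v) (j k : ℕ) (hk : j + 1 < k) :
    v j * v k + v k * v j = X j * X (j + 1) * (v (j + 3) * v k + v k * v (j + 3)) := by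
  rw [h.Dv_pair j k (by omega), ← mul_assoc, ← mul_assoc, h.vX j k (by omega), neg_mul,
    mul_assoc (X j) (v k), h.vX (j + 1) k hk]
  noncomm_ring

/-- The only surviving contribution comes from `v (j + 1)` acting on the factor `X (j + 1)` of `v
j`. The rest is `X j * X (j + 1)` times the anticommutator of `v (j + 1)` and `v (j + 3)`, which
itself starts with `X (j + 1)`. -/
theorem vv_succ (h : Pivot τ X D v) (j : ℕ) :
    v j * v (j + 1) + v (j + 1) * v j = -(τ • (X j * v (j + 3))) := by
  have e1 : v (j + 1) * (X j * X (j + 1) * v (j + 3)) =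
      -(τ • (X j * v (j + 3))) + X j * X (j + 1) * v (j + 1) * v (j + 3) := by
    rw [← mul_assoc, ← mul_assoc, h.vX _ _ (by omega), neg_mul, mul_assoc (X j), h.vX_self,
      mul_sub, mul_smul_comm, mul_one, neg_sub, sub_mul, smul_mul_assoc]
    noncomm_ring
  have e2 : X j * X (j + 1) * (v (j + 1) * v (j + 3) + v (j + 3) * v (j + 1)) = 0 := by
    rw [h.vv_rec (j + 1) (j + 3) (by omega), mul_assoc (X j), mul_assoc (X (j + 1)), h.X_sq_mul,
      mul_zero]
  rw [h.Dv_pair j _ (by omega), e1]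
  rw [mul_add, ← mul_assoc, ← mul_assoc] at e2
  rw [add_left_comm, add_comm (X j * X (j + 1) * v (j + 3) * v (j + 1)), e2, add_zero]

/-- Unrolling the pivot of smaller index lowers `d` by `3`. The base cases are a square, counted
twice, two neighbours, and `d = 2`, where one unrolling leaves the neighbours `j + 2`, `j + 3`. This
explains the factors `2` and `-1`. -/
theorem vv (h : Pivot τ X D v) (j d : ℕ) :
    v j * v (j + d) + v (j + d) * v j =
      ((if 3 ∣ d then 2 else -1 : R) * τ) • (ordProd X (brX j d) * v (brM j d)) := by
  induction j, d using brX.induct with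
  | case1 j =>
    simp only [add_zero, h.v_sq, brX, brM, ordProd_singleton, dvd_zero, if_true]
    rw [two_mul, add_smul]
  | case2 j => simp [h.vv_succ, brX, brM]
  | case3 j =>
    rw [h.vv_rec _ _ (by omega), add_comm (v (j + 3) * _), h.vv_succ (j + 2)]
    simp only [brX, brM]
    rw [ordProd_pair]
    · simp [mul_assoc]
    · simp
  | case4 j d ih =>
    have e : j + (d + 3) = j + 3 + d := by ring
    rw [h.vv_rec _ _ (by omega), e, ih]
    simp only [brX, brM]
    rw [ordProd_pair]
    · have e' : 3 ∣ d.succ.succ.succ ↔ 3 ∣ d := by omega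
      simp only [e', mul_smul_comm, mul_assoc]
    · intro i hi
      have := le_of_mem_brX hi
      omega

end Pivot
end FractalSuper

namespace FractalSuper

namespace Pivot

variable {R B : Type*} [CommRing R] [Ring B] [Algebra R B] {τ : R} {X D v : ℕ → B}

/-! ### Products of monomials -/

theorem X_mul_ordProd_of_mem (h : Pivot τ X D v) {i : ℕ} {α : Finset ℕ} (hi : i ∈ α) :
    X i * ordProd X α = 0 := by
  induction α using Finset.induction_on_min with
  | empty => simp at hi
  | insert a s hs ih =>
    rw [ordProd_insert _ hs]
    rcases Finset.mem_insert.1 hi with rfl | hi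
    · exact h.X_sq_mul _ _
    · rw [← mul_assoc, h.XX, neg_mul, mul_assoc, ih hi, mul_zero, neg_zero]

theorem X_mul_ordProd (h : Pivot τ X D v) {i : ℕ} {α : Finset ℕ} (hi : i ∉ α) :
    ∃ k : ℕ, X i * ordProd X α = (-1 : R) ^ k • ordProd X (insert i α) := by
  induction α using Finset.induction_on_min with
  | empty => exact ⟨0, by simp⟩
  | insert a s hs ih =>
    rw [Finset.mem_insert, not_or] at hi
    obtain ⟨k, hk⟩ := ih hi.2
    rcases lt_or_gt_of_ne hi.1 with hlt | hgt
    · refine ⟨0, ?_⟩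
      rw [ordProd_insert X (a := i), pow_zero, one_smul]
      intro b hb
      rcases Finset.mem_insert.1 hb with rfl | hb
      · exact hlt
      · exact hlt.trans (hs b hb)
    · refine ⟨k + 1, ?_⟩
      rw [ordProd_insert _ hs, ← mul_assoc, h.XX, neg_mul, mul_assoc, hk, Finset.insert_comm,
        ordProd_insert X (a := a), mul_smul_comm, pow_succ, mul_neg_one, neg_smul]
      intro b hb
      rcases Finset.mem_insert.1 hb with rfl | hb
      · exact hgt
      · exact hs b hb

theorem ordProd_mul (h : Pivot τ X D v) {α β : Finset ℕ} (hd : Disjoint α β) :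
    ∃ k : ℕ, ordProd X α * ordProd X β = (-1 : R) ^ k • ordProd X (α ∪ β) := by
  induction α using Finset.induction_on_min with
  | empty => exact ⟨0, by simp⟩
  | insert a s hs ih =>
    rw [Finset.disjoint_insert_left] at hd
    obtain ⟨k, hk⟩ := ih hd.2
    have ha : a ∉ s ∪ β := by
      rw [Finset.mem_union, not_or]
      exact ⟨fun ha => lt_irrefl _ (hs a ha), hd.1⟩
    obtain ⟨l, hl⟩ := h.X_mul_ordProd ha
    refine ⟨k + l, ?_⟩
    rw [ordProd_insert _ hs, mul_assoc, hk, mul_smul_comm, hl, smul_smul, pow_add,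
      Finset.insert_union]

theorem ordProd_mul_eq_zero (h : Pivot τ X D v) {α β : Finset ℕ} (hd : ¬ Disjoint α β) :
    ordProd X α * ordProd X β = 0 := by
  induction α using Finset.induction_on_min with
  | empty => simp at hd
  | insert a s hs ih =>
    rw [ordProd_insert _ hs, mul_assoc]
    by_cases hd' : Disjoint s β
    · have ha : a ∈ β := by
        by_contra ha
        exact hd (Finset.disjoint_insert_left.2 ⟨ha, hd'⟩)
      obtain ⟨k, hk⟩ := h.ordProd_mul hd'
      rw [hk, mul_smul_comm, h.X_mul_ordProd_of_mem (Finset.mem_union_right _ ha), smul_zero]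
    · rw [ih hd', mul_zero]

theorem ordProd_mul_mem (h : Pivot τ X D v) (α β : Finset ℕ) :
    ordProd X α * ordProd X β ∈ Submodule.span R {ordProd X (α ∪ β)} := by
  by_cases hd : Disjoint α β
  · obtain ⟨k, hk⟩ := h.ordProd_mul hd
    exact hk ▸ Submodule.smul_mem _ _ (Submodule.mem_span_singleton_self _)
  · rw [h.ordProd_mul_eq_zero hd]
    exact zero_mem _

theorem mul_ordProd_of_anti {u : B} {α : Finset ℕ} (hu : ∀ i ∈ α, u * X i = -(X i * u)) :
    u * ordProd X α = (-1 : R) ^ α.card • (ordProd X α * u) := by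
  induction α using Finset.induction_on_min with
  | empty => simp
  | insert a s hs ih =>
    rw [ordProd_insert _ hs, ← mul_assoc, hu _ (Finset.mem_insert_self _ _), neg_mul, mul_assoc,
      ih fun i hi => hu i (Finset.mem_insert_of_mem hi),
      Finset.card_insert_of_notMem fun ha => lt_irrefl _ (hs a ha), pow_succ, mul_neg_one,
      neg_smul, mul_smul_comm, mul_assoc]

theorem v_mul_ordProd (h : Pivot τ X D v) {n : ℕ} {α : Finset ℕ} (hn : ∀ i ∈ α, i < n) :
    v n * ordProd X α = (-1 : R) ^ α.card • (ordProd X α * v n) :=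
  mul_ordProd_of_anti fun i hi => h.vX _ _ (hn i hi)

theorem ordProd_comm (h : Pivot τ X D v) (α β : Finset ℕ) :
    ordProd X α * ordProd X β = (-1 : R) ^ (α.card * β.card) • (ordProd X β * ordProd X α) := by
  induction α using Finset.induction_on_min with
  | empty => simp
  | insert a s hs ih =>
    rw [ordProd_insert _ hs, mul_assoc, ih, mul_smul_comm, ← mul_assoc,
      mul_ordProd_of_anti (R := R) (fun i _ => h.XX a i), smul_mul_assoc, smul_smul,
      Finset.card_insert_of_notMem fun ha => lt_irrefl _ (hs a ha), ← pow_add, mul_assoc,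
      add_mul, one_mul]

/-- The supercommutator of `v n` with a monomial. -/
theorem v_ordProd_mem (h : Pivot τ X D v) (n : ℕ) (α : Finset ℕ) :
    ∃ d ∈ Submodule.span R {b : B | ∃ l, n + 3 * l ∈ α ∧
        b = ordProd X (α.erase (n + 3 * l) ∪ tail n l)},
      v n * ordProd X α = (-1 : R) ^ α.card • (ordProd X α * v n) + τ • d := by
  induction α using Finset.induction_on_min with
  | empty => exact ⟨0, zero_mem _, by simp⟩
  | insert a s hs ih =>
    obtain ⟨d, hd, e⟩ := ih
    have has : a ∉ s := fun ha => lt_irrefl _ (hs a ha)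
    have hd' : X a * d ∈ Submodule.span R {b : B | ∃ l, n + 3 * l ∈ insert a s ∧
        b = ordProd X ((insert a s).erase (n + 3 * l) ∪ tail n l)} := by
      refine Submodule.span_induction (p := fun d _ => X a * d ∈ _) ?_ ?_ ?_ ?_ hd
      · rintro _ ⟨l, hl, rfl⟩
        have hne : a ≠ n + 3 * l := fun e => has (e ▸ hl)
        by_cases ha : a ∈ s.erase (n + 3 * l) ∪ tail n l
        · rw [h.X_mul_ordProd_of_mem ha]
          exact zero_mem _
        · obtain ⟨k, hk⟩ := h.X_mul_ordProd ha
          rw [hk]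
          refine Submodule.smul_mem _ _ (Submodule.subset_span
            ⟨l, Finset.mem_insert_of_mem hl, ?_⟩)
          rw [Finset.erase_insert_of_ne hne, Finset.insert_union]
      · simp
      · intro x y _ _ hx hy
        rw [mul_add]
        exact add_mem hx hy
      · intro r x _ hx
        rw [mul_smul_comm]
        exact Submodule.smul_mem _ _ hx
    have key : v n * (X a * ordProd X s) = (v n * X a + X a * v n) * ordProd X s -
        (τ • (X a * d) + (-1 : R) ^ s.card • (X a * ordProd X s * v n)) := by
      rw [add_mul, mul_assoc, mul_assoc (X a) (v n), e]
      simp only [mul_add, mul_smul_comm, mul_assoc]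
      abel
    rw [ordProd_insert _ hs, Finset.card_insert_of_notMem has]
    -- `v n` fails to anticommute with `X a` at most when `∂_a` occurs in `v n`.
    by_cases hl : ∃ l, a = n + 3 * l
    · obtain ⟨l, rfl⟩ := hl
      refine ⟨ordProd X (tail n l) * ordProd X s - X (n + 3 * l) * d,
        sub_mem ?_ hd', ?_⟩
      · have := h.ordProd_mul_mem (tail n l) s
        refine Submodule.span_mono ?_ this
        rintro _ rfl
        exact ⟨l, Finset.mem_insert_self _ _, by rw [Finset.erase_insert has, Finset.union_comm]⟩
      · rw [key, h.vX_tail, smul_mul_assoc, smul_sub, pow_succ, mul_neg_one, neg_smul]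
        abel
    · push Not at hl
      refine ⟨-(X a * d), neg_mem hd', ?_⟩
      rw [key, h.vX_anti n a hl, neg_add_cancel, zero_mul, zero_sub, pow_succ, mul_neg_one,
        neg_smul, smul_neg]
      abel

/-- The elements `x^α v_n`. -/
abbrev elt (X v : ℕ → B) (α : Finset ℕ) (n : ℕ) : B := ordProd X α * v n

/-- The monomials `x^α v^β`. -/
abbrev mono (X v : ℕ → B) (α β : Finset ℕ) : B := ordProd X α * ordProd v β

/-- The supercommutator of two monomials of degree one. -/
theorem elt_bracket (h : Pivot τ X D v) {α β : Finset ℕ} {n d : ℕ} (hα : ∀ i ∈ α, i < n)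
    {c : B} (hc : v n * ordProd X β = (-1 : R) ^ β.card • (ordProd X β * v n) + τ • c) :
    elt X v α n * elt X v β (n + d) -
      (-1 : R) ^ ((α.card + 1) * (β.card + 1)) • (elt X v β (n + d) * elt X v α n) =
    τ • (ordProd X α * c * v (n + d)) +
      ((-1 : R) ^ β.card * ((if 3 ∣ d then 2 else -1) * τ)) •
        (ordProd X α * ordProd X β * (ordProd X (brX n d) * v (brM n d))) := by
  have e1 : elt X v α n * elt X v β (n + d) =
      (-1 : R) ^ β.card • (ordProd X α * ordProd X β * (v n * v (n + d))) +
        τ • (ordProd X α * c * v (n + d)) := by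
    simp only [elt]
    rw [mul_assoc, ← mul_assoc (v n), hc]
    simp only [mul_add, add_mul, smul_mul_assoc, mul_smul_comm, mul_assoc]
  have e2 : elt X v β (n + d) * elt X v α n =
      (-1 : R) ^ (α.card + α.card * β.card) •
        (ordProd X α * ordProd X β * (v (n + d) * v n)) := by
    simp only [elt]
    rw [mul_assoc, ← mul_assoc (v (n + d)), h.v_mul_ordProd (fun i hi => (hα i hi).trans_le (by omega)),
      smul_mul_assoc, mul_smul_comm, mul_assoc (ordProd X α) (v (n + d)), ← mul_assoc (ordProd X β),
      h.ordProd_comm β α, smul_mul_assoc, smul_smul, ← pow_add, mul_comm β.card]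
  -- The sign of the supercommutator and the signs of reordering combine so that `v n` and `v (n +
  -- d)` appear in their anticommutator.
  have e3 : (-1 : R) ^ ((α.card + 1) * (β.card + 1)) * (-1) ^ (α.card + α.card * β.card) =
      -(-1 : R) ^ β.card := by
    rw [← pow_add, show (α.card + 1) * (β.card + 1) + (α.card + α.card * β.card) =
      2 * (α.card + α.card * β.card) + (β.card + 1) by ring, pow_add, pow_mul, neg_one_sq, one_pow,
      one_mul, pow_succ, mul_neg_one]
  rw [e1, e2, smul_smul, e3, mul_smul, ← mul_smul_comm (_ * τ), ← h.vv, neg_smul, mul_add, smul_add]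
  abel

end Pivot
end FractalSuper

/-! ### Straightening products into ordered monomials. -/

namespace FractalSuper

/-- Closure properties of a set `J` of elements `x^α v_n` and a set `I` of monomials `x^α v^β`
under which the span of `I` is the algebra generated by `J`. -/
structure Closed (J : Finset ℕ → ℕ → Prop) (I : Finset ℕ → Finset ℕ → Prop) : Prop where
  lt : ∀ {α n i}, J α n → i ∈ α → i < n
  br : ∀ {α β n d}, J α n → J β (n + d) → J (α ∪ β ∪ brX n d) (brM n d)
  der : ∀ {α β n d l}, J α n → J β (n + d) → n + 3 * l ∈ β →
    J (α ∪ (β.erase (n + 3 * l) ∪ tail n l)) (n + d)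
  nil : I ∅ ∅
  ins : ∀ {α α' n β}, n ∉ β → J α n → I α' β → I (α ∪ α') (insert n β)
  der' : ∀ {α α' n β l}, J α n → I α' β → n + 3 * l ∈ α' →
    I (α ∪ (α'.erase (n + 3 * l) ∪ tail n l)) β
  split : ∀ {α b β}, (∀ c ∈ β, b < c) → I α (insert b β) →
    ∃ α₁ α₂, Disjoint α₁ α₂ ∧ α = α₁ ∪ α₂ ∧ J α₁ b ∧ I α₂ β

namespace Pivot

variable {R B : Type*} [CommRing R] [Ring B] [Algebra R B] {τ : R} {X D v : ℕ → B}
  {J : Finset ℕ → ℕ → Prop} {I : Finset ℕ → Finset ℕ → Prop}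

variable (R) in
/-- The span of the elements `x^α v_n` from `J`. -/
def eltSpan (X v : ℕ → B) (J : Finset ℕ → ℕ → Prop) : Submodule R B :=
  Submodule.span R {b | ∃ α n, J α n ∧ b = elt X v α n}

variable (R) in
/-- The span of the monomials `x^α v^β` from `I` with at most `s` factors `v`. -/
def monoSpan (X v : ℕ → B) (I : Finset ℕ → Finset ℕ → Prop) (s : ℕ) : Submodule R B :=
  Submodule.span R {b | ∃ α β, I α β ∧ β.card ≤ s ∧ b = mono X v α β}

theorem elt_mem {α : Finset ℕ} {n : ℕ} (hJ : J α n) : elt X v α n ∈ eltSpan R X v J :=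
  Submodule.subset_span ⟨α, n, hJ, rfl⟩

theorem mono_mem {α β : Finset ℕ} {s : ℕ} (hI : I α β) (hs : β.card ≤ s) :
    mono X v α β ∈ monoSpan R X v I s :=
  Submodule.subset_span ⟨α, β, hI, hs, rfl⟩

theorem monoSpan_mono {s t : ℕ} (hst : s ≤ t) : monoSpan R X v I s ≤ monoSpan R X v I t :=
  Submodule.span_mono fun _ ⟨α, β, h1, h2, h3⟩ => ⟨α, β, h1, h2.trans hst, h3⟩

/-- In questions of membership neither the sign of the product nor its vanishing for overlapping `α`
and `β` matters. This is why the conditions in `Closed` can be stated for unions. -/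
theorem ordProd_mul_mul_mem (h : Pivot τ X D v) (α β : Finset ℕ) (b : B) {M : Submodule R B}
    (hM : ordProd X (α ∪ β) * b ∈ M) : ordProd X α * ordProd X β * b ∈ M := by
  obtain ⟨r, hr⟩ := Submodule.mem_span_singleton.1 (h.ordProd_mul_mem α β)
  rw [← hr, smul_mul_assoc]
  exact M.smul_mem _ hM

/-- Linear maps and spans: a product with an element of a span. -/
theorem span_mul_mem {S : Set B} {M : Submodule R B} {a b d : B} (hd : d ∈ Submodule.span R S)
    (hS : ∀ x ∈ S, a * x * b ∈ M) : a * d * b ∈ M := by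
  refine Submodule.span_induction (p := fun d _ => a * d * b ∈ M) hS (by simp) ?_ ?_ hd
  · intro x y _ _ hx hy
    rw [mul_add, add_mul]
    exact add_mem hx hy
  · intro r x _ hx
    rw [mul_smul_comm, smul_mul_assoc]
    exact M.smul_mem _ hx

/-- There are two contributions: `v n` differentiates a letter of `β`, covered by `Closed.der`, or
the two pivots are bracketed, covered by `Closed.br`. -/
theorem elt_bracket_mem (h : Pivot τ X D v) (hc : Closed J I) {α β : Finset ℕ} {n d : ℕ}
    (hα : J α n) (hβ : J β (n + d)) :
    elt X v α n * elt X v β (n + d) -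
      (-1 : R) ^ ((α.card + 1) * (β.card + 1)) • (elt X v β (n + d) * elt X v α n) ∈
    eltSpan R X v J := by
  obtain ⟨c, hcs, e⟩ := h.v_ordProd_mem n β
  rw [h.elt_bracket (fun i hi => hc.lt hα hi) e]
  refine add_mem (Submodule.smul_mem _ _ ?_) (Submodule.smul_mem _ _ ?_)
  · refine span_mul_mem hcs ?_
    rintro _ ⟨l, hl, rfl⟩
    exact h.ordProd_mul_mul_mem _ _ _ (elt_mem (hc.der hα hβ hl))
  · refine h.ordProd_mul_mul_mem _ _ _ ?_
    rw [← mul_assoc]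
    exact h.ordProd_mul_mul_mem _ _ _ (elt_mem (hc.br hα hβ))

/-- For equal pivots the plain product, and not only the supercommutator, stays in the span: `v n`
passes the smaller letters of `β`, and the square of `v n` is known. This makes a repeated pivot
reducible without dividing by `2`. -/
theorem elt_sq_mem (h : Pivot τ X D v) (hc : Closed J I) {α β : Finset ℕ} {n : ℕ}
    (hα : J α n) (hβ : J β n) : elt X v α n * elt X v β n ∈ eltSpan R X v J := by
  have e : elt X v α n * elt X v β n = ((-1 : R) ^ β.card * τ) •
      (ordProd X α * ordProd X β * (ordProd X (brX n 0) * v (brM n 0))) := by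
    simp only [elt]
    rw [mul_assoc, ← mul_assoc (v n), h.v_mul_ordProd fun i hi => hc.lt hβ hi, smul_mul_assoc,
      mul_assoc, h.v_sq]
    simp only [mul_smul_comm, mul_smul, mul_assoc, brX, brM, ordProd_singleton]
  rw [e]
  refine Submodule.smul_mem _ _ (h.ordProd_mul_mul_mem _ _ _ ?_)
  rw [← mul_assoc]
  exact h.ordProd_mul_mul_mem _ _ _ (elt_mem (hc.br (d := 0) hα hβ))

/-- Multiplication of a monomial by `x^α v_n` where `n` is smaller than all indices. -/
theorem elt_mul_mono_of_lt (h : Pivot τ X D v) (hc : Closed J I) {α α' β : Finset ℕ} {n : ℕ}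
    (hα : J α n) (hI : I α' β) (hn : ∀ b ∈ β, n < b) :
    ∃ c ∈ monoSpan R X v I β.card, elt X v α n * mono X v α' β =
      (-1 : R) ^ α'.card • (ordProd X α * ordProd X α' * ordProd v (insert n β)) + c := by
  obtain ⟨d, hd, e⟩ := h.v_ordProd_mem n α'
  refine ⟨τ • (ordProd X α * d * ordProd v β), Submodule.smul_mem _ _ (span_mul_mem hd ?_), ?_⟩
  · rintro _ ⟨l, hl, rfl⟩
    exact h.ordProd_mul_mul_mem _ _ _ (mono_mem (hc.der' hα hI hl) le_rfl)
  · simp only [elt, mono]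
    rw [mul_assoc, ← mul_assoc (v n), e, ordProd_insert v hn]
    simp only [mul_add, add_mul, smul_mul_assoc, mul_smul_comm, mul_assoc]

theorem mono_insert_mem (h : Pivot τ X D v) (hc : Closed J I) {α α' β : Finset ℕ} {n : ℕ}
    (hα : J α n) (hI : I α' β) (hn : ∀ b ∈ β, n < b) (hd : Disjoint α α') :
    ∃ r : R, ∃ c ∈ monoSpan R X v I β.card, mono X v (α ∪ α') (insert n β) =
      r • (elt X v α n * mono X v α' β) + c := by
  obtain ⟨c, hc', e⟩ := h.elt_mul_mono_of_lt hc hα hI hn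
  obtain ⟨k, hk⟩ := h.ordProd_mul hd
  -- The leading coefficient is a product of signs, hence its own inverse, and the expansion can be
  -- solved for the leading monomial.
  have key (r : R) (hr : r * r = 1) (a b : B) (h1 : a = r • b + c) : b = r • a + -(r • c) := by
    rw [h1, smul_add, smul_smul, hr, one_smul, add_neg_cancel_right]
  rw [hk, smul_mul_assoc, smul_smul] at e
  refine ⟨_, _, neg_mem (Submodule.smul_mem _ _ hc'), key _ ?_ _ _ e⟩
  rw [mul_mul_mul_comm, ← mul_pow, ← mul_pow]
  simp

/-- Straightening in the style of Poincaré–Birkhoff–Witt, by induction on the number `s` of pivots.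
Modulo monomials with at most `s` pivots, the new pivot is inserted in its place, or nothing remains
if it was already present. The top term has to be identified, because in the inductive step it is
multiplied once more, by an element with a smaller pivot. It is left as a product of two `x`-parts,
which may be zero. -/
theorem elt_mul_mono (h : Pivot τ X D v) (hc : Closed J I) (s : ℕ) :
    ∀ {α α' β : Finset ℕ} {n : ℕ}, β.card = s → J α n → I α' β →
    elt X v α n * mono X v α' β ∈ monoSpan R X v I s ⊔
      (if n ∈ β then ⊥
        else Submodule.span R {ordProd X α * ordProd X α' * ordProd v (insert n β)}) := by
  induction s using Nat.strong_induction_on with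
  | _ s ih =>
  intro α α' β n hs hα hI
  have hlt : ∀ {α α' β : Finset ℕ} {n : ℕ}, β.card = s → J α n → I α' β → (∀ b ∈ β, n < b) →
      elt X v α n * mono X v α' β ∈ monoSpan R X v I s ⊔
        Submodule.span R {ordProd X α * ordProd X α' * ordProd v (insert n β)} := by
    intro α α' β n hs hα hI hn
    obtain ⟨c, hc', e⟩ := h.elt_mul_mono_of_lt hc hα hI hn
    rw [e, add_comm]
    exact Submodule.add_mem_sup (hs ▸ hc')
      (Submodule.smul_mem _ _ (Submodule.mem_span_singleton_self _))
  -- By the induction hypothesis, multiplication of shorter monomials adds at most one pivot.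
  have hstep : ∀ {α n t x}, t < s → J α n → x ∈ monoSpan R X v I t →
      elt X v α n * x ∈ monoSpan R X v I (t + 1) := by
    intro α n t x ht hα hx
    rw [← mul_one (elt X v α n * x)]
    refine span_mul_mem hx ?_
    rintro _ ⟨α', β', hI', hβ', rfl⟩
    rw [mul_one]
    obtain ⟨y, hy, z, hz, e⟩ :=
      Submodule.mem_sup.1 (ih β'.card (hβ'.trans_lt ht) rfl hα hI')
    rw [← e]
    refine add_mem (monoSpan_mono (by omega) hy) ?_
    split_ifs at hz with hn
    · rw [(Submodule.mem_bot R).1 hz]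
      exact zero_mem _
    · obtain ⟨r, rfl⟩ := Submodule.mem_span_singleton.1 hz
      refine Submodule.smul_mem _ _ (h.ordProd_mul_mul_mem _ _ _ (mono_mem (hc.ins hn hα hI') ?_))
      rw [Finset.card_insert_of_notMem hn]
      omega
  by_cases hn : ∀ b ∈ β, n < b
  · rw [if_neg fun hnb => lt_irrefl _ (hn n hnb)]
    exact hlt hs hα hI hn
  induction β using Finset.induction_on_min with
  | empty => simp at hn
  | insert b β' hb _ =>
    have hb' : b ∉ β' := fun hb' => lt_irrefl _ (hb b hb')
    rw [Finset.card_insert_of_notMem hb'] at hs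
    have hbn : b ≤ n := by
      by_contra hlt
      refine hn fun c hc => ?_
      rcases Finset.mem_insert.1 hc with rfl | hc
      · omega
      · have := hb c hc
        omega
    -- The smallest pivot `b ≤ n` is detached together with letters that form an element of `J` with
    -- it. The monomial becomes a product of that element and a shorter monomial, up to fewer
    -- pivots.
    obtain ⟨α₁, α₂, hd, rfl, hJ₁, hI₂⟩ := hc.split hb hI
    obtain ⟨r, c, hc', e⟩ := h.mono_insert_mem hc hJ₁ hI₂ hb hd
    have hcs : elt X v α n * c ∈ monoSpan R X v I s := by
      have := hstep (by omega) hα hc'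
      rwa [hs] at this
    have hJs : ∀ y ∈ eltSpan R X v J, y * mono X v α₂ β' ∈ monoSpan R X v I s := by
      intro y hy
      rw [← one_mul y]
      refine span_mul_mem hy ?_
      rintro _ ⟨γ, m, hγ, rfl⟩
      rw [one_mul, ← hs]
      exact hstep (by omega) hγ (mono_mem hI₂ le_rfl)
    rw [e, mul_add, mul_smul_comm, ← mul_assoc]
    refine add_mem (Submodule.smul_mem _ _ ?_) (Submodule.mem_sup_left hcs)
    obtain ⟨d, rfl⟩ := Nat.exists_eq_add_of_le hbn
    -- If the two pivots coincide, their product is already a combination of elements of `J`, so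
    -- only `s` pivots remain.
    rcases Nat.eq_zero_or_pos d with rfl | hd0
    · exact Submodule.mem_sup_left (hJs _ (h.elt_sq_mem hc hα hJ₁))
    have hsw := hJs _ (h.elt_bracket_mem hc hJ₁ hα)
    set k := (α₁.card + 1) * (α.card + 1)
    -- Otherwise the two elements are exchanged. The supercommutator is a combination of elements of
    -- `J` and costs one pivot. In the main term `b` is again to the left of larger pivots only.
    have e2 : elt X v α (b + d) * elt X v α₁ b * mono X v α₂ β' =
        (-1 : R) ^ k • (elt X v α₁ b * (elt X v α (b + d) * mono X v α₂ β')) -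
        (-1 : R) ^ k • ((elt X v α₁ b * elt X v α (b + d) - (-1 : R) ^ k •
          (elt X v α (b + d) * elt X v α₁ b)) * mono X v α₂ β') := by
      rw [sub_mul, smul_sub, smul_mul_assoc, smul_smul, ← mul_pow]
      simp [mul_assoc]
    rw [e2]
    refine sub_mem (Submodule.smul_mem _ _ ?_)
      (Submodule.mem_sup_left (Submodule.smul_mem _ _ hsw))
    obtain ⟨y, hy, z, hz, e3⟩ := Submodule.mem_sup.1 (ih β'.card (by omega) rfl hα hI₂)
    rw [← e3, mul_add]
    have hy' : elt X v α₁ b * y ∈ monoSpan R X v I s := by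
      have := hstep (by omega) hJ₁ hy
      rwa [hs] at this
    refine add_mem (Submodule.mem_sup_left hy') ?_
    have hmem : b + d ∈ insert b β' ↔ b + d ∈ β' := by
      simp only [Finset.mem_insert, or_iff_right_iff_imp]
      omega
    rw [if_congr hmem rfl rfl]
    split_ifs at hz ⊢ with hnβ
    · rw [(Submodule.mem_bot R).1 hz, mul_zero]
      exact zero_mem _
    · obtain ⟨t, rfl⟩ := Submodule.mem_span_singleton.1 hz
      rw [mul_smul_comm]
      refine Submodule.smul_mem _ _ ?_
      by_cases hd2 : Disjoint α α₂
      · obtain ⟨k2, hk2⟩ := h.ordProd_mul hd2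
        have hmin : ∀ c ∈ insert (b + d) β', b < c := by
          intro c hc
          rcases Finset.mem_insert.1 hc with rfl | hc
          · omega
          · exact hb c hc
        have := hlt (by rw [Finset.card_insert_of_notMem hnβ]; omega) hJ₁ (hc.ins hnβ hα hI₂) hmin
        rw [hk2, smul_mul_assoc, mul_smul_comm]
        refine Submodule.smul_mem _ _ (SetLike.le_def.1 (sup_le_sup_left ?_ _) this)
        rw [Submodule.span_singleton_le_iff_mem, Finset.insert_comm]
        obtain ⟨k3, hk3⟩ := h.ordProd_mul hd
        -- The three signs come from joining `α` and `α₂`, from moving `x^α` past `x^α₁`, and from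
        -- joining `α₁` and `α₂`.
        refine Submodule.mem_span_singleton.2 ⟨(-1) ^ (k2 + α.card * α₁.card + k3), ?_⟩
        have hinv (m : ℕ) (x y : B) (hx : x = (-1 : R) ^ m • y) : y = (-1 : R) ^ m • x := by
          rw [hx, smul_smul, ← mul_pow]
          simp
        rw [hinv _ _ _ hk2, hinv _ _ _ hk3]
        simp only [mul_smul_comm, smul_mul_assoc, smul_smul]
        rw [← mul_assoc (ordProd X α), h.ordProd_comm α α₁, smul_mul_assoc, smul_mul_assoc,
          smul_smul, mul_assoc (ordProd X α₁)]
        congr 1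
        have h1 : ∀ m : ℕ, (-1 : R) ^ m * (-1) ^ m = 1 := fun m => by rw [← mul_pow]; simp
        rw [pow_add, pow_add]
        linear_combination ((-1 : R) ^ k2 * ((-1) ^ (α.card * α₁.card) * (-1) ^ (α.card * α₁.card))) * h1 k3 + (-1 : R) ^ k2 * h1 (α.card * α₁.card)
      · rw [h.ordProd_mul_eq_zero hd2, zero_mul, mul_zero]
        exact zero_mem _

/-- The span of the monomials from `I`. -/
theorem elt_mul_monoSpan (h : Pivot τ X D v) (hc : Closed J I) {α : Finset ℕ} {n : ℕ}
    (hα : J α n) {x : B} (hx : x ∈ Submodule.span R {b | ∃ α β, I α β ∧ b = mono X v α β}) :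
    elt X v α n * x ∈ Submodule.span R {b | ∃ α β, I α β ∧ b = mono X v α β} := by
  rw [← mul_one (elt X v α n * x)]
  refine span_mul_mem hx ?_
  rintro _ ⟨α', β', hI, rfl⟩
  rw [mul_one]
  obtain ⟨y, hy, z, hz, e⟩ := Submodule.mem_sup.1 (h.elt_mul_mono hc β'.card rfl hα hI)
  rw [← e]
  refine add_mem (Submodule.span_mono ?_ hy) ?_
  · rintro _ ⟨a, b, h1, -, h2⟩
    exact ⟨a, b, h1, h2⟩
  · split_ifs at hz with hn
    · rw [(Submodule.mem_bot R).1 hz]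
      exact zero_mem _
    · obtain ⟨r, rfl⟩ := Submodule.mem_span_singleton.1 hz
      exact Submodule.smul_mem _ _ (h.ordProd_mul_mul_mem _ _ _
        (Submodule.subset_span ⟨_, _, hc.ins hn hα hI, rfl⟩))

/-- Induction on the number of pivots: the smallest pivot is detached with its letters, and the
error has fewer pivots. The hypothesis `h0` is needed at the bottom, since letters without a pivot
are not generated. -/
theorem mono_mem_adjoin (h : Pivot τ X D v) (hc : Closed J I) (h0 : ∀ α, I α ∅ → α = ∅) (s : ℕ) :
    ∀ {α β : Finset ℕ}, β.card ≤ s → I α β →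
      mono X v α β ∈ Algebra.adjoin R {b | ∃ α n, J α n ∧ b = elt X v α n} := by
  induction s with
  | zero =>
    intro α β hs hI
    obtain rfl := Finset.card_eq_zero.1 (Nat.le_zero.1 hs)
    obtain rfl := h0 α hI
    simp [mono, one_mem]
  | succ s ih =>
    intro α β hs hI
    induction β using Finset.induction_on_min with
    | empty => exact ih (by simp) hI
    | insert b β' hb _ =>
      rw [Finset.card_insert_of_notMem fun hb' => lt_irrefl _ (hb b hb')] at hs
      obtain ⟨α₁, α₂, hd, rfl, hJ₁, hI₂⟩ := hc.split hb hI
      obtain ⟨r, c, hc', e⟩ := h.mono_insert_mem hc hJ₁ hI₂ hb hd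
      have he : elt X v α₁ b ∈ Algebra.adjoin R {b | ∃ α n, J α n ∧ b = elt X v α n} :=
        Algebra.subset_adjoin ⟨_, _, hJ₁, rfl⟩
      rw [e]
      refine add_mem (Subalgebra.smul_mem _ (mul_mem he (ih (by omega) hI₂)) _) ?_
      have : monoSpan R X v I β'.card ≤ Subalgebra.toSubmodule
          (Algebra.adjoin R {b | ∃ α n, J α n ∧ b = elt X v α n}) := by
        refine Submodule.span_le.2 ?_
        rintro _ ⟨γ, δ, hI', hs', rfl⟩
        exact ih (by omega) hI'
      exact this hc'

theorem adjoin_eq_span (h : Pivot τ X D v) (hc : Closed J I) (h0 : ∀ α, I α ∅ → α = ∅) :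
    Subalgebra.toSubmodule (Algebra.adjoin R {b | ∃ α n, J α n ∧ b = elt X v α n}) =
      Submodule.span R {b | ∃ α β, I α β ∧ b = mono X v α β} := by
  refine le_antisymm ?_ (Submodule.span_le.2 ?_)
  · intro x hx
    -- The span is stable under left multiplication by the generators and contains `1`, so it
    -- contains the algebra they generate.
    have key : ∀ y ∈ Submodule.span R {b | ∃ α β, I α β ∧ b = mono X v α β},
        x * y ∈ Submodule.span R {b | ∃ α β, I α β ∧ b = mono X v α β} := by
      refine Algebra.adjoin_induction (p := fun x _ => ∀ y ∈ Submodule.span R _, x * y ∈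
        Submodule.span R _) ?_ ?_ ?_ ?_ hx
      · rintro _ ⟨α, n, hα, rfl⟩ y hy
        exact h.elt_mul_monoSpan hc hα hy
      · intro r y hy
        rw [← Algebra.smul_def]
        exact Submodule.smul_mem _ _ hy
      · intro a b _ _ ha hb y hy
        rw [add_mul]
        exact add_mem (ha y hy) (hb y hy)
      · intro a b _ _ ha hb y hy
        rw [mul_assoc]
        exact ha _ (hb y hy)
    have := key 1 (Submodule.subset_span ⟨∅, ∅, hc.nil, by simp [mono]⟩)
    rwa [mul_one] at this
  · rintro _ ⟨α, β, hI, rfl⟩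
    exact h.mono_mem_adjoin hc h0 _ le_rfl hI

end Pivot

/-- The closure properties for the set of all monomials. -/
theorem closed_all : Closed (fun α n => ∀ i ∈ α, i < n) fun _ _ => True where
  lt h hi := h _ hi
  br {α β n d} hα hβ i hi := by
    simp only [Finset.mem_union] at hi
    rcases brX_bound n d with ⟨h1, h2⟩ | ⟨h0, h1, h2⟩ | ⟨h0, h1, h2⟩ <;>
    · rcases hi with (hi | hi) | hi
      · have := hα i hi
        omega
      · have := hβ i hi
        omega
      · have := h2 i hi
        omega
  der {α β n d l} hα hβ hl i hi := by
    simp only [Finset.mem_union, Finset.mem_erase] at hi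
    rcases hi with hi | hi | hi
    · have := hα i hi
      omega
    · exact hβ i hi.2
    · have := mem_tail hi
      have := hβ _ hl
      omega
  nil := trivial
  ins _ _ _ := trivial
  der' _ _ _ := trivial
  split {α _ _} _ _ := ⟨∅, α, by simp, by simp, by simp, trivial⟩

namespace Pivot

variable {R B : Type*} [CommRing R] [Ring B] [Algebra R B] {τ : R} {X D v : ℕ → B}

/-- The span of all monomials is a subalgebra. -/
theorem mono_span_mul_mem (h : Pivot τ X D v) {x y : B}
    (hx : x ∈ Submodule.span R {b | ∃ α β, b = mono X v α β})
    (hy : y ∈ Submodule.span R {b | ∃ α β, b = mono X v α β}) :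
    x * y ∈ Submodule.span R {b | ∃ α β, b = mono X v α β} := by
  have hv : ∀ n, ∀ y ∈ Submodule.span R {b | ∃ α β, b = mono X v α β},
      v n * y ∈ Submodule.span R {b | ∃ α β, b = mono X v α β} := by
    intro n y hy
    have := h.elt_mul_monoSpan closed_all (α := ∅) (n := n) (x := y) (by simp)
      (by simpa using hy)
    simpa [elt] using this
  have hX : ∀ i, ∀ y ∈ Submodule.span R {b | ∃ α β, b = mono X v α β},
      X i * y ∈ Submodule.span R {b | ∃ α β, b = mono X v α β} := by
    intro i y hy
    rw [← mul_one (X i * y)]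
    refine span_mul_mem hy ?_
    rintro _ ⟨α, β, rfl⟩
    rw [mul_one, ← mul_assoc, ← ordProd_singleton X i]
    exact h.ordProd_mul_mul_mem _ _ _ (Submodule.subset_span ⟨_, _, rfl⟩)
  have hXs : ∀ α : Finset ℕ, ∀ y ∈ Submodule.span R {b | ∃ α β, b = mono X v α β},
      ordProd X α * y ∈ Submodule.span R {b | ∃ α β, b = mono X v α β} := by
    intro α
    induction α using Finset.induction_on_min with
    | empty => simp
    | insert a s hs ih =>
      intro y hy
      rw [ordProd_insert X hs, mul_assoc]
      exact hX _ _ (ih y hy)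
  have hvs : ∀ α : Finset ℕ, ∀ y ∈ Submodule.span R {b | ∃ α β, b = mono X v α β},
      ordProd v α * y ∈ Submodule.span R {b | ∃ α β, b = mono X v α β} := by
    intro α
    induction α using Finset.induction_on_min with
    | empty => simp
    | insert a s hs ih =>
      intro y hy
      rw [ordProd_insert v hs, mul_assoc]
      exact hv _ _ (ih y hy)
  rw [← one_mul x]
  refine span_mul_mem hx ?_
  rintro _ ⟨α, β, rfl⟩
  rw [one_mul, mul_assoc]
  exact hXs _ _ (hvs _ _ hy)

end Pivot
end FractalSuper

namespace FractalSuper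

/-! ### The standard monomials -/

/-- The degree of `v_n` with respect to `v_0`. -/
def wt : ℕ → ℕ
  | 0 => 1
  | 1 => 0
  | 2 => 0
  | n + 3 => 2 * wt n + wt (n + 1)

/-- The condition on `(α, n)` for `x^α v_n` to be in the Lie superalgebra. -/
def LieIndex (α : Finset ℕ) (n : ℕ) : Prop :=
  ((∀ i ∈ α, i + 3 ≤ n) ∨ ∀ i ∈ α, i + 5 ≤ n ∨ i + 2 = n) ∧ ∑ i ∈ α, wt i ≤ wt n

/-- The condition on `(α, β)` for `x^α v^β` to be in the associative hull. -/
def AssocIndex (α β : Finset ℕ) : Prop :=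
  ∃ a : ℕ → Finset ℕ, (∀ b ∈ β, LieIndex (a b) b) ∧ α ⊆ β.biUnion a

theorem LieIndex.lt {α : Finset ℕ} {n i : ℕ} (h : LieIndex α n) (hi : i ∈ α) : i + 2 ≤ n := by
  rcases h.1 with h | h
  · have := h i hi
    omega
  · have := h i hi
    omega

theorem LieIndex.mono {α β : Finset ℕ} {n : ℕ} (h : LieIndex β n) (hs : α ⊆ β) :
    LieIndex α n :=
  ⟨h.1.imp (fun h i hi => h i (hs hi)) fun h i hi => h i (hs hi),
    (Finset.sum_le_sum_of_subset hs).trans h.2⟩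

theorem sum_wt_union_le (α β : Finset ℕ) :
    ∑ i ∈ α ∪ β, wt i ≤ ∑ i ∈ α, wt i + ∑ i ∈ β, wt i := by
  rw [← Finset.sum_union_inter]
  exact Nat.le_add_right _ _

/-- If `x_i` has weight `-wt i` and `∂_i` has weight `wt i`, all terms of the pivot `v_n` have
weight `wt n`. The recursion defining `wt` is forced by this. The inequality in `LieIndex` says that
the weight of `x^α v_n`, which counts the factors `v_0`, is not negative. -/
theorem wt_tail (n l : ℕ) : ∑ i ∈ tail n l, wt i + wt n = wt (n + 3 * l) := by
  induction l generalizing n with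
  | zero => simp [tail]
  | succ l ih =>
    have h1 : n + 1 ∉ tail (n + 3) l := fun h => by have := mem_tail h; omega
    have h2 : n ∉ insert (n + 1) (tail (n + 3) l) := fun h => by
      rcases Finset.mem_insert.1 h with h | h
      · omega
      · have := mem_tail h
        omega
    have h3 := ih (n + 3)
    rw [tail, Finset.sum_insert h2, Finset.sum_insert h1]
    rw [show n + 3 + 3 * l = n + 3 * (l + 1) by ring, wt] at h3
    omega

theorem wt_brX (j d : ℕ) : ∑ i ∈ brX j d, wt i + wt j + wt (j + d) = wt (brM j d) := by
  induction j, d using brX.induct with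
  | case1 j => simp [brX, brM, wt]; omega
  | case2 j => simp [brX, brM, wt]; omega
  | case3 j =>
    simp [brX, brM, wt]
    omega
  | case4 j d ih =>
    have h1 : j + 1 ∉ brX (j + 3) d := fun h => by have := le_of_mem_brX h; omega
    have h2 : j ∉ insert (j + 1) (brX (j + 3) d) := fun h => by
      rcases Finset.mem_insert.1 h with h | h
      · omega
      · have := le_of_mem_brX h
        omega
    rw [brX, brM, Finset.sum_insert h2, Finset.sum_insert h1, ← ih, wt,
      show j + 3 + d = j + (d + 3) by ring]
    change _ + wt (j + (d + 3)) = _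
    omega

/-- Letters of `α` and `β` are at most `n + d - 2`, so they fit either shape relative to the new
pivot, and the new letters decide which one applies. The weights add up by `wt_brX`, and overlaps
only lower the sum. -/
theorem LieIndex.bracket {α β : Finset ℕ} {n d : ℕ} (hα : LieIndex α n)
    (hβ : LieIndex β (n + d)) : LieIndex (α ∪ β ∪ brX n d) (brM n d) := by
  refine ⟨?_, ?_⟩
  · simp only [Finset.mem_union]
    rcases brX_bound n d with ⟨h1, h2⟩ | ⟨h0, h1, h2⟩ | ⟨h0, h1, h2⟩
    · right
      rintro i ((hi | hi) | hi)
      · have := hα.lt hi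
        omega
      · have := hβ.lt hi
        omega
      · have := h2 i hi
        omega
    all_goals
      left
      rintro i ((hi | hi) | hi)
      · have := hα.lt hi
        omega
      · have := hβ.lt hi
        omega
      · have := h2 i hi
        omega
  · have h1 := sum_wt_union_le (α ∪ β) (brX n d)
    have h2 := sum_wt_union_le α β
    have h3 := wt_brX n d
    have h4 := hα.2
    have h5 := hβ.2
    omega

theorem LieIndex.derivative {α β : Finset ℕ} {n d l : ℕ} (hα : LieIndex α n)
    (hβ : LieIndex β (n + d)) (hl : n + 3 * l ∈ β) :
    LieIndex (α ∪ (β.erase (n + 3 * l) ∪ tail n l)) (n + d) := by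
  refine ⟨?_, ?_⟩
  · simp only [Finset.mem_union, Finset.mem_erase]
    have hl' := hβ.lt hl
    rcases hβ.1 with h | h
    · left
      rintro i (hi | hi | hi)
      · have := hα.lt hi
        omega
      · exact h i hi.2
      · have := mem_tail hi
        omega
    · rcases h _ hl with hl2 | hl2
      · right
        rintro i (hi | hi | hi)
        · have := hα.lt hi
          omega
        · exact h i hi.2
        · have := mem_tail hi
          omega
      -- The letter two below the pivot is the one that is differentiated away, so the result
      -- satisfies the first alternative.
      · left
        rintro i (hi | hi | hi)
        · have := hα.lt hi
          omega
        · have := h i hi.2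
          have := hi.1
          omega
        · have := mem_tail hi
          omega
  · have h1 := sum_wt_union_le α (β.erase (n + 3 * l) ∪ tail n l)
    have h2 := sum_wt_union_le (β.erase (n + 3 * l)) (tail n l)
    have h3 := wt_tail n l
    have h4 := hα.2
    have h5 := hβ.2
    have h6 := Finset.sum_erase_add β wt hl
    omega

/-- The definition of `AssocIndex` asks only for a covering of `α` by sets attached to the pivots,
not for a partition. Insertion attaches a new set, a derivative changes only a set containing the
differentiated letter, and splitting gives the smallest pivot all the letters of its own set. -/
theorem closed_index : Closed LieIndex AssocIndex where
  lt h hi := by have := h.lt hi; omega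
  br := LieIndex.bracket
  der := LieIndex.derivative
  nil := ⟨fun _ => ∅, by simp, by simp⟩
  ins := by
    rintro α α' n β hn hα ⟨a, ha, hs⟩
    have hne : ∀ b ∈ β, b ≠ n := fun b hb e => hn (e ▸ hb)
    refine ⟨Function.update a n α, ?_, ?_⟩
    · intro b hb
      rcases Finset.mem_insert.1 hb with rfl | hb
      · rwa [Function.update_self]
      · rw [Function.update_of_ne (hne b hb)]
        exact ha b hb
    · rw [Finset.biUnion_insert, Function.update_self]
      refine Finset.union_subset_union_right fun i hi => ?_
      obtain ⟨b, hb, hib⟩ := Finset.mem_biUnion.1 (hs hi)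
      refine Finset.mem_biUnion.2 ⟨b, hb, ?_⟩
      rwa [Function.update_of_ne (hne b hb)]
  der' := by
    rintro α α' n β l hα ⟨a, ha, hs⟩ hl
    obtain ⟨b, hb, hlb⟩ := Finset.mem_biUnion.1 (hs hl)
    have hlt := (ha b hb).lt hlb
    obtain ⟨d, rfl⟩ : ∃ d, b = n + d := Nat.exists_eq_add_of_le (by omega)
    -- The set attached to the pivot `n + d` loses the differentiated letter and absorbs the new
    -- ones. The other sets are kept.
    refine ⟨Function.update a (n + d) (α ∪ ((a (n + d)).erase (n + 3 * l) ∪ tail n l)), ?_, ?_⟩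
    · intro c hc
      by_cases hcb : c = n + d
      · subst hcb
        rw [Function.update_self]
        exact hα.derivative (ha _ hb) hlb
      · rw [Function.update_of_ne hcb]
        exact ha c hc
    · intro i hi
      rw [Finset.mem_biUnion]
      by_cases h1 : i ∈ α ∪ ((a (n + d)).erase (n + 3 * l) ∪ tail n l)
      · exact ⟨n + d, hb, by rwa [Function.update_self]⟩
      · simp only [Finset.mem_union, Finset.mem_erase, not_or, not_and] at hi h1
        have h2 : i ∈ α' ∧ i ≠ n + 3 * l := by tauto
        obtain ⟨c, hc, hic⟩ := Finset.mem_biUnion.1 (hs h2.1)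
        refine ⟨c, hc, ?_⟩
        rwa [Function.update_of_ne]
        rintro rfl
        exact h1.2.1 h2.2 hic
  split := by
    rintro α b β hb ⟨a, ha, hs⟩
    refine ⟨α ∩ a b, α \ a b, ?_, ?_, ?_, a, fun c hc => ha c (Finset.mem_insert_of_mem hc), ?_⟩
    · rw [Finset.disjoint_left]
      simp +contextual
    · ext i
      simp only [Finset.mem_union, Finset.mem_inter, Finset.mem_sdiff]
      tauto
    · exact (ha b (Finset.mem_insert_self _ _)).mono Finset.inter_subset_right
    · intro i hi
      rw [Finset.mem_sdiff] at hi
      have := hs hi.1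
      rw [Finset.biUnion_insert, Finset.mem_union] at this
      exact this.resolve_left hi.2

theorem AssocIndex.eq_empty {α : Finset ℕ} (h : AssocIndex α ∅) : α = ∅ := by
  obtain ⟨a, -, hs⟩ := h
  simpa using hs

/-- Closure under the brackets that generate the Lie superalgebra. -/
structure Generating (S : Finset ℕ → ℕ → Prop) : Prop where
  gen : ∀ i < 3, S ∅ i
  br : ∀ {α β n d}, (∀ i ∈ α, i < n) → (∀ i ∈ β, i < n) → Disjoint α β → d < 3 → S α n →
    S β (n + d) → S (α ∪ β ∪ brX n d) (brM n d)
  erase : ∀ {α n i}, i ∈ α → i + 1 < n → S ∅ i → S α n → S (α.erase i) n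

/-! ### Producing every standard Lie element from `v_0, v_1, v_2`. -/

namespace Generating

variable {S : Finset ℕ → ℕ → Prop}

/-- The bracket of `v_n` with itself gives `x_{n+1} v_{n+3}`, and bracketing with `v_{n+1}` erases
the letter. So the pivots are obtained in steps of three. -/
theorem nil (h : Generating S) (n : ℕ) : S ∅ n := by
  induction n using Nat.strong_induction_on with
  | _ n ih =>
    match n with
    | 0 => exact h.gen 0 (by omega)
    | 1 => exact h.gen 1 (by omega)
    | 2 => exact h.gen 2 (by omega)
    | n + 3 =>
      have h0 := ih n (by omega)
      have h1 := h.br (α := ∅) (β := ∅) (d := 0) (by simp) (by simp) (by simp) (by omega) h0 h0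
      simp only [Finset.union_empty, Finset.empty_union, brX, brM] at h1
      simpa using h.erase (i := n + 1) (by simp) (by omega) (ih (n + 1) (by omega)) h1

/-- Letters can be erased one at a time, since every pivot is available by `nil`. Hence only maximal
sets of letters have to be constructed below. -/
theorem subset (h : Generating S) {α β : Finset ℕ} {n : ℕ} (hs : α ⊆ β)
    (hβ : ∀ i ∈ β, i + 1 < n) (hS : S β n) : S α n := by
  obtain ⟨γ, rfl⟩ : ∃ γ, α = β \ γ := ⟨β \ α, by simp [hs]⟩
  clear hs
  induction γ using Finset.induction_on with
  | empty => simpa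
  | insert i γ _ ih =>
    rw [Finset.sdiff_insert]
    by_cases hi : i ∈ β \ γ
    · exact h.erase hi (hβ i (Finset.sdiff_subset hi)) (h.nil i) ih
    · rwa [Finset.erase_eq_of_notMem hi]

/-- The bracket with second factor of the first type. -/
theorem br0 (h : Generating S) {α β : Finset ℕ} {n : ℕ} (hα : ∀ i ∈ α, i < n)
    (hβ : ∀ i ∈ β, i < n) (hd : Disjoint α β) (h1 : S α n) (h2 : S β n) :
    S (insert (n + 1) (α ∪ β)) (n + 3) := by
  have := h.br hα hβ hd (d := 0) (by omega) h1 h2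
  rwa [brX, Finset.union_comm, ← Finset.insert_eq] at this

theorem br1 (h : Generating S) {α β : Finset ℕ} {n : ℕ} (hα : ∀ i ∈ α, i < n)
    (hβ : ∀ i ∈ β, i < n) (hd : Disjoint α β) (h1 : S α n) (h2 : S β (n + 1)) :
    S (insert n (α ∪ β)) (n + 3) := by
  have := h.br hα hβ hd (d := 1) (by omega) h1 h2
  rwa [brX, Finset.union_comm, ← Finset.insert_eq] at this

theorem br2 (h : Generating S) {α β : Finset ℕ} {n : ℕ} (hα : ∀ i ∈ α, i < n)
    (hβ : ∀ i ∈ β, i < n) (hd : Disjoint α β) (h1 : S α n) (h2 : S β (n + 2)) :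
    S (insert n (insert (n + 1) (insert (n + 2) (α ∪ β)))) (n + 5) := by
  have := h.br hα hβ hd (d := 2) (by omega) h1 h2
  rwa [brX, Finset.union_comm, Finset.insert_union, Finset.insert_union, ← Finset.insert_eq] at this

/-- The set `{0, …, 4}` has weight `3` while `wt 7 = 2`, so the full element does not exist for `n =
7`. This is one of its maximal substitutes. -/
theorem seven_four (h : Generating S) : S {1, 2, 3, 4} 7 := by
  have h1 : S {1} 4 := by
    simpa using h.br1 (n := 1) (α := ∅) (β := ∅) (by simp) (by simp) (by simp) (h.nil _) (h.nil _)
  have h2 := h.br2 (n := 2) (α := ∅) (β := {1}) (by simp) (by simp) (by simp) (h.nil _) h1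
  convert h2 using 1
  decide

/-- The elements `x_0 ⋯ x_{n-3} v_n`. -/
theorem full (h : Generating S) (n : ℕ) (h3 : 3 ≤ n) (h4 : n ≠ 4) (h7 : n ≠ 7) :
    S (Finset.range (n - 2)) n := by
  induction n using Nat.strong_induction_on with
  | _ n ih =>
    by_cases e3 : n = 3
    · subst e3
      simpa using h.br1 (n := 0) (α := ∅) (β := ∅) (by simp) (by simp) (by simp) (h.nil _)
        (h.nil _)
    obtain ⟨k, rfl⟩ : ∃ k, n = k + 5 := ⟨n - 5, by omega⟩
    -- The bracket of `v_k` with the full element for `k + 2` adds the letters `k, k + 1, k + 2` and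
    -- gives the full element for `k + 5`.
    have step : S (Finset.range k) (k + 2) → S (Finset.range (k + 5 - 2)) (k + 5) := by
      intro hk
      have := h.br2 (n := k) (α := ∅) (by simp) (by simp) (by simp) (h.nil _) hk
      convert this using 1
      ext i
      simp only [Finset.mem_range, Finset.mem_insert, Finset.empty_union]
      omega
    by_cases e0 : k = 0
    · subst e0
      exact step (by simpa using h.nil 2)
    -- Here the step would start from the missing full element for `7`. The letter `0` is instead
    -- carried by `v_5`, and `{1, 2, 3, 4}` by `v_7`.
    by_cases e10 : k = 5
    · subst e10
      have h5 : S {0} 5 := h.subset (by decide) (by decide) (ih 5 (by omega) (by omega) (by omega)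
        (by omega))
      have := h.br2 (n := 5) (α := {0}) (β := {1, 2, 3, 4}) (by decide) (by decide) (by decide) h5
        h.seven_four
      convert this using 1
      decide
    exact step (ih (k + 2) (by omega) (by omega) (by omega) (by omega))

theorem single_mem (h : Generating S) (n : ℕ) : S {n + 1} (n + 3) := by
  simpa using h.br0 (n := n) (α := ∅) (β := ∅) (by simp) (by simp) (by simp) (h.nil _) (h.nil _)

/-- The elements `x_0 ⋯ x_{n-5} x_{n-2} v_n`. -/
theorem full' (h : Generating S) (n : ℕ) (h7 : n + 6 ≠ 7) (h10 : n + 6 ≠ 10) :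
    S (insert (n + 4) (Finset.range (n + 2))) (n + 6) := by
  have h1 := h.full (n + 3) (by omega) (by omega) (by omega)
  -- The full element for `n + 3` lacks the letter `n + 1`, so the other factor supplies it, and the
  -- bracket adds `n + 4`.
  have := h.br0 (n := n + 3) (α := {n + 1}) (β := Finset.range (n + 1)) (by simp) ?_ (by simp)
    (h.single_mem n) h1
  · convert this using 2
    ext i
    simp only [Finset.mem_range, Finset.mem_union, Finset.mem_singleton]
    omega
  · intro i hi
    rw [Finset.mem_range] at hi
    omega

/-- As `wt 7 = 2`, the letter `0` of weight `1` cannot occur together with `3` or `5`, both of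
weight `2`. Every admissible set therefore lies in `{0, 1, 2, 4}`, `{1, 2, 3, 4}` or `{1, 2, 5}`. -/
theorem seven (h : Generating S) {α : Finset ℕ} (hα : LieIndex α 7) : S α 7 := by
  have hw := hα.2
  have h03 : ∀ i, i ≠ 0 → 2 < wt 0 + wt i → 0 ∈ α → i ∉ α := by
    intro i hi0 hi h0 h1
    have : ({0, i} : Finset ℕ) ⊆ α := by
      simp [Finset.insert_subset_iff, h0, h1]
    have := Finset.sum_le_sum_of_subset (f := wt) this
    rw [Finset.sum_pair (Ne.symm hi0)] at this
    simp only [show wt 7 = 2 from rfl] at hw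
    omega
  have h1 : S {0, 1, 2, 4} 7 := by
    have h5 : S {0, 1, 2} 5 := h.full 5 (by omega) (by omega) (by omega)
    have := h.br1 (n := 4) (α := ∅) (β := {0, 1, 2}) (by simp) (by decide) (by simp) (h.nil _) h5
    convert this using 1
    decide
  have h2 : S {1, 2, 5} 7 := by
    have h4 : S {1} 4 := by
      simpa using h.br1 (n := 1) (α := ∅) (β := ∅) (by simp) (by simp) (by simp) (h.nil _)
        (h.nil _)
    have := h.br0 (n := 4) (α := {1}) (β := {2}) (by simp) (by decide) (by simp) h4
      (h.single_mem 1)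
    convert this using 1
    decide
  rcases hα.1 with ht | ht
  · by_cases h0 : 0 ∈ α
    · have h3 := h03 3 (by simp) (by decide) h0
      refine h.subset (β := {0, 1, 2, 4}) ?_ (by decide) h1
      intro i hi
      have := ht i hi
      have : i ≠ 3 := fun e => h3 (e ▸ hi)
      simp only [Finset.mem_insert, Finset.mem_singleton]
      omega
    · refine h.subset (β := {1, 2, 3, 4}) ?_ (by decide) h.seven_four
      intro i hi
      have := ht i hi
      have : i ≠ 0 := fun e => h0 (e ▸ hi)
      simp only [Finset.mem_insert, Finset.mem_singleton]
      omega
  · by_cases h0 : 0 ∈ α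
    · have h5 := h03 5 (by simp) (by decide) h0
      refine h.subset (β := {0, 1, 2, 4}) ?_ (by decide) h1
      intro i hi
      have := ht i hi
      have : i ≠ 5 := fun e => h5 (e ▸ hi)
      simp only [Finset.mem_insert, Finset.mem_singleton]
      omega
    · refine h.subset (β := {1, 2, 5}) ?_ (by decide) h2
      intro i hi
      have := ht i hi
      have : i ≠ 0 := fun e => h0 (e ▸ hi)
      simp only [Finset.mem_insert, Finset.mem_singleton]
      omega

/-- The candidates `{0, …, 5, 8}` have total weight `13`, one more than `wt 10`, so one of the
letters `0, 3, 5, 8` of positive weight is missing. If it is `8`, the full element suffices.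
Otherwise the letters other than `8` are distributed over two elements with pivot `v_7`, whose
bracket adds the letter `8`. -/
theorem ten (h : Generating S) {α : Finset ℕ} (hα : LieIndex α 10)
    (ht : ∀ i ∈ α, i + 5 ≤ 10 ∨ i + 2 = 10) : S α 10 := by
  have hw := hα.2
  have h8 : ∀ {a b : Finset ℕ}, Disjoint a b → LieIndex a 7 → LieIndex b 7 →
      α ⊆ insert 8 (a ∪ b) → S α 10 := by
    intro a b hd ha hb hs
    have hbd : ∀ {a : Finset ℕ}, LieIndex a 7 → ∀ i ∈ a, i < 7 := fun ha i hi => by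
      have := ha.lt hi
      omega
    refine h.subset hs ?_ (h.br0 (hbd ha) (hbd hb) hd (h.seven ha) (h.seven hb))
    intro i hi
    simp only [Finset.mem_insert, Finset.mem_union] at hi
    rcases hi with hi | hi | hi
    · omega
    · have := ha.lt hi
      omega
    · have := hb.lt hi
      omega
  by_cases h0 : 0 ∈ α
  · by_cases h3 : 3 ∈ α
    · by_cases h5 : 5 ∈ α
      · have h8 : 8 ∉ α := by
          intro h8
          have : ({0, 3, 5, 8} : Finset ℕ) ⊆ α := by
            simp [Finset.insert_subset_iff, h0, h3, h5, h8]
          have := (Finset.sum_le_sum_of_subset (f := wt) this).trans hw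
          revert this
          decide
        refine h.subset ?_ ?_ (h.full 10 (by omega) (by omega) (by omega))
        · intro i hi
          have := ht i hi
          have : i ≠ 8 := fun e => h8 (e ▸ hi)
          rw [Finset.mem_range]
          omega
        · intro i hi
          rw [Finset.mem_range] at hi
          omega
      · refine h8 (a := {0}) (b := {1, 2, 3, 4}) (by decide) (by unfold LieIndex; decide)
          (by unfold LieIndex; decide) ?_
        intro i hi
        have := ht i hi
        have : i ≠ 5 := fun e => h5 (e ▸ hi)
        simp only [Finset.mem_insert, Finset.mem_union, Finset.mem_singleton]
        omega
    · refine h8 (a := {5}) (b := {0, 1, 2, 4}) (by decide) (by unfold LieIndex; decide)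
        (by unfold LieIndex; decide) ?_
      intro i hi
      have := ht i hi
      have : i ≠ 3 := fun e => h3 (e ▸ hi)
      simp only [Finset.mem_insert, Finset.mem_union, Finset.mem_singleton]
      omega
  · refine h8 (a := {5}) (b := {1, 2, 3, 4}) (by decide) (by unfold LieIndex; decide)
      (by unfold LieIndex; decide) ?_
    intro i hi
    have := ht i hi
    have : i ≠ 0 := fun e => h0 (e ▸ hi)
    simp only [Finset.mem_insert, Finset.mem_union, Finset.mem_singleton]
    omega

/-- The weight inequality excludes sets of the two allowed shapes only for `n = 2, 4, 5, 7, 10`. For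
the other `n ≥ 6` the maximal sets are those of `full` and `full'`. The exceptional and the small
cases are treated by hand. -/
theorem of_lieIndex (h : Generating S) {α : Finset ℕ} {n : ℕ} (hα : LieIndex α n) : S α n := by
  have hw := hα.2
  have hsmall : ∀ {m}, wt n < wt m → m ∉ α := fun hm h' =>
    absurd ((Finset.single_le_sum (fun _ _ => Nat.zero_le _) h').trans hw) (not_le.2 hm)
  by_cases h7 : n = 7
  · subst h7
    exact h.seven hα
  rcases hα.1 with ht | ht
  · by_cases h2 : n < 3
    · have : α = ∅ := Finset.eq_empty_of_forall_notMem fun i hi => by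
        have := ht i hi
        omega
      exact this ▸ h.nil n
    by_cases h4 : n = 4
    · subst h4
      have h0 : 0 ∉ α := hsmall (by decide)
      have h4 : S {1} 4 := by
        simpa using h.br1 (n := 1) (α := ∅) (β := ∅) (by simp) (by simp) (by simp) (h.nil _)
          (h.nil _)
      refine h.subset ?_ (by decide) h4
      intro i hi
      have := ht i hi
      have : i ≠ 0 := fun e => h0 (e ▸ hi)
      simp only [Finset.mem_singleton]
      omega
    · refine h.subset ?_ ?_ (h.full n (by omega) h4 h7)
      · intro i hi
        have := ht i hi
        rw [Finset.mem_range]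
        omega
      · intro i hi
        rw [Finset.mem_range] at hi
        omega
  · by_cases h10 : n = 10
    · subst h10
      exact h.ten hα ht
    by_cases h6 : 6 ≤ n
    · obtain ⟨k, rfl⟩ : ∃ k, n = k + 6 := ⟨n - 6, by omega⟩
      refine h.subset ?_ ?_ (h.full' k h7 h10)
      · intro i hi
        have := ht i hi
        rw [Finset.mem_insert, Finset.mem_range]
        omega
      · intro i hi
        rw [Finset.mem_insert, Finset.mem_range] at hi
        omega
    by_cases h3 : 3 ≤ n
    · obtain ⟨k, rfl⟩ : ∃ k, n = k + 3 := ⟨n - 3, by omega⟩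
      -- For `3 ≤ n ≤ 5` the second shape allows the letter `n - 2`, and for `n = 5` also `0`. For
      -- `n = 5` the letters `0` and `3` together weigh `3 > wt 5`.
      by_cases hk : k + 3 = 5 ∧ 0 ∈ α
      · obtain ⟨rfl, h0⟩ : k = 2 ∧ _ := ⟨by omega, hk.2⟩
        have h3 : 3 ∉ α := by
          intro h3
          have : ({0, 3} : Finset ℕ) ⊆ α := by simp [Finset.insert_subset_iff, h0, h3]
          have := (Finset.sum_le_sum_of_subset (f := wt) this).trans hw
          revert this
          decide
        refine h.subset ?_ ?_ (h.full 5 (by omega) (by omega) (by omega))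
        · intro i hi
          have := ht i hi
          have : i ≠ 3 := fun e => h3 (e ▸ hi)
          rw [Finset.mem_range]
          omega
        · intro i hi
          rw [Finset.mem_range] at hi
          omega
      · refine h.subset ?_ ?_ (h.single_mem k)
        · intro i hi
          have := ht i hi
          rw [Finset.mem_singleton]
          by_contra hik
          have : i = 0 ∧ k = 2 := by omega
          exact hk ⟨by omega, this.1 ▸ hi⟩
        · simp
    · have : α = ∅ := Finset.eq_empty_of_forall_notMem fun i hi => by
        have := ht i hi
        obtain ⟨rfl, rfl⟩ : i = 0 ∧ n = 2 := by omega
        exact hsmall (by decide) hi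
      exact this ▸ h.nil n

end Generating

end FractalSuper

/-! ### Supercommutators that consist of a single term. -/

namespace FractalSuper

theorem self_mem_brX (j d : ℕ) (hd : 0 < d) : j ∈ brX j d := by
  match d with
  | 1 => simp [brX]
  | 2 => simp [brX]
  | d + 3 => simp [brX]

namespace Pivot

variable {R B : Type*} [CommRing R] [Ring B] [Algebra R B] {τ : R} {X D v : ℕ → B}

/-- All letters of `β` lie below `n`, so `v n` differentiates none of them and only the bracket of
the pivots is left. Its new letters start at `n`, hence no letter is repeated. -/
theorem elt_bracket_disjoint (h : Pivot τ X D v) {α β : Finset ℕ} {n d : ℕ} (hα : ∀ i ∈ α, i < n)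
    (hβ : ∀ i ∈ β, i < n) (hd : Disjoint α β) :
    ∃ k : ℕ, elt X v α n * elt X v β (n + d) -
      (-1 : R) ^ ((α.card + 1) * (β.card + 1)) • (elt X v β (n + d) * elt X v α n) =
      ((-1 : R) ^ k * (if 3 ∣ d then 2 else -1) * τ) •
        elt X v (α ∪ β ∪ brX n d) (brM n d) := by
  obtain ⟨k, hk⟩ := h.ordProd_mul hd
  have hd' : Disjoint (α ∪ β) (brX n d) := by
    rw [Finset.disjoint_left]
    intro i hi hi'
    have := le_of_mem_brX hi'
    rcases Finset.mem_union.1 hi with hi | hi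
    · have := hα i hi
      omega
    · have := hβ i hi
      omega
  obtain ⟨l, hl⟩ := h.ordProd_mul hd'
  refine ⟨β.card + k + l, ?_⟩
  rw [h.elt_bracket hα (c := 0) (by rw [h.v_mul_ordProd hβ, smul_zero, add_zero]), mul_zero,
    zero_mul, smul_zero, zero_add, hk, smul_mul_assoc, ← mul_assoc (ordProd X (α ∪ β)), hl, smul_mul_assoc, smul_smul,
    smul_smul]
  congr 1
  ring

/-- Everything except the removal of the letter `i` vanishes: a derivative of another letter brings
in a tail containing `X i`, and so does the bracket of the two pivots, while the factor `X i` is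
still present. -/
theorem elt_bracket_erase (h : Pivot τ X D v) {α : Finset ℕ} {n i : ℕ} (hi : i ∈ α)
    (hn : i + 1 < n) :
    ∃ k : ℕ, elt X v ∅ i * elt X v α n -
      (-1 : R) ^ (((∅ : Finset ℕ).card + 1) * (α.card + 1)) • (elt X v α n * elt X v ∅ i) =
      ((-1 : R) ^ k * τ) • elt X v (α.erase i) n := by
  obtain ⟨d, rfl⟩ : ∃ d, n = i + d := Nat.exists_eq_add_of_le (by omega)
  obtain ⟨k, hk⟩ := h.X_mul_ordProd (Finset.notMem_erase i α)
  rw [Finset.insert_erase hi] at hk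
  have hk' : ordProd X α = (-1 : R) ^ k • (X i * ordProd X (α.erase i)) := by
    rw [hk, smul_smul, ← mul_pow]
    simp
  have hc : v i * ordProd X α = (-1 : R) ^ α.card • (ordProd X α * v i) +
      τ • ((-1 : R) ^ k • ordProd X (α.erase i)) := by
    obtain ⟨c, hcs, e⟩ := h.v_ordProd_mem i (α.erase i)
    have hc0 : X i * c = 0 := by
      rw [← Submodule.mem_bot R, ← mul_one (X i * c)]
      refine span_mul_mem hcs ?_
      rintro _ ⟨l, hl, rfl⟩
      match l with
      | 0 => simp at hl
      | l + 1 =>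
        rw [h.X_mul_ordProd_of_mem (Finset.mem_union_right _ (mem_tail_self i l)), zero_mul]
        exact zero_mem _
    have hcard : α.card = (α.erase i).card + 1 := (Finset.card_erase_add_one hi).symm
    rw [hk', mul_smul_comm, ← mul_assoc, h.vX_self, sub_mul, smul_mul_assoc, one_mul, mul_assoc, e,
      mul_add, mul_smul_comm _ (X i) c, hc0, smul_zero, add_zero, mul_smul_comm, ← mul_assoc,
      hcard, pow_succ, mul_neg_one, neg_smul, smul_mul_assoc]
    rw [smul_sub, smul_comm _ τ, smul_comm (_ ^ k)]
    abel
  refine ⟨k, ?_⟩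
  rw [h.elt_bracket (by simp) hc,
    ordProd_empty, one_mul, one_mul, ← mul_assoc (ordProd X α), h.ordProd_mul_eq_zero, zero_mul, smul_zero, add_zero, smul_mul_assoc, smul_smul,
    mul_comm τ]
  exact Finset.not_disjoint_iff.2 ⟨i, hi, self_mem_brX i d (by omega)⟩

/-- A set of elements `x^α v_n` is generating if it is closed under supercommutators, up to
nonzero factors. -/
theorem generating (h : Pivot τ X D v) {S : Finset ℕ → ℕ → Prop} (h2 : IsUnit (2 : R))
    (gen : ∀ i < 3, S ∅ i)
    (br : ∀ {α β γ m n k} {u : R}, IsUnit u → S α m → S β n →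
      elt X v α m * elt X v β n -
        (-1 : R) ^ ((α.card + 1) * (β.card + 1)) • (elt X v β n * elt X v α m) =
      (u * τ) • elt X v γ k → S γ k) : Generating S where
  gen := gen
  br {α β n d} hα hβ hd _ h1 h2' := by
    obtain ⟨k, hk⟩ := h.elt_bracket_disjoint hα hβ hd (d := d)
    refine br ?_ h1 h2' hk
    -- Up to sign the structure constants are `2` and `1`, so invertibility of `2` makes them units.
    refine (IsUnit.pow _ isUnit_one.neg).mul ?_
    split_ifs
    · exact h2
    · exact isUnit_one.neg
  erase hi hn h1 h2' := by
    obtain ⟨k, hk⟩ := h.elt_bracket_erase hi hn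
    exact br (IsUnit.pow _ isUnit_one.neg) h1 h2' hk

end Pivot
end FractalSuper

namespace FractalSuper

/-! ### Pivot elements as operators on the Grassmann algebra -/

/-- The product `y_i y_{i+1} · y_{i+3} y_{i+4} ⋯ y_{i+3l-3} y_{i+3l-2}`. -/
def tailProd {A : Type*} [Monoid A] (y : ℕ → A) (i : ℕ) : ℕ → A
  | 0 => 1
  | l + 1 => tailProd y i l * (y (i + 3 * l) * y (i + 3 * l + 1))

theorem tailProd_succ {A : Type*} [Monoid A] (y : ℕ → A) (i l : ℕ) :
    tailProd y i (l + 1) = y i * y (i + 1) * tailProd y (i + 3) l := by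
  induction l with
  | zero => simp [tailProd]
  | succ l ih =>
    rw [tailProd, ih, tailProd, mul_assoc]
    congr 4 <;> ring

theorem map_tailProd {A C : Type*} [Monoid A] [Monoid C] (f : A →* C) (y : ℕ → A) (i l : ℕ) :
    f (tailProd y i l) = tailProd (fun i => f (y i)) i l := by
  induction l with
  | zero => simp [tailProd]
  | succ l ih => simp [tailProd, ih]

/-- The coefficient of `∂_j` in the pivot element `v_i`. -/
def pivotCoeff {A : Type*} [Ring A] (y : ℕ → A) (i j : ℕ) : A :=
  if i ≤ j ∧ 3 ∣ j - i then tailProd y i ((j - i) / 3) else 0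

theorem pivotCoeff_rec {A : Type*} [Ring A] (y : ℕ → A) (i j : ℕ) :
    pivotCoeff y i j =
      (Pi.single i 1 : ℕ → A) j + y i * y (i + 1) * pivotCoeff y (i + 3) j := by
  unfold pivotCoeff
  by_cases hij : j = i
  · subst hij
    rw [if_pos (by simp), if_neg (by omega)]
    simp [tailProd]
  · rw [Pi.single_eq_of_ne hij, zero_add]
    by_cases h : i ≤ j ∧ 3 ∣ j - i
    · rw [if_pos h, if_pos (by omega), ← tailProd_succ]
      congr 1
      omega
    · rw [if_neg h, if_neg (by omega), mul_zero]

section Operators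

variable (R : Type*) [CommRing R]

theorem gx_sq (i : ℕ) : gx R i * gx R i = 0 := ExteriorAlgebra.ι_sq_zero _

theorem gx_anti (i j : ℕ) : gx R i * gx R j = -(gx R j * gx R i) :=
  eq_neg_of_add_eq_zero_left (ExteriorAlgebra.ι_add_mul_swap _ _)

theorem gd_gx_mul (i j : ℕ) (f : Grassmann R) :
    gd R j (gx R i * f) = (if i = j then f else 0) - gx R i * gd R j f := by
  have h := CliffordAlgebra.contractLeft_ι_mul (Q := (0 : QuadraticForm R (ℕ →₀ R)))
    (Finsupp.lapply j) (Finsupp.single i 1) f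
  refine h.trans ?_
  congr 1
  simp [Finsupp.single_apply]

theorem gd_gx (i j : ℕ) : gd R j (gx R i) = if i = j then 1 else 0 := by
  have := gd_gx_mul R i j 1
  rw [mul_one] at this
  rw [this]
  simp [gd, CliffordAlgebra.contractLeft_one]

theorem gd_sq (i : ℕ) (f : Grassmann R) : gd R i (gd R i f) = 0 :=
  CliffordAlgebra.contractLeft_contractLeft _ _

theorem gd_anti (i j : ℕ) (f : Grassmann R) : gd R i (gd R j f) = -gd R j (gd R i f) :=
  CliffordAlgebra.contractLeft_comm _ _ _

variable {R}

theorem gx_mul_tailProd (τ : R) (i j l : ℕ) (f : Grassmann R) :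
    gx R i * (tailProd (fun k => τ • gx R k) j l * f) =
      tailProd (fun k => τ • gx R k) j l * (gx R i * f) := by
  induction l generalizing f with
  | zero => simp [tailProd]
  | succ l ih =>
    simp only [tailProd, mul_assoc]
    rw [ih]
    congr 1
    simp only [smul_mul_assoc, mul_smul_comm]
    congr 2
    rw [← mul_assoc, gx_anti, neg_mul, mul_assoc, ← mul_assoc (gx R i), gx_anti R i, neg_mul,
      mul_neg, neg_neg, mul_assoc]

theorem gd_tailProd (τ : R) (i j l : ℕ) (hij : i < j) (f : Grassmann R) :
    gd R i (tailProd (fun k => τ • gx R k) j l * f) =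
      tailProd (fun k => τ • gx R k) j l * gd R i f := by
  induction l generalizing f with
  | zero => simp [tailProd]
  | succ l ih =>
    simp only [tailProd, mul_assoc]
    rw [ih]
    congr 1
    simp only [smul_mul_assoc, mul_smul_comm, map_smul]
    rw [gd_gx_mul, if_neg (by omega), gd_gx_mul, if_neg (by omega)]
    simp

theorem gx_mul_pivotCoeff (τ : R) (i j k : ℕ) (f : Grassmann R) :
    gx R i * (pivotCoeff (fun k => τ • gx R k) j k * f) =
      pivotCoeff (fun k => τ • gx R k) j k * (gx R i * f) := by
  unfold pivotCoeff
  split_ifs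
  · exact gx_mul_tailProd _ _ _ _ _
  · simp

theorem gd_pivotCoeff (τ : R) (i j k : ℕ) (hij : i < j) (f : Grassmann R) :
    gd R i (pivotCoeff (fun k => τ • gx R k) j k * f) =
      pivotCoeff (fun k => τ • gx R k) j k * gd R i f := by
  unfold pivotCoeff
  split_ifs
  · exact gd_tailProd _ _ _ _ hij _
  · simp

theorem specialDer_apply (c : ℕ → Grassmann R) (f : Grassmann R) :
    specialDer c f = ∑ᶠ j, c j * gd R j f := rfl

theorem specialDer_gx (c : ℕ → Grassmann R) (i : ℕ) : specialDer c (gx R i) = c i := by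
  rw [specialDer_apply, finsum_eq_single _ i]
  · simp [gd_gx]
  · intro j hj
    rw [gd_gx, if_neg hj.symm, mul_zero]

theorem specialDer_add (c d : ℕ → Grassmann R) :
    specialDer (c + d) = specialDer c + specialDer d := by
  refine LinearMap.ext fun f => ?_
  rw [LinearMap.add_apply]
  simp only [specialDer_apply]
  rw [← finsum_add_distrib (specialDer_finite c f) (specialDer_finite d f)]
  simp only [Pi.add_apply, add_mul]

theorem specialDer_mul (a : Grassmann R) (c : ℕ → Grassmann R) :
    specialDer (fun j => a * c j) = LinearMap.mulLeft R a * specialDer c := by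
  refine LinearMap.ext fun f => ?_
  rw [Module.End.mul_apply, LinearMap.mulLeft_apply]
  simp only [specialDer_apply]
  rw [mul_finsum' _ _ (specialDer_finite c f)]
  simp only [mul_assoc]

theorem specialDer_single (i : ℕ) :
    specialDer (Pi.single i 1 : ℕ → Grassmann R) = gd R i := by
  refine LinearMap.ext fun f => ?_
  rw [specialDer_apply, finsum_eq_single _ i]
  · simp
  · intro j hj
    rw [Pi.single_eq_of_ne hj, zero_mul]

/-- Left multiplication by `τ x_i`. -/
def opX (τ : R) (i : ℕ) : Module.End R (Grassmann R) := LinearMap.mulLeft R (τ • gx R i)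

/-- The pivot element with `τ x_i` in place of `x_i`. -/
def opV (τ : R) (i : ℕ) : Module.End R (Grassmann R) :=
  specialDer (pivotCoeff (fun k => τ • gx R k) i)

/-- The case `τ = 1` over `K` describes `A`, and `τ = t` over `K[t]` describes `At`. -/
theorem pivot_op (τ : R) : Pivot τ (opX τ) (gd R) (opV τ) where
  XX i j := by
    refine LinearMap.ext fun f => ?_
    simp only [opX, Module.End.mul_apply, LinearMap.mulLeft_apply, LinearMap.neg_apply]
    rw [← mul_assoc, ← mul_assoc, smul_mul_smul_comm, smul_mul_smul_comm, gx_anti]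
    simp
  X_sq i := by
    refine LinearMap.ext fun f => ?_
    simp only [opX, Module.End.mul_apply, LinearMap.mulLeft_apply, LinearMap.zero_apply]
    rw [← mul_assoc, smul_mul_smul_comm, gx_sq, smul_zero, zero_mul]
  DX i j hij := by
    refine LinearMap.ext fun f => ?_
    simp only [opX, Module.End.mul_apply, LinearMap.mulLeft_apply, LinearMap.neg_apply]
    rw [smul_mul_assoc, map_smul, gd_gx_mul, if_neg hij.symm, zero_sub, smul_neg, smul_mul_assoc]
  DX_self i := by
    refine LinearMap.ext fun f => ?_
    simp only [opX, Module.End.mul_apply, LinearMap.mulLeft_apply, LinearMap.sub_apply,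
      LinearMap.smul_apply, Module.End.one_apply]
    rw [smul_mul_assoc, map_smul, gd_gx_mul, if_pos rfl, smul_sub, smul_mul_assoc]
  D_sq i := by
    refine LinearMap.ext fun f => ?_
    exact gd_sq R i f
  Dv i j hij := by
    refine LinearMap.ext fun f => ?_
    simp only [opV, Module.End.mul_apply, LinearMap.neg_apply, specialDer_apply]
    rw [map_finsum _ (specialDer_finite _ f), ← finsum_neg_distrib]
    refine finsum_congr fun k => ?_
    rw [gd_pivotCoeff _ _ _ _ hij, gd_anti, mul_neg]
  vX i j hij := by
    refine LinearMap.ext fun f => ?_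
    simp only [opV, opX, Module.End.mul_apply, LinearMap.neg_apply, specialDer_apply,
      LinearMap.mulLeft_apply]
    rw [mul_finsum' _ _ (specialDer_finite _ f), ← finsum_neg_distrib]
    refine finsum_congr fun k => ?_
    rw [smul_mul_assoc, smul_mul_assoc, gx_mul_pivotCoeff, map_smul, gd_gx_mul]
    -- The derivative `∂_i` with `i < j` does not occur in `v j`, so the exceptional term has
    -- coefficient zero.
    by_cases hik : i = k
    · have : pivotCoeff (fun k => τ • gx R k) j k = 0 := by
        unfold pivotCoeff
        rw [if_neg (by omega)]
      simp [this]
    · rw [if_neg hik, zero_sub, smul_neg, mul_neg, mul_smul_comm]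
  v_eq i := by
    have h : pivotCoeff (fun k => τ • gx R k) i =
        (Pi.single i 1 : ℕ → Grassmann R) + fun j => (τ • gx R i) * (τ • gx R (i + 1)) *
          pivotCoeff (fun k => τ • gx R k) (i + 3) j := by
      ext1 j
      exact pivotCoeff_rec _ _ _
    unfold opV opX
    rw [h, specialDer_add, specialDer_single, specialDer_mul, LinearMap.mulLeft_mul]
    rfl

end Operators

/-! ### The deformation of the Lie elements. -/

section Deformation

variable (K : Type*) [Field K]

theorem pivotTail_eq (i l : ℕ) : pivotTail K i l = tailProd (gx K) i l := by
  induction l with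
  | zero => rfl
  | succ l ih => rw [pivotTail, tailProd, ih]

theorem v_eq_opV : v K = opV (1 : K) := by
  ext1 i
  simp only [v, opV, one_smul, pivotTail_eq]
  rfl

theorem scaleX_gx (i : ℕ) : scaleX K (gx K i) = (Polynomial.X : K[X]) • gx K[X] i := by
  simp only [scaleX, gx]
  erw [ExteriorAlgebra.lift_ι_apply]
  simp

theorem deform_mul_specialDer (a : Grassmann K) (c : ℕ → Grassmann K) :
    deform K (LinearMap.mulLeft K a * specialDer c) =
      LinearMap.mulLeft K[X] (scaleX K a) * specialDer fun j => scaleX K (c j) := by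
  have h (j : ℕ) : (LinearMap.mulLeft K a * specialDer c) (gx K j) = a * c j := by
    rw [Module.End.mul_apply, specialDer_gx]
    rfl
  simp only [deform, h, map_mul]
  exact specialDer_mul _ _

theorem deform_v (i : ℕ) : deform K (v K i) = opV (Polynomial.X : K[X]) i := by
  have := deform_mul_specialDer K 1 (pivotCoeff (fun k => (1 : K) • gx K k) i)
  rw [map_one] at this
  rw [LinearMap.mulLeft_one, LinearMap.mulLeft_one, ← Module.End.one_eq_id, one_mul,
    ← Module.End.one_eq_id, one_mul] at this
  rw [v_eq_opV, opV, this, opV]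
  congr 1
  ext1 j
  simp only [pivotCoeff]
  split_ifs
  · have := map_tailProd (scaleX K : Grassmann K →* Grassmann K[X]) (fun k => (1 : K) • gx K k) i
      ((j - i) / 3)
    refine this.trans ?_
    congr 1
    ext1 k
    simp [scaleX_gx]
  · simp

theorem monoA_eq (α β : Finset ℕ) :
    monoA K α β = Pivot.mono (opX (1 : K)) (opV (1 : K)) α β := by
  have h : opX (1 : K) = fun i => LinearMap.mulLeft K (gx K i) := by
    ext1 i
    rw [opX, one_smul]
  rw [h]
  simp only [monoA, Pivot.mono, ordProd, v_eq_opV]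

theorem monoAt_eq (α β : Finset ℕ) :
    monoAt K α β = Pivot.mono (opX (Polynomial.X : K[X])) (opV (Polynomial.X : K[X])) α β := by
  simp only [monoAt, Pivot.mono, ordProd, deform_v]
  rfl

theorem ordProd_opX {R : Type*} [CommRing R] (τ : R) (α : Finset ℕ) :
    ordProd (opX τ) α = LinearMap.mulLeft R (ordProd (fun k => τ • gx R k) α) := by
  have := map_ordProd (fun k => τ • gx R k)
    (Algebra.lmul R (Grassmann R) : Grassmann R →* Module.End R (Grassmann R)) α
  exact this.symm

/-- `deform` scales the coefficients of the `∂_j`, and in `x^α v_n` these are `x^α` times those of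
`v_n`. As scaling is multiplicative, it can be carried out in both factors separately. -/
theorem deform_elt (α : Finset ℕ) (n : ℕ) :
    deform K (Pivot.elt (opX (1 : K)) (opV (1 : K)) α n) =
      Pivot.elt (opX (Polynomial.X : K[X])) (opV (Polynomial.X : K[X])) α n := by
  rw [Pivot.elt, ordProd_opX, opV, deform_mul_specialDer, Pivot.elt, ordProd_opX, ← deform_v]
  congr 1
  · have := map_ordProd (fun k => (1 : K) • gx K k) (scaleX K : Grassmann K →* Grassmann K[X]) α
    congr 1
    refine this.trans ?_
    congr 1
    ext1 k
    simp [scaleX_gx]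
  · rw [v_eq_opV, opV, deform]
    simp only [specialDer_gx]

theorem deform_add (a b : Module.End K (Grassmann K)) :
    deform K (a + b) = deform K a + deform K b := by
  rw [deform, deform, deform, ← specialDer_add]
  congr 1
  ext1 j
  simp

theorem deform_smul (r : K) (a : Module.End K (Grassmann K)) :
    deform K (r • a) = (Polynomial.C r) • deform K a := by
  refine LinearMap.ext fun f => ?_
  rw [LinearMap.smul_apply]
  simp only [deform, specialDer_apply]
  rw [smul_finsum' _ (specialDer_finite _ f)]
  refine finsum_congr fun j => ?_
  rw [LinearMap.smul_apply, map_smul, smul_mul_assoc]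
  rw [← algebraMap_smul K[X] r]
  rfl

end Deformation
end FractalSuper

namespace FractalSuper

theorem ordProd_insert_max {B : Type*} [Monoid B] (x : ℕ → B) {a : ℕ} {s : Finset ℕ}
    (h : ∀ b ∈ s, b < a) : ordProd x (insert a s) = ordProd x s * x a := by
  induction s using Finset.induction_on_min with
  | empty => simp [ordProd]
  | insert m s hm ih =>
    rw [Finset.insert_comm, ordProd_insert x hm, ordProd_insert,
      ih fun b hb => h b (Finset.mem_insert_of_mem hb), mul_assoc]
    intro b hb
    rcases Finset.mem_insert.1 hb with rfl | hb
    · exact h m (Finset.mem_insert_self _ _)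
    · exact hm b hb

/-! ### Linear independence of the operator monomials. -/

section Independence

variable {R : Type*} [CommRing R]

variable (R) in
/-- The monomial `x_{i_r} ⋯ x_{i_1}`, where `γ = {i_1 < ⋯ < i_r}`. -/
def descProd (γ : Finset ℕ) : Grassmann R := ((γ.sort (· ≥ ·)).map (gx R)).prod

theorem descProd_insert {a : ℕ} {γ : Finset ℕ} (h : ∀ b ∈ γ, b < a) :
    descProd R (insert a γ) = gx R a * descProd R γ := by
  rw [descProd, Finset.sort_insert (r := (· ≥ ·)) (fun b hb => (h b hb).le)
    fun ha => lt_irrefl _ (h a ha), List.map_cons, List.prod_cons, descProd]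

theorem gd_one (j : ℕ) : gd R j 1 = 0 := CliffordAlgebra.contractLeft_one _ _

theorem gd_descProd {j : ℕ} {γ : Finset ℕ} (h : j ∉ γ) : gd R j (descProd R γ) = 0 := by
  induction γ using Finset.induction_on_max with
  | empty => simp [descProd, gd_one]
  | insert a s hs ih =>
    rw [Finset.mem_insert, not_or] at h
    rw [descProd_insert hs, gd_gx_mul, if_neg (Ne.symm h.1), ih h.2]
    simp

theorem gd_ordProd (τ : R) {j : ℕ} {γ : Finset ℕ} (h : j ∉ γ) :
    gd R j (ordProd (fun i => τ • gx R i) γ) = 0 := by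
  induction γ using Finset.induction_on_min with
  | empty => simp [gd_one]
  | insert a s hs ih =>
    rw [Finset.mem_insert, not_or] at h
    rw [ordProd_insert _ hs, smul_mul_assoc, map_smul, gd_gx_mul, if_neg (Ne.symm h.1), ih h.2]
    simp

theorem opV_descProd (τ : R) {j : ℕ} {γ : Finset ℕ} (h : ∀ b ∈ γ, b < j) :
    opV τ j (descProd R γ) = 0 := by
  rw [opV, specialDer_apply]
  refine (finsum_congr fun k => ?_).trans finsum_zero
  by_cases hk : k ∈ γ
  · rw [pivotCoeff, if_neg, zero_mul]
    have := h k hk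
    omega
  · rw [gd_descProd hk, mul_zero]

/-- Only `∂_j` contributes: smaller derivatives are absent from `v_j`, larger ones find no letter.
In descending order `x_j` stands first and is removed without a sign. -/
theorem opV_descProd_insert (τ : R) {j : ℕ} {γ : Finset ℕ} (h : ∀ b ∈ γ, b < j) :
    opV τ j (descProd R (insert j γ)) = descProd R γ := by
  rw [opV, specialDer_apply, finsum_eq_single _ j]
  · have hj : j ∉ γ := fun hj => lt_irrefl _ (h j hj)
    rw [descProd_insert h, gd_gx_mul, gd_descProd hj]
    simp [pivotCoeff, tailProd]
  · intro k hk
    by_cases hkγ : k ∈ γ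
    · rw [pivotCoeff, if_neg, zero_mul]
      have := h k hkγ
      omega
    · rw [gd_descProd, mul_zero]
      simp [hk, hkγ]

/-- In `v^β` the pivot with the largest index acts first. On monomials without the largest letter
`a` all terms with `v_a` vanish, which isolates the remaining `β`. On monomials containing `a`, the
operator `v_a` removes it and the other half is isolated in the same way. -/
theorem ordProd_opV_indep (τ : R) (S : Finset ℕ) (F : Finset ℕ → Grassmann R)
    (h : ∀ γ ⊆ S, ∑ β ∈ S.powerset, F β * ordProd (opV τ) β (descProd R γ) = 0) :
    ∀ β ⊆ S, F β = 0 := by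
  induction S using Finset.induction_on_max generalizing F with
  | empty =>
    intro β hβ
    obtain rfl := Finset.subset_empty.1 hβ
    simpa [descProd] using h ∅ le_rfl
  | insert a s hs ih =>
    have ha : a ∉ s := fun ha => lt_irrefl _ (hs a ha)
    have hlt : ∀ {β}, β ⊆ s → ∀ b ∈ β, b < a := fun hβ b hb => hs b (hβ hb)
    have h1 : ∀ β ⊆ s, F β = 0 := by
      refine ih F fun γ hγ => ?_
      rw [← h γ (hγ.trans (Finset.subset_insert _ _)), Finset.sum_powerset_insert ha,
        left_eq_add]
      refine Finset.sum_eq_zero fun β hβ => ?_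
      rw [ordProd_insert_max _ (hlt (Finset.mem_powerset.1 hβ)), Module.End.mul_apply,
        opV_descProd τ (hlt hγ), map_zero, mul_zero]
    have h2 : ∀ β ⊆ s, F (insert a β) = 0 := by
      refine ih (fun β => F (insert a β)) fun γ hγ => ?_
      have h0 : ∑ β ∈ s.powerset, F β * ordProd (opV τ) β (descProd R (insert a γ)) = 0 :=
        Finset.sum_eq_zero fun β hβ => by rw [h1 β (Finset.mem_powerset.1 hβ), zero_mul]
      rw [← h (insert a γ) (Finset.insert_subset_insert _ hγ), Finset.sum_powerset_insert ha, h0,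
        zero_add]
      refine Finset.sum_congr rfl fun β hβ => ?_
      rw [ordProd_insert_max _ (hlt (Finset.mem_powerset.1 hβ)), Module.End.mul_apply,
        opV_descProd_insert τ (hlt hγ)]
    intro β hβ
    by_cases haβ : a ∈ β
    · rw [← Finset.insert_erase haβ]
      exact h2 _ (Finset.subset_insert_iff.1 hβ)
    · exact h1 _ ((Finset.subset_insert_iff_of_notMem haβ).1 hβ)

/-- The derivative with respect to the smallest letter isolates the monomials that contain it, at
the price of a factor `τ`, which can be cancelled in a domain. -/
theorem ordProd_gx_indep [IsDomain R] {τ : R} (hτ : τ ≠ 0) (S : Finset ℕ) (c : Finset ℕ → R)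
    (h : ∑ α ∈ S.powerset, c α • ordProd (fun i => τ • gx R i) α = 0) :
    ∀ α ⊆ S, c α = 0 := by
  induction S using Finset.induction_on_min generalizing c with
  | empty =>
    intro β hβ
    obtain rfl := Finset.subset_empty.1 hβ
    have h' : c ∅ • (1 : Grassmann R) = 0 := by simpa using h
    rw [← Algebra.algebraMap_eq_smul_one] at h'
    exact (ExteriorAlgebra.algebraMap_eq_zero_iff _ _).1 h'
  | insert a s hs ih =>
    have ha : a ∉ s := fun ha => lt_irrefl _ (hs a ha)
    rw [Finset.sum_powerset_insert ha] at h
    have hgt : ∀ {β}, β ∈ s.powerset → ∀ b ∈ β, a < b := fun hβ b hb =>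
      hs b (Finset.mem_powerset.1 hβ hb)
    have h2 : ∀ β ⊆ s, c (insert a β) = 0 := by
      have h3 := congrArg (gd R a) h
      rw [map_zero, map_add, map_sum, map_sum, Finset.sum_eq_zero, zero_add] at h3
      · have h4 := ih (fun α => τ * c (insert a α)) ?_
        · intro β hβ
          exact (mul_eq_zero.1 (h4 β hβ)).resolve_left hτ
        · rw [← h3]
          refine Finset.sum_congr rfl fun β hβ => ?_
          have haβ : a ∉ β := fun haβ => ha (Finset.mem_powerset.1 hβ haβ)
          rw [ordProd_insert _ (hgt hβ), map_smul, smul_mul_assoc, map_smul, gd_gx_mul, if_pos rfl,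
            gd_ordProd τ haβ, mul_zero, sub_zero, smul_smul, mul_comm]
      · intro β hβ
        have haβ : a ∉ β := fun haβ => ha (Finset.mem_powerset.1 hβ haβ)
        rw [map_smul, gd_ordProd τ haβ, smul_zero]
    have h1 : ∀ β ⊆ s, c β = 0 := by
      refine ih c ?_
      rw [← h, left_eq_add]
      refine Finset.sum_eq_zero fun β hβ => ?_
      rw [h2 β (Finset.mem_powerset.1 hβ), zero_smul]
    intro β hβ
    by_cases haβ : a ∈ β
    · rw [← Finset.insert_erase haβ]
      exact h2 _ (Finset.subset_insert_iff.1 hβ)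
    · exact h1 _ ((Finset.subset_insert_iff_of_notMem haβ).1 hβ)

/-- Every finite set of pairs of finite sets is contained in a product of power sets. -/
theorem exists_powerset_product (s : Finset (Finset ℕ × Finset ℕ)) :
    ∃ S : Finset ℕ, s ⊆ S.powerset ×ˢ S.powerset := by
  refine ⟨s.biUnion fun p => p.1 ∪ p.2, fun p hp => ?_⟩
  rw [Finset.mem_product, Finset.mem_powerset, Finset.mem_powerset]
  exact ⟨fun i hi => Finset.mem_biUnion.2 ⟨p, hp, Finset.mem_union_left _ hi⟩,
    fun i hi => Finset.mem_biUnion.2 ⟨p, hp, Finset.mem_union_right _ hi⟩⟩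

/-- The products of pivots are independent over the Grassmann algebra acting from the left, and then
the monomials in the `τ x_i` are independent over `R`. -/
theorem mono_op_linearIndependent [IsDomain R] {τ : R} (hτ : τ ≠ 0) :
    LinearIndependent R fun p : Finset ℕ × Finset ℕ =>
      Pivot.mono (opX τ) (opV τ) p.1 p.2 := by
  classical
  rw [linearIndependent_iff']
  intro s g hg p hp
  obtain ⟨S, hS⟩ := exists_powerset_product s
  let c : Finset ℕ → Finset ℕ → R := fun α β => if (α, β) ∈ s then g (α, β) else 0
  have hsum : ∑ β ∈ S.powerset, ∑ α ∈ S.powerset,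
      c α β • Pivot.mono (opX τ) (opV τ) α β = 0 := by
    rw [← hg, ← Finset.sum_product_right', ← Finset.sum_subset hS]
    · refine Finset.sum_congr rfl fun q hq => ?_
      simp [c, hq]
    · intro q _ hq
      simp [c, hq]
  have h1 := ordProd_opV_indep τ S
    (fun β => ∑ α ∈ S.powerset, c α β • ordProd (fun i => τ • gx R i) α) (fun γ _ => by
      have h0 := LinearMap.congr_fun hsum (descProd R γ)
      rw [LinearMap.sum_apply, LinearMap.zero_apply] at h0
      rw [← h0]
      refine Finset.sum_congr rfl fun β _ => ?_
      rw [LinearMap.sum_apply, Finset.sum_mul]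
      refine Finset.sum_congr rfl fun α _ => ?_
      rw [LinearMap.smul_apply, Pivot.mono, Module.End.mul_apply, ordProd_opX,
        LinearMap.mulLeft_apply, smul_mul_assoc])
  have hp' := Finset.mem_product.1 (hS hp)
  have h2 := ordProd_gx_indep hτ S (fun α => c α p.2) (h1 p.2 (Finset.mem_powerset.1 hp'.2)) p.1
    (Finset.mem_powerset.1 hp'.1)
  simpa [c, hp] using h2

end Independence

/-! ### Parity of operators -/

section Parity

variable {R : Type*} [CommRing R]

theorem zmod_two_cases (q : ZMod 2) : q = 0 ∨ q = 1 := by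
  revert q
  decide

theorem gx_mem_gParity (i : ℕ) : gx R i ∈ gParity R 1 := CliffordAlgebra.ι_mem_evenOdd_one _ _

theorem one_mem_gParity : (1 : Grassmann R) ∈ gParity R 0 :=
  Submodule.one_le.1 (CliffordAlgebra.one_le_evenOdd_zero (0 : QuadraticForm R (ℕ →₀ R)))

theorem mul_mem_gParity {p q : ZMod 2} {f g : Grassmann R} (hf : f ∈ gParity R p)
    (hg : g ∈ gParity R q) : f * g ∈ gParity R (p + q) :=
  CliffordAlgebra.evenOdd_mul_le _ p q (Submodule.mul_mem_mul hf hg)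

theorem gd_homogeneous (j : ℕ) : IsHomogeneousEnd R 1 (gd R j) := by
  intro q f hf
  have hι : ∀ m : ℕ →₀ R, CliffordAlgebra.ι 0 m ∈ gParity R 1 := fun m =>
    CliffordAlgebra.ι_mem_evenOdd_one _ _
  refine CliffordAlgebra.evenOdd_induction (Q := (0 : QuadraticForm R (ℕ →₀ R))) q
    (motive := fun x _ => gd R j x ∈ gParity R (1 + q)) ?_ ?_ ?_ f hf
  · intro x hx
    obtain rfl | rfl := zmod_two_cases q
    · rw [ZMod.val_zero, pow_zero] at hx
      obtain ⟨r, rfl⟩ := Submodule.mem_one.1 hx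
      have : gd R j (algebraMap R _ r) = 0 := CliffordAlgebra.contractLeft_algebraMap _ _ _
      rw [this]
      exact zero_mem _
    · rw [ZMod.val_one, pow_one] at hx
      obtain ⟨m, rfl⟩ := hx
      have : gd R j (CliffordAlgebra.ι 0 m) = algebraMap R _ (m j) :=
        CliffordAlgebra.contractLeft_ι _ _ _
      rw [this]
      exact SetLike.algebraMap_mem_graded (CliffordAlgebra.evenOdd _) _
  · intro x y _ _ hx hy
    rw [map_add]
    exact add_mem hx hy
  · intro m₁ m₂ x hxq hx
    have e : ∀ (m : ℕ →₀ R) (y : Grassmann R), gd R j (CliffordAlgebra.ι 0 m * y) =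
        m j • y - CliffordAlgebra.ι 0 m * gd R j y := fun m y =>
      CliffordAlgebra.contractLeft_ι_mul _ _ _
    rw [mul_assoc, e, e]
    refine sub_mem (Submodule.smul_mem _ _ (mul_mem_gParity (hι _) hxq)) ?_
    rw [mul_sub]
    refine sub_mem ?_ ?_
    · rw [mul_smul_comm]
      exact Submodule.smul_mem _ _ (mul_mem_gParity (hι _) hxq)
    · have := mul_mem_gParity (hι m₁) (mul_mem_gParity (hι m₂) hx)
      rwa [← add_assoc, ← add_assoc, show (1 + 1 + 1 + q : ZMod 2) = 1 + q by
        rw [CharTwo.add_self_eq_zero, zero_add]] at this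

theorem IsHomogeneousEnd.mul {p q : ZMod 2} {a b : Module.End R (Grassmann R)}
    (ha : IsHomogeneousEnd R p a) (hb : IsHomogeneousEnd R q b) :
    IsHomogeneousEnd R (p + q) (a * b) := by
  intro r f hf
  rw [add_assoc]
  exact ha _ _ (hb _ _ hf)

theorem IsHomogeneousEnd.add {p : ZMod 2} {a b : Module.End R (Grassmann R)}
    (ha : IsHomogeneousEnd R p a) (hb : IsHomogeneousEnd R p b) :
    IsHomogeneousEnd R p (a + b) := fun r f hf => add_mem (ha r f hf) (hb r f hf)

theorem IsHomogeneousEnd.smul {p : ZMod 2} {a : Module.End R (Grassmann R)} (c : R)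
    (ha : IsHomogeneousEnd R p a) :
    IsHomogeneousEnd R p (c • a) := fun r f hf => Submodule.smul_mem _ _ (ha r f hf)

theorem IsHomogeneousEnd.sub {p : ZMod 2} {a b : Module.End R (Grassmann R)}
    (ha : IsHomogeneousEnd R p a) (hb : IsHomogeneousEnd R p b) :
    IsHomogeneousEnd R p (a - b) := fun r f hf => sub_mem (ha r f hf) (hb r f hf)

theorem isHomogeneousEnd_zero (p : ZMod 2) : IsHomogeneousEnd R p 0 := fun _ _ _ => zero_mem _

theorem isHomogeneousEnd_one : IsHomogeneousEnd R 0 1 := fun _ _ hf => by rwa [zero_add]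

theorem opX_homogeneous (τ : R) (i : ℕ) : IsHomogeneousEnd R 1 (opX τ i) := fun _ _ hf =>
  mul_mem_gParity (Submodule.smul_mem _ _ (gx_mem_gParity i)) hf

theorem pivotCoeff_mem (τ : R) (i j : ℕ) :
    pivotCoeff (fun k => τ • gx R k) i j ∈ gParity R 0 := by
  unfold pivotCoeff
  split_ifs
  · generalize (j - i) / 3 = l
    induction l with
    | zero =>
      rw [tailProd]
      exact one_mem_gParity
    | succ l ih =>
      rw [tailProd]
      have h := mul_mem_gParity ih (mul_mem_gParity
        (Submodule.smul_mem _ τ (gx_mem_gParity (i + 3 * l)))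
        (Submodule.smul_mem _ τ (gx_mem_gParity (i + 3 * l + 1))))
      rwa [show (0 + (1 + 1) : ZMod 2) = 0 by decide] at h
  · exact zero_mem _

theorem opV_homogeneous (τ : R) (i : ℕ) : IsHomogeneousEnd R 1 (opV τ i) := by
  intro q f hf
  rw [opV, specialDer_apply]
  refine finsum_induction (· ∈ gParity R (1 + q)) (zero_mem _) (fun _ _ => add_mem) fun j => ?_
  have := mul_mem_gParity (pivotCoeff_mem τ i j) (gd_homogeneous j q f hf)
  rwa [zero_add] at this

theorem ordProd_homogeneous {x : ℕ → Module.End R (Grassmann R)}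
    (hx : ∀ i, IsHomogeneousEnd R 1 (x i)) (s : Finset ℕ) :
    IsHomogeneousEnd R (s.card : ZMod 2) (ordProd x s) := by
  induction s using Finset.induction_on_min with
  | empty => simpa using isHomogeneousEnd_one
  | insert a s hs ih =>
    rw [ordProd_insert x hs, Finset.card_insert_of_notMem fun ha => lt_irrefl _ (hs a ha),
      Nat.cast_succ, add_comm]
    exact (hx a).mul ih

theorem mono_homogeneous (τ : R) (α β : Finset ℕ) :
    IsHomogeneousEnd R ((α.card + β.card : ℕ) : ZMod 2) (Pivot.mono (opX τ) (opV τ) α β) := by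
  rw [Nat.cast_add]
  exact (ordProd_homogeneous (opX_homogeneous τ) α).mul (ordProd_homogeneous (opV_homogeneous τ) β)

/-- The values of `a` on homogeneous elements lie in both complementary parts. Together with linear
independence this recovers parities of index sets from identities of operators. -/
theorem eq_zero_of_homogeneous {a : Module.End R (Grassmann R)} {p q : ZMod 2} (hpq : p ≠ q)
    (hp : IsHomogeneousEnd R p a) (hq : IsHomogeneousEnd R q a) : a = 0 := by
  have hc : ∀ r : ZMod 2, Disjoint (gParity R (p + r)) (gParity R (q + r)) := by
    intro r
    have h := CliffordAlgebra.evenOdd_isCompl (Q := (0 : QuadraticForm R (ℕ →₀ R)))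
    obtain ⟨h1, h2⟩ | ⟨h1, h2⟩ : (p + r = 0 ∧ q + r = 1) ∨ (p + r = 1 ∧ q + r = 0) := by
      clear hp hq h
      revert p q r
      decide
    · rw [h1, h2]
      exact h.disjoint
    · rw [h1, h2]
      exact h.disjoint.symm
  have h0 : ∀ r, ∀ f ∈ gParity R r, a f = 0 := fun r f hf =>
    Submodule.disjoint_def.1 (hc r) _ (hp r f hf) (hq r f hf)
  refine LinearMap.ext fun f => ?_
  have hf : f ∈ gParity R 0 ⊔ gParity R 1 := by
    have h := CliffordAlgebra.evenOdd_isCompl (Q := (0 : QuadraticForm R (ℕ →₀ R)))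
    have h' : gParity R 0 ⊔ gParity R 1 = ⊤ := h.sup_eq_top
    rw [h']
    trivial
  obtain ⟨y, hy, z, hz, rfl⟩ := Submodule.mem_sup.1 hf
  rw [map_add, h0 _ y hy, h0 _ z hz]
  simp

end Parity

end FractalSuper

namespace FractalSuper

/-! ### The supercommutative algebra of formal sums -/

theorem inversions_union_left {S S' : Finset Letter} (h : Disjoint S S') (T : Finset Letter) :
    inversions (S ∪ S') T = inversions S T + inversions S' T := by
  rw [inversions, Finset.union_product, Finset.filter_union, Finset.card_union_of_disjoint]
  · rfl
  · exact Finset.disjoint_filter_filter (Finset.disjoint_product.2 (Or.inl h))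

theorem inversions_union_right {T T' : Finset Letter} (h : Disjoint T T') (S : Finset Letter) :
    inversions S (T ∪ T') = inversions S T + inversions S T' := by
  rw [inversions, Finset.product_union, Finset.filter_union, Finset.card_union_of_disjoint]
  · rfl
  · exact Finset.disjoint_filter_filter (Finset.disjoint_product.2 (Or.inr h))

theorem inversions_comm {S T : Finset Letter} (h : Disjoint S T) :
    inversions S T + inversions T S = S.card * T.card := by
  have h1 : inversions T S = ((S ×ˢ T).filter fun p => p.1 < p.2).card := by
    refine Finset.card_bij (fun p _ => p.swap) ?_ ?_ ?_
    · intro p hp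
      simp only [Finset.mem_filter, Finset.mem_product, Prod.fst_swap, Prod.snd_swap] at hp ⊢
      tauto
    · intro p _ q _ h
      exact Prod.swap_injective h
    · intro p hp
      refine ⟨p.swap, ?_, Prod.swap_swap p⟩
      simp only [Finset.mem_filter, Finset.mem_product, Prod.fst_swap, Prod.snd_swap] at hp ⊢
      tauto
  rw [h1, inversions, ← Finset.card_union_of_disjoint, ← Finset.filter_or,
    Finset.filter_true_of_mem, Finset.card_product]
  · intro p hp
    rw [Finset.mem_product] at hp
    exact lt_or_gt_of_ne fun e => Finset.disjoint_left.1 h hp.1 (e ▸ hp.2)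
  · refine Finset.disjoint_filter.2 fun p _ h1 h2 => lt_asymm h1 h2

theorem inversions_empty_left (T : Finset Letter) : inversions ∅ T = 0 := by simp [inversions]

theorem inversions_empty_right (T : Finset Letter) : inversions T ∅ = 0 := by simp [inversions]

theorem inversions_singleton_left (s : Letter) (T : Finset Letter) :
    inversions {s} T = (T.filter (· < s)).card := by
  refine Finset.card_bij (fun p _ => p.2) ?_ ?_ ?_
  · rintro ⟨a, b⟩ hp
    simp only [Finset.mem_filter, Finset.mem_product, Finset.mem_singleton] at hp ⊢
    obtain ⟨⟨rfl, h⟩, h'⟩ := hp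
    exact ⟨h, h'⟩
  · rintro ⟨a, b⟩ hp ⟨c, d⟩ hq h
    simp only [Finset.mem_filter, Finset.mem_product, Finset.mem_singleton] at hp hq h
    rw [hp.1.1, hq.1.1, h]
  · intro b hb
    exact ⟨(s, b), by simpa using hb, rfl⟩

namespace FormalSum

theorem ext {K : Type*} {f g : FormalSum K} (h : ∀ S, f S = g S) : f = g := funext h

variable {K : Type*} [Field K]

theorem add_apply (f g : FormalSum K) (S : Finset Letter) : (f + g) S = f S + g S := rfl

theorem neg_apply (f : FormalSum K) (S : Finset Letter) : (-f) S = -f S := rfl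

theorem sub_apply (f g : FormalSum K) (S : Finset Letter) : (f - g) S = f S - g S := rfl

theorem smul_apply (c : K) (f : FormalSum K) (S : Finset Letter) : (c • f) S = c * f S := rfl

theorem zero_apply (S : Finset Letter) : (0 : FormalSum K) S = 0 := rfl

theorem mul_apply (f g : FormalSum K) (S : Finset Letter) :
    (f * g) S = ∑ T ∈ S.powerset, (-1) ^ inversions T (S \ T) * f T * g (S \ T) := rfl

theorem one_apply (S : Finset Letter) : (1 : FormalSum K) S = if S = ∅ then 1 else 0 := rfl

/-- Both sides are sums over ordered partitions of `S` into three parts, and the signs agree because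
`inversions` is additive in each argument. -/
theorem mul_assoc' (f g h : FormalSum K) : f * g * h = f * (g * h) := by
  refine ext fun S => ?_
  simp only [mul_apply, Finset.mul_sum, Finset.sum_mul]
  rw [Finset.sum_sigma', Finset.sum_sigma']
  refine Finset.sum_bij' (fun p _ => ⟨p.2, p.1 \ p.2⟩) (fun p _ => ⟨p.1 ∪ p.2, p.1⟩) ?_ ?_ ?_ ?_ ?_
  · rintro ⟨T, U⟩ hp
    simp only [Finset.mem_sigma, Finset.mem_powerset] at hp ⊢
    exact ⟨hp.2.trans hp.1, Finset.sdiff_subset_sdiff hp.1 le_rfl⟩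
  · rintro ⟨U, W⟩ hp
    simp only [Finset.mem_sigma, Finset.mem_powerset] at hp ⊢
    exact ⟨Finset.union_subset hp.1 (hp.2.trans Finset.sdiff_subset), Finset.subset_union_left⟩
  · rintro ⟨T, U⟩ hp
    simp only [Finset.mem_sigma, Finset.mem_powerset] at hp
    simp only [Finset.union_sdiff_of_subset hp.2]
  · rintro ⟨U, W⟩ hp
    simp only [Finset.mem_sigma, Finset.mem_powerset] at hp
    have hd : Disjoint U W := Finset.disjoint_of_subset_right hp.2 Finset.disjoint_sdiff
    simp only [Finset.union_sdiff_cancel_left hd]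
  · rintro ⟨T, U⟩ hp
    simp only [Finset.mem_sigma, Finset.mem_powerset] at hp
    have e1 : (S \ U) \ (T \ U) = S \ T := by
      ext s
      simp only [Finset.mem_sdiff]
      have := @hp.2 s
      tauto
    have e2 : inversions T (S \ T) = inversions U (S \ T) + inversions (T \ U) (S \ T) := by
      have := inversions_union_left (Finset.disjoint_sdiff (s := U) (t := T)) (S \ T)
      rwa [Finset.union_sdiff_of_subset hp.2] at this
    have e3 : inversions U (S \ U) = inversions U (T \ U) + inversions U (S \ T) := by
      rw [← inversions_union_right]
      · congr 1
        ext s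
        simp only [Finset.mem_sdiff, Finset.mem_union]
        have := @hp.2 s
        have := @hp.1 s
        tauto
      · exact Finset.disjoint_of_subset_left Finset.sdiff_subset Finset.disjoint_sdiff
    dsimp only
    rw [e1, e2, e3, pow_add, pow_add]
    ring

theorem one_mul' (f : FormalSum K) : 1 * f = f := by
  refine ext fun S => ?_
  rw [mul_apply, Finset.sum_eq_single ∅]
  · simp [one_apply, inversions_empty_left]
  · intro T _ hT
    simp [one_apply, hT]
  · simp

theorem mul_one' (f : FormalSum K) : f * 1 = f := by
  refine ext fun S => ?_
  rw [mul_apply, Finset.sum_eq_single S]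
  · simp [one_apply, inversions_empty_right]
  · intro T hT hTS
    rw [one_apply, if_neg, mul_zero]
    intro h
    exact hTS (Finset.Subset.antisymm (Finset.mem_powerset.1 hT) (Finset.sdiff_eq_empty_iff_subset.1 h))
  · simp

instance : Ring (FormalSum K) :=
  { (inferInstance : AddCommGroup (FormalSum K)) with
    mul := (· * ·)
    one := 1
    mul_assoc := mul_assoc'
    one_mul := one_mul'
    mul_one := mul_one'
    left_distrib := fun f g h => ext fun S => by
      simp only [mul_apply, add_apply, mul_add, Finset.sum_add_distrib]
    right_distrib := fun f g h => ext fun S => by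
      simp only [mul_apply, add_apply, mul_add, add_mul, Finset.sum_add_distrib]
    zero_mul := fun f => ext fun S => by simp [mul_apply, zero_apply]
    mul_zero := fun f => ext fun S => by simp [mul_apply, zero_apply] }

instance : Algebra K (FormalSum K) :=
  Algebra.ofModule
    (fun c f g => ext fun S => by
      simp only [mul_apply, smul_apply, Finset.mul_sum]
      exact Finset.sum_congr rfl fun T _ => by ring)
    fun c f g => ext fun S => by
      simp only [mul_apply, smul_apply, Finset.mul_sum]
      exact Finset.sum_congr rfl fun T _ => by ring

/-- The formal sums of monomials of parity `p`. -/
def HasParity (p : ZMod 2) (f : FormalSum K) : Prop := ∀ S, f S ≠ 0 → (S.card : ZMod 2) = p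

theorem HasParity.mul {p q : ZMod 2} {f g : FormalSum K} (hf : HasParity p f)
    (hg : HasParity q g) : HasParity (p + q) (f * g) := by
  intro S h
  obtain ⟨T, hT, h1, h2⟩ := exists_of_mul_ne h
  rw [← hf T h1, ← hg _ h2, ← Nat.cast_add, add_comm, Finset.card_sdiff_add_card_eq_card hT]

theorem neg_one_pow_eq {a b : ℕ} (h : (a : ZMod 2) = b) : (-1 : K) ^ a = (-1) ^ b := by
  have h' := (ZMod.natCast_eq_natCast_iff' a b 2).1 h
  rw [neg_one_pow_eq_pow_mod_two, h', ← neg_one_pow_eq_pow_mod_two]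

theorem mul_comm_of_parity {p q : ZMod 2} {f g : FormalSum K} (hf : HasParity p f)
    (hg : HasParity q g) : f * g = sgn K p q • (g * f) := by
  refine ext fun S => ?_
  rw [smul_apply, mul_apply, mul_apply, Finset.mul_sum]
  refine Finset.sum_bij' (fun T _ => S \ T) (fun T _ => S \ T) ?_ ?_ ?_ ?_ ?_
  · simp
  · simp
  · intro T hT
    rw [Finset.sdiff_sdiff_eq_self (Finset.mem_powerset.1 hT)]
  · intro T hT
    rw [Finset.sdiff_sdiff_eq_self (Finset.mem_powerset.1 hT)]
  · intro T hT
    rw [Finset.sdiff_sdiff_eq_self (Finset.mem_powerset.1 hT)]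
    by_cases h1 : f T = 0
    · simp [h1]
    by_cases h2 : g (S \ T) = 0
    · simp [h2]
    have h3 := inversions_comm (Finset.disjoint_sdiff (s := T) (t := S))
    have h4 : (-1 : K) ^ inversions T (S \ T) = sgn K p q * (-1) ^ inversions (S \ T) T := by
      rw [sgn, ← pow_add]
      refine neg_one_pow_eq ?_
      rw [Nat.cast_add, Nat.cast_mul, ZMod.natCast_zmod_val, ZMod.natCast_zmod_val, ← hf T h1,
        ← hg _ h2, ← Nat.cast_mul, ← h3]
      push_cast
      rw [add_assoc, CharTwo.add_self_eq_zero, add_zero]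
    rw [h4]
    ring

theorem anti_of_odd {f g : FormalSum K} (hf : HasParity 1 f) (hg : HasParity 1 g) :
    f * g = -(g * f) := by
  rw [mul_comm_of_parity hf hg, sgn, ZMod.val_one]
  simp

theorem hasParity_single (S : Finset Letter) :
    HasParity (S.card : ZMod 2) (single S : FormalSum K) := by
  intro T hT
  have : T = S := by
    by_contra h
    exact hT (if_neg h)
  rw [this]

theorem hasParity_single_one (s : Letter) : HasParity 1 (single {s} : FormalSum K) := by
  simpa using hasParity_single (K := K) {s}

theorem single_mul (s : Letter) (f : FormalSum K) (S : Finset Letter) :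
    ((single {s} : FormalSum K) * f : FormalSum K) S =
      if s ∈ S then (-1) ^ ((S.erase s).filter (· < s)).card * f (S.erase s) else 0 := by
  rw [mul_apply]
  split_ifs with h
  · rw [Finset.sum_eq_single {s}]
    · rw [inversions_singleton_left, Finset.sdiff_singleton_eq_erase]
      simp [single]
    · intro T _ hT
      simp [single, hT]
    · intro hs
      simp [h] at hs
  · refine Finset.sum_eq_zero fun T hT => ?_
    rw [single, if_neg, mul_zero, zero_mul]
    rintro rfl
    exact h (Finset.singleton_subset_iff.1 (Finset.mem_powerset.1 hT))

theorem single_mul_self (s : Letter) : (single {s} : FormalSum K) * single {s} = 0 := by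
  refine ext fun S => ?_
  rw [single_mul, zero_apply]
  split_ifs with h
  · rw [single, if_neg, mul_zero]
    intro h'
    have := Finset.notMem_erase s S
    rw [h'] at this
    simp at this
  · rfl

theorem single_mul_single {S T : Finset Letter} (h : ∀ s ∈ S, ∀ t ∈ T, s < t) :
    (single S : FormalSum K) * single T = single (S ∪ T) := by
  have hd : Disjoint S T := Finset.disjoint_left.2 fun s hs ht => lt_irrefl _ (h s hs s ht)
  have h0 : inversions S T = 0 := by
    rw [inversions, Finset.card_eq_zero, Finset.filter_eq_empty_iff]
    rintro ⟨s, t⟩ hst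
    rw [Finset.mem_product] at hst
    exact (h s hst.1 t hst.2).not_gt
  refine ext fun U => ?_
  rw [mul_apply]
  by_cases hU : U = S ∪ T
  · subst hU
    rw [Finset.sum_eq_single S]
    · rw [Finset.union_sdiff_cancel_left hd, h0]
      simp [single]
    · intro W _ hW
      simp [single, hW]
    · intro hS
      exact absurd (Finset.mem_powerset.2 Finset.subset_union_left) hS
  · rw [single, if_neg hU]
    refine Finset.sum_eq_zero fun W hW => ?_
    by_cases h1 : W = S
    · by_cases h2 : U \ W = T
      · refine absurd ?_ hU
        rw [← h1, ← h2, Finset.union_sdiff_of_subset (Finset.mem_powerset.1 hW)]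
      · simp [single, h2]
    · simp [single, h1]

end FormalSum

/-! ### The pivot elements as formal sums -/

variable {K : Type*} [Field K]

variable (K) in
/-- The variable `x_i` as a formal sum. -/
def fx (i : ℕ) : FormalSum K := single {ix i}

variable (K) in
/-- The variable `y_i` as a formal sum. -/
def fy (i : ℕ) : FormalSum K := single {iy i}

theorem ix_lt_ix {i j : ℕ} : ix i < ix j ↔ i < j := by simp [ix]

theorem iy_lt_iy {i j : ℕ} : iy i < iy j ↔ i < j := by simp [iy]

theorem ix_lt_iy (i j : ℕ) : ix i < iy j := by
  simp [ix, iy]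

theorem ix_inj {i j : ℕ} : ix i = ix j ↔ i = j := by simp [ix]

theorem iy_inj {i j : ℕ} : iy i = iy j ↔ i = j := by simp [iy]

theorem ix_ne_iy (i j : ℕ) : ix i ≠ iy j := (ix_lt_iy i j).ne

theorem mem_pivotTerm {i l : ℕ} {s : Letter} (h : s ∈ pivotTerm i l) :
    s = iy (i + 3 * l) ∨ ∃ k, i ≤ k ∧ k < i + 3 * l ∧ s = ix k := by
  simp only [pivotTerm, Finset.mem_insert, Finset.mem_biUnion, Finset.mem_range,
    Finset.mem_singleton] at h
  rcases h with rfl | ⟨m, hm, rfl | rfl⟩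
  · exact Or.inl rfl
  · exact Or.inr ⟨_, by omega, by omega, rfl⟩
  · exact Or.inr ⟨_, by omega, by omega, rfl⟩

theorem pivotTerm_zero (i : ℕ) : pivotTerm i 0 = {iy i} := by simp [pivotTerm]

theorem pivotTerm_succ (i l : ℕ) :
    pivotTerm i (l + 1) = insert (ix i) (insert (ix (i + 1)) (pivotTerm (i + 3) l)) := by
  have h1 : (Finset.range (l + 1)).biUnion
      (fun m => ({ix (i + 3 * m), ix (i + 3 * m + 1)} : Finset Letter)) =
      insert (ix i) (insert (ix (i + 1)) ((Finset.range l).biUnion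
        fun m => {ix (i + 3 + 3 * m), ix (i + 3 + 3 * m + 1)})) := by
    ext s
    simp only [Finset.mem_biUnion, Finset.mem_range, Finset.mem_insert, Finset.mem_singleton]
    constructor
    · rintro ⟨m, hm, h⟩
      cases m with
      | zero => simpa [or_assoc] using Or.inl h
      | succ m =>
        refine Or.inr (Or.inr ⟨m, by omega, ?_⟩)
        rwa [show i + 3 + 3 * m = i + 3 * (m + 1) by ring]
    · rintro (h | h | ⟨m, hm, h⟩)
      · exact ⟨0, by omega, Or.inl h⟩
      · exact ⟨0, by omega, Or.inr h⟩
      · refine ⟨m + 1, by omega, ?_⟩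
        rwa [show i + 3 * (m + 1) = i + 3 + 3 * m by ring]
  rw [pivotTerm, h1, pivotTerm, Finset.insert_comm (iy _), Finset.insert_comm (iy _)]
  congr 4
  ring

theorem ix_notMem_pivotTerm {i j l : ℕ} (h : j < i) : ix j ∉ pivotTerm i l := by
  intro h'
  rcases mem_pivotTerm h' with h' | ⟨k, hk, -, h'⟩
  · exact ix_ne_iy _ _ h'
  · rw [ix_inj] at h'
    omega

theorem lt_of_mem_pivotTerm {i j l : ℕ} (h : j < i) {s : Letter} (hs : s ∈ pivotTerm i l) :
    ix j < s := by
  rcases mem_pivotTerm hs with rfl | ⟨k, hk, -, rfl⟩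
  · exact ix_lt_iy _ _
  · rw [ix_lt_ix]
    omega

theorem card_pivotTerm (i l : ℕ) : (pivotTerm i l).card = 2 * l + 1 := by
  induction l generalizing i with
  | zero => simp [pivotTerm_zero]
  | succ l ih =>
    rw [pivotTerm_succ, Finset.card_insert_of_notMem, Finset.card_insert_of_notMem, ih]
    · ring
    · exact ix_notMem_pivotTerm (by omega)
    · rw [Finset.mem_insert, not_or, ix_inj]
      exact ⟨by omega, ix_notMem_pivotTerm (by omega)⟩

theorem V_apply (i : ℕ) (S : Finset Letter) [Decidable (∃ l, S = pivotTerm i l)] :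
    V K i S = if ∃ l, S = pivotTerm i l then 1 else 0 := by
  unfold V
  congr

theorem V_ne_zero {i : ℕ} {S : Finset Letter} (h : V K i S ≠ 0) : ∃ l, S = pivotTerm i l := by
  classical
  by_contra h'
  exact h (by rw [V_apply, if_neg h'])

theorem V_pivotTerm (i l : ℕ) : V K i (pivotTerm i l) = 1 := by
  classical
  rw [V_apply, if_pos ⟨l, rfl⟩]

theorem hasParity_V (i : ℕ) : FormalSum.HasParity 1 (V K i) := by
  intro S h
  obtain ⟨l, rfl⟩ := V_ne_zero h
  rw [card_pivotTerm]
  push_cast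
  rw [show (2 : ZMod 2) = 0 from rfl]
  ring

theorem V_eq (i : ℕ) : V K i = fy K i + fx K i * fx K (i + 1) * V K (i + 3) := by
  refine FormalSum.ext fun S => ?_
  have key : ∀ l, S = pivotTerm i (l + 1) → (fx K i * (fx K (i + 1) * V K (i + 3))) S = 1 := by
    rintro l rfl
    have h1 : ix i ∉ insert (ix (i + 1)) (pivotTerm (i + 3) l) := by
      rw [Finset.mem_insert, not_or, ix_inj]
      exact ⟨by omega, ix_notMem_pivotTerm (by omega)⟩
    have h2 : ix (i + 1) ∉ pivotTerm (i + 3) l := ix_notMem_pivotTerm (by omega)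
    rw [fx, FormalSum.single_mul, pivotTerm_succ, if_pos (Finset.mem_insert_self _ _),
      Finset.erase_insert h1, fx, FormalSum.single_mul, if_pos (Finset.mem_insert_self _ _),
      Finset.erase_insert h2, V_pivotTerm, Finset.filter_false_of_mem, Finset.filter_false_of_mem]
    · simp
    · intro s hs
      exact (lt_of_mem_pivotTerm (by omega) hs).not_gt
    · intro s hs
      rcases Finset.mem_insert.1 hs with rfl | hs
      · rw [ix_lt_ix]
        omega
      · exact (lt_of_mem_pivotTerm (by omega) hs).not_gt
  have key' : (fx K i * (fx K (i + 1) * V K (i + 3))) S ≠ 0 → ∃ l, S = pivotTerm i (l + 1) := by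
    rw [fx, FormalSum.single_mul, fx, FormalSum.single_mul]
    intro h
    split_ifs at h with h1 h2
    · obtain ⟨l, hl⟩ := V_ne_zero (right_ne_zero_of_mul (right_ne_zero_of_mul h))
      refine ⟨l, ?_⟩
      rw [pivotTerm_succ, ← hl, Finset.insert_erase h2, Finset.insert_erase h1]
    · simp at h
    · simp at h
  rw [FormalSum.add_apply, mul_assoc]
  by_cases h0 : S = {iy i}
  · have h1 : (fx K i * (fx K (i + 1) * V K (i + 3))) S = 0 := by
      by_contra h
      obtain ⟨l, hl⟩ := key' h
      have h2 : ix i ∈ ({iy i} : Finset Letter) := by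
        rw [← h0, hl, pivotTerm_succ]
        exact Finset.mem_insert_self _ _
      exact ix_ne_iy _ _ (Finset.mem_singleton.1 h2)
    rw [h1, h0, ← pivotTerm_zero, V_pivotTerm, pivotTerm_zero, fy, single, if_pos rfl, add_zero]
  · rw [fy, single, if_neg h0, zero_add]
    by_cases h : ∃ l, S = pivotTerm i (l + 1)
    · obtain ⟨l, hl⟩ := h
      rw [key l hl, hl, V_pivotTerm]
    · have h1 : (fx K i * (fx K (i + 1) * V K (i + 3))) S = 0 := by
        by_contra h'
        exact h (key' h')
      rw [h1]
      by_contra h2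
      obtain ⟨l, hl⟩ := V_ne_zero h2
      cases l with
      | zero => exact h0 (hl.trans (pivotTerm_zero i))
      | succ l => exact h ⟨l, hl⟩

theorem hasParity_fx (i : ℕ) : FormalSum.HasParity 1 (fx K i) :=
  FormalSum.hasParity_single_one _

theorem hasParity_fy (i : ℕ) : FormalSum.HasParity 1 (fy K i) :=
  FormalSum.hasParity_single_one _

/-- For `τ = 0` the relations say that the odd elements involved anticommute, which holds by
supercommutativity, together with the recursion `V_eq`. -/
theorem pivot_formal : Pivot (0 : K) (fx K) (fy K) (V K) where
  XX i j := FormalSum.anti_of_odd (hasParity_fx i) (hasParity_fx j)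
  X_sq i := FormalSum.single_mul_self _
  DX i j _ := FormalSum.anti_of_odd (hasParity_fy i) (hasParity_fx j)
  DX_self i := by
    rw [zero_smul, zero_sub]
    exact FormalSum.anti_of_odd (hasParity_fy i) (hasParity_fx i)
  D_sq i := FormalSum.single_mul_self _
  Dv i j _ := FormalSum.anti_of_odd (hasParity_fy i) (hasParity_V j)
  vX i j _ := FormalSum.anti_of_odd (hasParity_V j) (hasParity_fx i)
  v_eq := V_eq

theorem monoP_eq (α β : Finset ℕ) : monoP K α β = Pivot.mono (fx K) (V K) α β := rfl

/-! ### Linear independence -/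

/-- The sum of the indices of the letters `y` in a monomial. -/
def ySum (S : Finset Letter) : ℕ := ∑ s ∈ S, Sum.elim (fun _ => 0) (fun j => j) (ofLex s)

theorem ySum_sdiff {S T : Finset Letter} (h : T ⊆ S) : ySum T + ySum (S \ T) = ySum S := by
  rw [add_comm]
  exact Finset.sum_sdiff h

/-- All monomials of the formal sum have `y`-index sum at least `k`. -/
def YGe (k : ℕ) (f : FormalSum K) : Prop := ∀ S, f S ≠ 0 → k ≤ ySum S

theorem YGe.mul {k l : ℕ} {f g : FormalSum K} (hf : YGe k f) (hg : YGe l g) :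
    YGe (k + l) (f * g) := by
  intro S h
  obtain ⟨T, hT, h1, h2⟩ := exists_of_mul_ne h
  rw [← ySum_sdiff hT]
  exact add_le_add (hf T h1) (hg _ h2)

theorem YGe.add {k : ℕ} {f g : FormalSum K} (hf : YGe k f) (hg : YGe k g) : YGe k (f + g) := by
  intro S h
  by_cases h1 : f S = 0
  · by_cases h2 : g S = 0
    · rw [FormalSum.add_apply, h1, h2, add_zero] at h
      exact absurd rfl h
    · exact hg S h2
  · exact hf S h1

theorem YGe.mono {k l : ℕ} {f : FormalSum K} (hf : YGe l f) (h : k ≤ l) : YGe k f :=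
  fun S hS => h.trans (hf S hS)

theorem yGe_zero (f : FormalSum K) : YGe 0 f := fun _ _ => Nat.zero_le _

theorem yGe_single {k : ℕ} {S : Finset Letter} (h : k ≤ ySum S) :
    YGe k (single S : FormalSum K) := by
  intro T hT
  have : T = S := by
    by_contra h
    exact hT (if_neg h)
  rwa [this]

theorem ySum_pivotTerm (i l : ℕ) : ySum (pivotTerm i l) = i + 3 * l := by
  induction l generalizing i with
  | zero => simp [pivotTerm_zero, ySum, iy]
  | succ l ih =>
    rw [pivotTerm_succ, ySum, Finset.sum_insert, Finset.sum_insert]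
    · have := ih (i + 3)
      rw [ySum] at this
      rw [this]
      simp [ix]
      ring
    · exact ix_notMem_pivotTerm (by omega)
    · rw [Finset.mem_insert, not_or, ix_inj]
      exact ⟨by omega, ix_notMem_pivotTerm (by omega)⟩

/-- After the leading term `y_i`, every term of `V_i` has a single `y`, with index at least `i + 3`.
-/
theorem yGe_V_sub (i : ℕ) : YGe (i + 1) (V K i - fy K i) := by
  rw [V_eq, add_sub_cancel_left]
  have : YGe (i + 3) (V K (i + 3)) := by
    intro S h
    obtain ⟨l, rfl⟩ := V_ne_zero h
    rw [ySum_pivotTerm]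
    omega
  exact ((yGe_zero _).mul this).mono (by omega)

theorem ordProd_single (e : ℕ → Letter) (he : ∀ i j, i < j → e i < e j) (s : Finset ℕ) :
    ordProd (fun i => (single {e i} : FormalSum K)) s = single (s.image e) := by
  induction s using Finset.induction_on_min with
  | empty =>
    rw [Finset.image_empty]
    exact ordProd_empty _
  | insert a s hs ih =>
    rw [ordProd_insert _ hs, ih, FormalSum.single_mul_single, Finset.image_insert,
      Finset.insert_eq]
    intro b hb c hc
    rw [Finset.mem_singleton] at hb
    obtain ⟨d, hd, rfl⟩ := Finset.mem_image.1 hc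
    exact hb ▸ he _ _ (hs d hd)

theorem yGe_ordProd_fy (β : Finset ℕ) : YGe (∑ j ∈ β, j) (ordProd (fy K) β) := by
  induction β using Finset.induction_on_min with
  | empty => exact yGe_zero _
  | insert a s hs ih =>
    rw [ordProd_insert _ hs, Finset.sum_insert fun ha => lt_irrefl _ (hs a ha)]
    exact YGe.mul (yGe_single (by simp [ySum, iy])) ih

theorem yGe_ordProd_V (β : Finset ℕ) :
    YGe (∑ j ∈ β, j + 1) (ordProd (V K) β - ordProd (fy K) β) := by
  induction β using Finset.induction_on_min with
  | empty =>
    intro S h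
    simp [FormalSum.zero_apply] at h
  | insert a s hs ih =>
    have e : ordProd (V K) (insert a s) - ordProd (fy K) (insert a s) =
        fy K a * (ordProd (V K) s - ordProd (fy K) s) +
        (V K a - fy K a) * (ordProd (V K) s - ordProd (fy K) s) +
        (V K a - fy K a) * ordProd (fy K) s := by
      rw [ordProd_insert _ hs, ordProd_insert _ hs]
      noncomm_ring
    rw [e, Finset.sum_insert fun ha => lt_irrefl _ (hs a ha)]
    have h1 : YGe a (fy K a) := yGe_single (by simp [ySum, iy])
    refine ((YGe.mul h1 ih).mono (by omega)).add ((YGe.mul (yGe_V_sub a) ih).mono (by omega)) |>.add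
      ((YGe.mul (yGe_V_sub a) (yGe_ordProd_fy s)).mono (by omega))

/-- The monomial `x^α y^β`. -/
def leadingTerm (p : Finset ℕ × Finset ℕ) : Finset Letter := p.1.image ix ∪ p.2.image iy

theorem leadingTerm_injective : Function.Injective leadingTerm := by
  rintro ⟨α, β⟩ ⟨γ, δ⟩ h
  have h1 : ∀ i, ix i ∈ leadingTerm (α, β) ↔ i ∈ α := by
    intro i
    simp [leadingTerm, ix, iy]
  have h2 : ∀ i, iy i ∈ leadingTerm (α, β) ↔ i ∈ β := by
    intro i
    simp [leadingTerm, ix, iy]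
  have h3 : ∀ i, ix i ∈ leadingTerm (γ, δ) ↔ i ∈ γ := by
    intro i
    simp [leadingTerm, ix, iy]
  have h4 : ∀ i, iy i ∈ leadingTerm (γ, δ) ↔ i ∈ δ := by
    intro i
    simp [leadingTerm, ix, iy]
  rw [Prod.mk.injEq]
  constructor
  · ext i
    rw [← h1, h, h3]
  · ext i
    rw [← h2, h, h4]

theorem ySum_leadingTerm (p : Finset ℕ × Finset ℕ) : ySum (leadingTerm p) = ∑ j ∈ p.2, j := by
  rw [leadingTerm, ySum, Finset.sum_union, Finset.sum_image, Finset.sum_image]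
  · simp [ix, iy]
  · intro i _ j _ h
    exact iy_inj.1 h
  · intro i _ j _ h
    exact ix_inj.1 h
  · rw [Finset.disjoint_left]
    intro s h1 h2
    obtain ⟨i, -, rfl⟩ := Finset.mem_image.1 h1
    obtain ⟨j, -, h⟩ := Finset.mem_image.1 h2
    exact ix_ne_iy _ _ h.symm

theorem mono_formal_leading (α β : Finset ℕ) :
    YGe (∑ j ∈ β, j + 1)
      (Pivot.mono (fx K) (V K) α β - (single (leadingTerm (α, β)) : FormalSum K)) := by
  have e : (single (leadingTerm (α, β)) : FormalSum K) = ordProd (fx K) α * ordProd (fy K) β := by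
    have h1 : ordProd (fx K) α = single (α.image ix) :=
      ordProd_single ix (fun _ _ => ix_lt_ix.2) α
    have h2 : ordProd (fy K) β = single (β.image iy) :=
      ordProd_single iy (fun _ _ => iy_lt_iy.2) β
    rw [h1, h2, FormalSum.single_mul_single, leadingTerm]
    intro s hs t ht
    obtain ⟨i, -, rfl⟩ := Finset.mem_image.1 hs
    obtain ⟨j, -, rfl⟩ := Finset.mem_image.1 ht
    exact ix_lt_iy _ _
  rw [e, Pivot.mono, ← mul_sub]
  exact (YGe.mul (yGe_zero _) (yGe_ordProd_V β)).mono (by omega)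

/-- In a vanishing combination, take a monomial with nonzero coefficient and minimal sum of
`y`-indices. Its leading term does not occur in any other monomial with nonzero coefficient: their
leading terms differ from it, and all their further terms have a larger sum. -/
theorem mono_formal_linearIndependent :
    LinearIndependent K fun p : Finset ℕ × Finset ℕ => Pivot.mono (fx K) (V K) p.1 p.2 := by
  classical
  rw [linearIndependent_iff']
  intro s g hg p hp
  by_contra hgp
  obtain ⟨q, hq, hmin⟩ := Finset.exists_min_image (s.filter fun p => g p ≠ 0)
    (fun p => ∑ j ∈ p.2, j) ⟨p, Finset.mem_filter.2 ⟨hp, hgp⟩⟩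
  rw [Finset.mem_filter] at hq
  have hev : ∀ (t : Finset (Finset ℕ × Finset ℕ)) (F : Finset ℕ × Finset ℕ → FormalSum K) (S),
      (∑ r ∈ t, F r) S = ∑ r ∈ t, F r S := fun t F S => Finset.sum_apply S t F
  have h0 := congrFun hg (leadingTerm q)
  rw [hev] at h0
  refine hq.2 ?_
  rw [← h0.trans (FormalSum.zero_apply _)]
  have hcoef : ∀ r ∈ s, (g r • Pivot.mono (fx K) (V K) r.1 r.2) (leadingTerm q) =
      if r = q then g q else 0 := by
    intro r hr
    rw [FormalSum.smul_apply]
    by_cases hgr : g r = 0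
    · rw [hgr, zero_mul]
      split_ifs with h
      · rw [← h, hgr]
      · rfl
    have h1 : (Pivot.mono (fx K) (V K) r.1 r.2 - (single (leadingTerm r) : FormalSum K))
        (leadingTerm q) = 0 := by
      by_contra h
      have := mono_formal_leading r.1 r.2 _ h
      rw [ySum_leadingTerm] at this
      have := hmin r (Finset.mem_filter.2 ⟨hr, hgr⟩)
      omega
    rw [FormalSum.sub_apply, sub_eq_zero] at h1
    rw [h1, single]
    by_cases hrq : r = q
    · subst hrq
      simp
    · rw [if_neg fun h => hrq (leadingTerm_injective h.symm), if_neg hrq, mul_zero]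
  rw [Finset.sum_congr rfl hcoef, Finset.sum_ite_eq' s q, if_pos hq.1]

end FractalSuper

namespace FractalSuper

/-! ### The superderivatives of formal sums -/

namespace FormalSum

variable {K : Type*} [Field K]

theorem HasParity.add {p : ZMod 2} {f g : FormalSum K} (hf : HasParity p f) (hg : HasParity p g) :
    HasParity p (f + g) := by
  intro S h
  by_cases h1 : f S = 0
  · by_cases h2 : g S = 0
    · rw [add_apply, h1, h2, add_zero] at h
      exact absurd rfl h
    · exact hg S h2
  · exact hf S h1

theorem HasParity.smul {p : ZMod 2} {f : FormalSum K} (hf : HasParity p f) (c : K) :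
    HasParity p (c • f) := fun S h => hf S fun h' => h (by rw [smul_apply, h', mul_zero])

theorem hasParity_zero (p : ZMod 2) : HasParity p (0 : FormalSum K) := fun _ h => absurd rfl h

theorem hasParity_one : HasParity 0 (1 : FormalSum K) := hasParity_single (K := K) ∅

theorem pd_apply_of_mem {s : Letter} {S : Finset Letter} (h : s ∈ S) (f : FormalSum K) :
    pd s f S = 0 := if_pos h

theorem pd_apply_of_notMem {s : Letter} {S : Finset Letter} (h : s ∉ S) (f : FormalSum K) :
    pd s f S = (-1) ^ (S.filter (· < s)).card * f (insert s S) := if_neg h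

theorem pd_add (s : Letter) (f g : FormalSum K) : pd s (f + g) = pd s f + pd s g := by
  refine ext fun S => ?_
  by_cases h : s ∈ S
  · simp only [add_apply, pd_apply_of_mem h, add_zero]
  · simp only [add_apply, pd_apply_of_notMem h, mul_add]

theorem pd_smul (s : Letter) (c : K) (f : FormalSum K) : pd s (c • f) = c • pd s f := by
  refine ext fun S => ?_
  by_cases h : s ∈ S
  · simp only [smul_apply, pd_apply_of_mem h, mul_zero]
  · simp only [smul_apply, pd_apply_of_notMem h]
    ring

theorem HasParity.pd {p : ZMod 2} {f : FormalSum K} (hf : HasParity p f) (s : Letter) :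
    HasParity (p + 1) (pd s f) := by
  intro S h
  by_cases hs : s ∈ S
  · exact absurd (pd_apply_of_mem hs f) h
  · rw [← hf _ (pd_ne h), Finset.card_insert_of_notMem hs, Nat.cast_add, Nat.cast_one, add_assoc,
      CharTwo.add_self_eq_zero, add_zero]

theorem HasParity.twist {p : ZMod 2} {f : FormalSum K} (hf : HasParity p f) :
    twist f = (-(-1) ^ p.val : K) • f := by
  refine ext fun S => ?_
  rw [smul_apply, FractalSuper.twist]
  by_cases h : f S = 0
  · rw [h, mul_zero, mul_zero]
  · rw [pow_succ, mul_neg_one, neg_one_pow_eq (a := S.card) (b := p.val)]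
    rw [ZMod.natCast_zmod_val, hf S h]

/-- The letter `s` does not occur in the formal sum. -/
def Avoids (s : Letter) (f : FormalSum K) : Prop := ∀ S, s ∈ S → f S = 0

theorem Avoids.mul {s : Letter} {f g : FormalSum K} (hf : Avoids s f) (hg : Avoids s g) :
    Avoids s (f * g) := by
  intro S hS
  by_contra h
  obtain ⟨T, hT, h1, h2⟩ := exists_of_mul_ne h
  by_cases hsT : s ∈ T
  · exact h1 (hf T hsT)
  · exact h2 (hg _ (Finset.mem_sdiff.2 ⟨hS, hsT⟩))

theorem Avoids.add {s : Letter} {f g : FormalSum K} (hf : Avoids s f) (hg : Avoids s g) :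
    Avoids s (f + g) := fun S hS => by rw [add_apply, hf S hS, hg S hS, add_zero]

theorem Avoids.smul {s : Letter} {f : FormalSum K} (hf : Avoids s f) (c : K) :
    Avoids s (c • f) := fun S hS => by rw [smul_apply, hf S hS, mul_zero]

theorem avoids_pd (s : Letter) (f : FormalSum K) : Avoids s (pd s f) :=
  fun _ hS => pd_apply_of_mem hS f

theorem Avoids.pd_eq {s : Letter} {f : FormalSum K} (hf : Avoids s f) : pd s f = 0 := by
  refine ext fun S => ?_
  by_cases h : s ∈ S
  · exact pd_apply_of_mem h f
  · rw [pd_apply_of_notMem h, hf _ (Finset.mem_insert_self _ _), mul_zero, zero_apply]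

theorem Avoids.pd_single_mul {s : Letter} {f : FormalSum K} (hf : Avoids s f) :
    pd s ((single {s} : FormalSum K) * f) = f := by
  refine ext fun S => ?_
  by_cases h : s ∈ S
  · rw [pd_apply_of_mem h, hf S h]
  · rw [pd_apply_of_notMem h, single_mul, if_pos (Finset.mem_insert_self _ _),
      Finset.erase_insert h, ← mul_assoc, ← mul_pow, neg_mul_neg, one_mul, one_pow, one_mul]

/-- The monomials of a formal sum that do not contain the letter `s`. -/
def free (s : Letter) (f : FormalSum K) : FormalSum K := fun S => if s ∈ S then 0 else f S

theorem avoids_free (s : Letter) (f : FormalSum K) : Avoids s (free s f) := fun _ hS => if_pos hS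

theorem HasParity.free {p : ZMod 2} {f : FormalSum K} (hf : HasParity p f) (s : Letter) :
    HasParity p (free s f) := by
  intro S h
  unfold FormalSum.free at h
  split_ifs at h
  · exact absurd rfl h
  · exact hf S h

theorem free_add_single_mul_pd (s : Letter) (f : FormalSum K) :
    f = free s f + single {s} * pd s f := by
  refine ext fun S => ?_
  rw [add_apply, single_mul, free]
  split_ifs with h
  · rw [pd_apply_of_notMem (Finset.notMem_erase _ _), Finset.insert_erase h, ← mul_assoc, ← mul_pow,
      neg_mul_neg, one_mul, one_pow, one_mul, zero_add]
  · rw [add_zero]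

/-- Write both factors as `f0 + s f1` with parts free of the letter `s`. The coefficient of `s` in
the product can then be read off, and the sign arises from moving `s` past `f0`. -/
theorem pd_mul {p : ZMod 2} {f : FormalSum K} (hf : HasParity p f) (g : FormalSum K) (s : Letter) :
    pd s (f * g) = pd s f * g + ((-1) ^ p.val : K) • (f * pd s g) := by
  set e : FormalSum K := single {s} with he
  have he1 : HasParity 1 e := hasParity_single_one s
  have hee : e * e = 0 := single_mul_self s
  set f0 := free s f
  set f1 := pd s f
  set g0 := free s g
  set g1 := pd s g
  have ef : f = f0 + e * f1 := free_add_single_mul_pd s f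
  have eg : g = g0 + e * g1 := free_add_single_mul_pd s g
  have c0 : f0 * e = ((-1) ^ p.val : K) • (e * f0) := by
    rw [mul_comm_of_parity (hf.free s) he1, sgn, ZMod.val_one, mul_one]
  have c1 : f1 * e = -((-1) ^ p.val : K) • (e * f1) := by
    rw [mul_comm_of_parity (hf.pd s) he1, sgn, ZMod.val_one, mul_one]
    rcases zmod_two_cases p with rfl | rfl
    · simp [ZMod.val_one, f1]
    · rw [CharTwo.add_self_eq_zero]
      simp [ZMod.val_one, f1]
  have h1 : f * g = f0 * g0 + e * (f1 * g0 + ((-1) ^ p.val : K) • (f0 * g1)) := by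
    have h2 : e * f1 * (e * g1) = 0 := by
      rw [mul_assoc, ← mul_assoc f1, c1, smul_mul_assoc, mul_smul_comm, ← mul_assoc, ← mul_assoc,
        hee, zero_mul, zero_mul, smul_zero]
    conv_lhs => rw [ef, eg]
    rw [add_mul, mul_add, mul_add, h2, ← mul_assoc f0, c0, mul_add, mul_smul_comm, smul_mul_assoc,
      mul_assoc, mul_assoc]
    abel
  rw [h1, pd_add, ((avoids_free s f).mul (avoids_free s g)).pd_eq, zero_add,
    (((avoids_pd s f).mul (avoids_free s g)).add
      (((avoids_free s f).mul (avoids_pd s g)).smul _)).pd_single_mul]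
  conv_rhs => rw [eg, ef]
  rw [mul_add, ← mul_assoc f1, c1, add_mul, smul_add, smul_mul_assoc, neg_smul]
  abel

theorem pd_single_self (s : Letter) : pd s (single {s} : FormalSum K) = 1 := by
  have := Avoids.pd_single_mul (K := K) (s := s) (f := 1) fun S hS => by
    rw [one_apply, if_neg]
    rintro rfl
    simp at hS
  rwa [mul_one] at this

theorem avoids_single {s : Letter} {S : Finset Letter} (h : s ∉ S) :
    Avoids s (single S : FormalSum K) := fun T hT => if_neg fun (e : T = S) => h (e ▸ hT)

/-! ### Formal sums with a Poisson bracket -/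

variable (K) in
/-- The formal sums in which every monomial occurs with only finitely many variables `x_i` as
additional factor. -/
def xFinite : Subalgebra K (FormalSum K) where
  carrier := {f | ∀ T, {i : ℕ | f (insert (ix i) T) ≠ 0}.Finite}
  mul_mem' := by
    intro f g hf hg T
    refine ((Finset.finite_toSet T.powerset).biUnion fun W _ => (hf W).union (hg W)).subset ?_
    intro i hi
    obtain ⟨U, hU, h1, h2⟩ := exists_of_mul_ne hi
    by_cases hiU : ix i ∈ U
    · refine Set.mem_biUnion (x := U.erase (ix i)) ?_ (Or.inl ?_)
      · rw [Finset.mem_coe, Finset.mem_powerset]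
        intro s hs
        exact (Finset.mem_insert.1 (hU (Finset.mem_of_mem_erase hs))).resolve_left
          (Finset.ne_of_mem_erase hs)
      · change f (insert (ix i) (U.erase (ix i))) ≠ 0
        rwa [Finset.insert_erase hiU]
    · have hm : ix i ∈ insert (ix i) T \ U := Finset.mem_sdiff.2 ⟨Finset.mem_insert_self _ _, hiU⟩
      refine Set.mem_biUnion (x := (insert (ix i) T \ U).erase (ix i)) ?_ (Or.inr ?_)
      · rw [Finset.mem_coe, Finset.mem_powerset]
        intro s hs
        exact (Finset.mem_insert.1 (Finset.mem_sdiff.1 (Finset.mem_of_mem_erase hs)).1).resolve_left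
            (Finset.ne_of_mem_erase hs)
      · change g (insert (ix i) _) ≠ 0
        rwa [Finset.insert_erase hm]
  add_mem' := by
    intro f g hf hg T
    refine ((hf T).union (hg T)).subset fun i hi => ?_
    by_contra h
    simp only [Set.mem_union, Set.mem_ofPred_eq, not_or, not_not] at h
    exact hi (by rw [add_apply, h.1, h.2, add_zero])
  algebraMap_mem' := by
    intro r T
    refine Set.finite_empty.subset fun i hi => hi ?_
    rw [Algebra.algebraMap_eq_smul_one, smul_apply, one_apply, if_neg (Finset.insert_ne_empty _ _),
      mul_zero]

/-- The `i`-th term of the bracket. -/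
def bracketTerm (i : ℕ) (f g : FormalSum K) : FormalSum K :=
  pd (ix i) (twist f) * pd (iy i) g + pd (iy i) (twist f) * pd (ix i) g

theorem bracket_apply (f g : FormalSum K) (S : Finset Letter) :
    bracket f g S = ∑ᶠ i, bracketTerm i f g S := rfl

/-- Each product in the `i`-th term differentiates one factor by `x_i`. A contribution at `S`
requires that factor to contain a monomial `x_i T` with `T ⊆ S`, which happens for finitely many
`i`. Unlike `HH K`, the algebra `xFinite K` contains the single variables `x_i`, so brackets of
generators make sense there. -/
theorem bracketTerm_finite {f g : FormalSum K} (hf : f ∈ xFinite K) (hg : g ∈ xFinite K)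
    (S : Finset Letter) : (Function.support fun i => bracketTerm i f g S).Finite := by
  refine ((Finset.finite_toSet S.powerset).biUnion fun W _ => (hf W).union (hg W)).subset ?_
  intro i hi
  rw [Function.mem_support, bracketTerm, add_apply] at hi
  by_cases h1 : (pd (ix i) (twist f) * pd (iy i) g) S = 0
  · rw [h1, zero_add] at hi
    obtain ⟨T, hT, h2, h3⟩ := exists_of_mul_ne hi
    refine Set.mem_biUnion (x := S \ T) ?_ (Or.inr (pd_ne h3))
    simp
  · obtain ⟨T, hT, h2, h3⟩ := exists_of_mul_ne h1
    refine Set.mem_biUnion (x := T) ?_ (Or.inl (pd_twist_ne h2))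
    simpa using hT

theorem twist_add (f g : FormalSum K) : twist (f + g) = twist f + twist g := by
  refine ext fun S => ?_
  simp only [twist, add_apply, mul_add]

theorem twist_smul (c : K) (f : FormalSum K) : twist (c • f) = c • twist f := by
  refine ext fun S => ?_
  simp only [twist, smul_apply]
  ring

theorem bracket_add_left {f g h : FormalSum K} (hf : f ∈ xFinite K) (hg : g ∈ xFinite K)
    (hh : h ∈ xFinite K) : bracket (f + g) h = bracket f h + bracket g h := by
  refine ext fun S => ?_
  rw [add_apply, bracket_apply, bracket_apply, bracket_apply,
    ← finsum_add_distrib (bracketTerm_finite hf hh S) (bracketTerm_finite hg hh S)]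
  refine finsum_congr fun i => ?_
  rw [← add_apply]
  refine congrFun ?_ S
  simp only [bracketTerm, twist_add, pd_add, add_mul]
  abel

theorem bracket_add_right {f g h : FormalSum K} (hf : f ∈ xFinite K) (hg : g ∈ xFinite K)
    (hh : h ∈ xFinite K) : bracket f (g + h) = bracket f g + bracket f h := by
  refine ext fun S => ?_
  rw [add_apply, bracket_apply, bracket_apply, bracket_apply,
    ← finsum_add_distrib (bracketTerm_finite hf hg S) (bracketTerm_finite hf hh S)]
  refine finsum_congr fun i => ?_
  rw [← add_apply]
  refine congrFun ?_ S
  simp only [bracketTerm, pd_add, mul_add]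
  abel

theorem bracket_smul_left (c : K) (f g : FormalSum K) : bracket (c • f) g = c • bracket f g := by
  refine ext fun S => ?_
  rw [smul_apply, bracket_apply, bracket_apply, ← smul_eq_mul, smul_finsum]
  refine finsum_congr fun i => ?_
  rw [smul_eq_mul, ← smul_apply]
  refine congrFun ?_ S
  simp only [bracketTerm, twist_smul, pd_smul, smul_mul_assoc, smul_add]
  rfl

theorem bracket_smul_right (c : K) (f g : FormalSum K) : bracket f (c • g) = c • bracket f g := by
  refine ext fun S => ?_
  rw [smul_apply, bracket_apply, bracket_apply, ← smul_eq_mul, smul_finsum]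
  refine finsum_congr fun i => ?_
  rw [smul_eq_mul, ← smul_apply]
  refine congrFun ?_ S
  simp only [bracketTerm, pd_smul, mul_smul_comm, smul_add]
  rfl

theorem HasParity.bracketTerm {p q : ZMod 2} {f g : FormalSum K} (hf : HasParity p f)
    (hg : HasParity q g) (i : ℕ) : HasParity (p + q) (bracketTerm i f g) := by
  have e : p + 1 + (q + 1) = p + q := by
    rw [add_add_add_comm, CharTwo.add_self_eq_zero, add_zero]
  rw [FormalSum.bracketTerm, hf.twist, pd_smul, pd_smul, smul_mul_assoc, smul_mul_assoc, ← smul_add]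
  refine HasParity.smul ?_ _
  rw [← e]
  exact ((hf.pd _).mul (hg.pd _)).add ((hf.pd _).mul (hg.pd _))

theorem HasParity.bracket {p q : ZMod 2} {f g : FormalSum K} (hf : HasParity p f)
    (hg : HasParity q g) : HasParity (p + q) (bracket f g) := by
  intro S h
  rw [bracket_apply] at h
  obtain ⟨i, hi⟩ : ∃ i, FormalSum.bracketTerm i f g S ≠ 0 := by
    by_contra h'
    push Not at h'
    exact h (finsum_eq_zero_of_forall_eq_zero h')
  exact hf.bracketTerm hg i S hi

theorem bracketTerm_anticomm {p q : ZMod 2} {f g : FormalSum K} (hf : HasParity p f)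
    (hg : HasParity q g) (i : ℕ) : bracketTerm i f g = -(sgn K p q • bracketTerm i g f) := by
  rw [bracketTerm, bracketTerm, hf.twist, hg.twist, pd_smul, pd_smul, pd_smul, pd_smul]
  simp only [smul_mul_assoc]
  rw [mul_comm_of_parity (hf.pd (ix i)) (hg.pd (iy i)),
    mul_comm_of_parity (hf.pd (iy i)) (hg.pd (ix i))]
  rcases zmod_two_cases p with rfl | rfl <;> rcases zmod_two_cases q with rfl | rfl <;>
    simp [sgn, CharTwo.add_self_eq_zero, ZMod.val_one, add_comm]

theorem bracket_anticomm {p q : ZMod 2} {f g : FormalSum K} (hf : HasParity p f)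
    (hg : HasParity q g) : bracket f g = -(sgn K p q • bracket g f) := by
  refine ext fun S => ?_
  rw [neg_apply, smul_apply, bracket_apply, bracket_apply, ← smul_eq_mul, smul_finsum,
    ← finsum_neg_distrib]
  refine finsum_congr fun i => ?_
  rw [bracketTerm_anticomm hf hg i]
  rfl

theorem bracketTerm_mul {p q : ZMod 2} {f g : FormalSum K} (hf : HasParity p f)
    (hg : HasParity q g) (h : FormalSum K) (i : ℕ) :
    bracketTerm i f (g * h) = bracketTerm i f g * h + sgn K p q • (g * bracketTerm i f h) := by
  have c1 := mul_comm_of_parity (hf.pd (ix i)) hg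
  have c2 := mul_comm_of_parity (hf.pd (iy i)) hg
  rw [bracketTerm, bracketTerm, bracketTerm, hf.twist, pd_smul, pd_smul, pd_mul hg, pd_mul hg]
  simp only [smul_mul_assoc, mul_smul_comm, mul_add, ← mul_assoc, c1, c2, add_mul]
  rcases zmod_two_cases p with rfl | rfl <;> rcases zmod_two_cases q with rfl | rfl <;>
    simp [sgn, CharTwo.add_self_eq_zero, ZMod.val_one] <;> abel

/-- A pointwise finite sum of formal sums. -/
def pointwiseSum (F : ℕ → FormalSum K) : FormalSum K := fun S => ∑ᶠ i, F i S

theorem finsum_mul_apply {F : ℕ → FormalSum K}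
    (hF : ∀ S, (Function.support fun i => F i S).Finite) (h : FormalSum K) (S : Finset Letter) :
    ∑ᶠ i, (F i * h) S = (pointwiseSum F * h) S := by
  simp only [mul_apply, pointwiseSum]
  rw [finsum_sum_comm]
  · refine Finset.sum_congr rfl fun T _ => ?_
    rw [mul_assoc, finsum_mul' _ _ (hF T), mul_finsum' _ _ ((hF T).subset ?_)]
    · simp only [mul_assoc]
    · intro i hi
      exact left_ne_zero_of_mul hi
  · intro T _
    exact (hF T).subset fun i hi => right_ne_zero_of_mul (left_ne_zero_of_mul hi)

theorem finsum_mul_apply_left {F : ℕ → FormalSum K}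
    (hF : ∀ S, (Function.support fun i => F i S).Finite) (h : FormalSum K) (S : Finset Letter) :
    ∑ᶠ i, (h * F i) S = (h * pointwiseSum F) S := by
  simp only [mul_apply, pointwiseSum]
  rw [finsum_sum_comm]
  · refine Finset.sum_congr rfl fun T _ => ?_
    rw [mul_finsum' _ _ (hF _)]
  · intro T _
    exact (hF _).subset fun i hi => right_ne_zero_of_mul hi

/-- The identity holds for each `bracketTerm`. The finiteness conditions allow multiplication to be
interchanged with the sum over `i`, coefficient by coefficient. -/
theorem bracket_mul {p q : ZMod 2} {f g h : FormalSum K} (hf : HasParity p f)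
    (hg : HasParity q g) (hf' : f ∈ xFinite K) (hg' : g ∈ xFinite K) (hh' : h ∈ xFinite K) :
    bracket f (g * h) = bracket f g * h + sgn K p q • (g * bracket f h) := by
  refine ext fun S => ?_
  have e1 := finsum_mul_apply (bracketTerm_finite hf' hg') h S
  have e2 := finsum_mul_apply_left (bracketTerm_finite hf' hh') g S
  have f1 : (Function.support fun i => (bracketTerm i f g * h) S).Finite := by
    refine ((Finset.finite_toSet S.powerset).biUnion fun W _ => bracketTerm_finite hf' hg' W).subset
      fun i hi => ?_
    obtain ⟨T, hT, h1, h2⟩ := exists_of_mul_ne hi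
    exact Set.mem_biUnion (Finset.mem_coe.2 (Finset.mem_powerset.2 hT)) h1
  have f2 : (Function.support fun i => sgn K p q * (g * bracketTerm i f h) S).Finite := by
    refine ((Finset.finite_toSet S.powerset).biUnion fun W _ => bracketTerm_finite hf' hh' W).subset
      fun i hi => ?_
    obtain ⟨T, hT, h1, h2⟩ := exists_of_mul_ne (right_ne_zero_of_mul hi)
    exact Set.mem_biUnion (Finset.mem_coe.2 (Finset.mem_powerset.2 Finset.sdiff_subset)) h2
  change _ = (bracket f g * h) S + sgn K p q * (g * bracket f h) S
  rw [show (bracket f g * h) S = _ from e1.symm, show (g * bracket f h) S = _ from e2.symm,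
    mul_finsum, ← finsum_add_distrib f1 f2, bracket_apply]
  refine finsum_congr fun i => ?_
  rw [bracketTerm_mul hf hg]
  rfl

end FormalSum

end FractalSuper

namespace FractalSuper

variable {K : Type*} [Field K]

/-! ### The correspondence between formal sums and operators -/

/-- Polynomials act on formal sums by their constant coefficients. -/
instance : Algebra K[X] (FormalSum K) := Algebra.compHom _ (Polynomial.evalRingHom (0 : K))

theorem poly_smul_formal (p : K[X]) (f : FormalSum K) : p • f = p.eval 0 • f := rfl

theorem Pivot.prod {R B C : Type*} [CommRing R] [Ring B] [Algebra R B] [Ring C] [Algebra R C]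
    {τ : R} {x d w : ℕ → B} {x' d' w' : ℕ → C} (h : Pivot τ x d w) (h' : Pivot τ x' d' w') :
    Pivot τ (fun i => (x i, x' i)) (fun i => (d i, d' i)) (fun i => (w i, w' i)) where
  XX i j := Prod.ext (h.XX i j) (h'.XX i j)
  X_sq i := Prod.ext (h.X_sq i) (h'.X_sq i)
  DX i j hij := Prod.ext (h.DX i j hij) (h'.DX i j hij)
  DX_self i := Prod.ext (h.DX_self i) (h'.DX_self i)
  D_sq i := Prod.ext (h.D_sq i) (h'.D_sq i)
  Dv i j hij := Prod.ext (h.Dv i j hij) (h'.Dv i j hij)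
  vX i j hij := Prod.ext (h.vX i j hij) (h'.vX i j hij)
  v_eq i := Prod.ext (h.v_eq i) (h'.v_eq i)

/-- Since `t` acts on formal sums as zero, the relations with `τ = t` are those with `τ = 0`. Formal
sums and operators now share one base ring and one parameter. -/
theorem pivot_formal_poly : Pivot (Polynomial.X : K[X]) (fx K) (fy K) (V K) where
  XX := pivot_formal.XX
  X_sq := pivot_formal.X_sq
  DX := pivot_formal.DX
  DX_self i := by
    rw [pivot_formal.DX_self, poly_smul_formal, Polynomial.eval_X, zero_smul]
  D_sq := pivot_formal.D_sq
  Dv := pivot_formal.Dv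
  vX := pivot_formal.vX
  v_eq := pivot_formal.v_eq

theorem Pivot.XX_mul {R B : Type*} [CommRing R] [Ring B] [Algebra R B] {τ : R} {x d w : ℕ → B}
    (h : Pivot τ x d w) (i j : ℕ) (b : B) : x i * x j * b = (-1 : R) • (x j * (x i * b)) := by
  rw [h.XX i j, neg_mul, neg_one_smul, mul_assoc]

variable (K) in
/-- Operators on `K[t] ⊗ Λ`. -/
abbrev OpT : Type _ := Module.End K[X] (Grassmann K[X])

variable (K) in
/-- The variable `x_i` as a formal sum together with the operator `t x_i`. -/
def pairX (i : ℕ) : FormalSum K × OpT K := (fx K i, opX Polynomial.X i)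

variable (K) in
/-- The variable `y_i` as a formal sum together with the operator `∂_i`. -/
def pairD (i : ℕ) : FormalSum K × OpT K := (fy K i, gd K[X] i)

variable (K) in
/-- The pivot element as a formal sum and as an operator. -/
def pairV (i : ℕ) : FormalSum K × OpT K := (V K i, opV Polynomial.X i)

theorem pivot_pair : Pivot (Polynomial.X : K[X]) (pairX K) (pairD K) (pairV K) :=
  pivot_formal_poly.prod (pivot_op _)

variable (K) in
/-- The pairs of a formal sum and an operator with the same expansion in monomials, up to
multiples of `t` on the side of formal sums. -/
def Quant : Submodule K[X] (FormalSum K × OpT K) :=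
  Submodule.span K[X] {b | ∃ α β, b = Pivot.mono (pairX K) (pairV K) α β}

theorem mono_pair_fst (α β : Finset ℕ) :
    (Pivot.mono (pairX K) (pairV K) α β).1 = Pivot.mono (fx K) (V K) α β := by
  have h (x : ℕ → FormalSum K × OpT K) (s : Finset ℕ) :
      (ordProd x s).1 = ordProd (fun i => (x i).1) s :=
    map_ordProd x (MonoidHom.fst _ _) s
  rw [Pivot.mono, Prod.fst_mul, h, h]
  rfl

theorem mono_pair_snd (α β : Finset ℕ) : (Pivot.mono (pairX K) (pairV K) α β).2 =
    Pivot.mono (opX (Polynomial.X : K[X])) (opV Polynomial.X) α β := by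
  have h (x : ℕ → FormalSum K × OpT K) (s : Finset ℕ) :
      (ordProd x s).2 = ordProd (fun i => (x i).2) s :=
    map_ordProd x (MonoidHom.snd _ _) s
  rw [Pivot.mono, Prod.snd_mul, h, h]
  rfl

/-- Straightening uses only the relations of `Pivot`, so it takes place in both components at once.
This is the congruence of the operator product with the supercommutative product modulo `t`. -/
theorem quant_mul {z w : FormalSum K × OpT K} (hz : z ∈ Quant K) (hw : w ∈ Quant K) :
    z * w ∈ Quant K := pivot_pair.mono_span_mul_mem hz hw

theorem quant_mono (α β : Finset ℕ) : Pivot.mono (pairX K) (pairV K) α β ∈ Quant K :=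
  Submodule.subset_span ⟨α, β, rfl⟩

theorem quant_one : 1 ∈ Quant K := by
  have := quant_mono (K := K) ∅ ∅
  rwa [Pivot.mono, ordProd_empty, ordProd_empty, mul_one] at this

theorem quant_X (i : ℕ) : pairX K i ∈ Quant K := by
  have := quant_mono (K := K) {i} ∅
  rwa [Pivot.mono, ordProd_empty, ordProd_singleton, mul_one] at this

theorem quant_V (i : ℕ) : pairV K i ∈ Quant K := by
  have := quant_mono (K := K) ∅ {i}
  rwa [Pivot.mono, ordProd_empty, ordProd_singleton, one_mul] at this

theorem quant_D (i : ℕ) : pairD K i ∈ Quant K := by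
  have e : pairD K i = pairV K i - pairX K i * pairX K (i + 1) * pairV K (i + 3) := by
    rw [pivot_pair.v_eq, add_sub_cancel_right]
  rw [e]
  exact sub_mem (quant_V i) (quant_mul (quant_mul (quant_X i) (quant_X _)) (quant_V _))

namespace FormalSum

theorem fx_mem_xFinite (i : ℕ) : fx K i ∈ xFinite K := by
  intro T
  refine (Set.finite_singleton i).subset fun j hj => ?_
  have h : insert (ix j) T = {ix i} := by
    by_contra h
    exact hj (if_neg h)
  exact ix_inj.1 (Finset.mem_singleton.1 (h ▸ Finset.mem_insert_self _ _))

theorem le_ySum {j : ℕ} {S : Finset Letter} (h : iy j ∈ S) : j ≤ ySum S :=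
  Finset.single_le_sum (f := fun s : Letter => Sum.elim (fun _ => 0) (fun j => j) (ofLex s))
    (fun _ _ => Nat.zero_le _) h

theorem V_mem_xFinite (i : ℕ) : V K i ∈ xFinite K := by
  intro T
  refine (Finset.finite_toSet (Finset.range (ySum T + 1))).subset fun j hj => ?_
  obtain ⟨l, hl⟩ := V_ne_zero hj
  have h1 : iy (i + 3 * l) ∈ T := by
    have : iy (i + 3 * l) ∈ insert (ix j) T := hl ▸ Finset.mem_insert_self _ _
    exact (Finset.mem_insert.1 this).resolve_left (ix_ne_iy _ _).symm
  have h2 := le_ySum h1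
  have h3 : ix j ∈ pivotTerm i l := hl ▸ Finset.mem_insert_self _ _
  rcases mem_pivotTerm h3 with h | ⟨k, -, hk, h⟩
  · exact absurd h (ix_ne_iy _ _)
  · rw [ix_inj] at h
    rw [Finset.mem_coe, Finset.mem_range]
    omega

theorem ordProd_mem_xFinite {x : ℕ → FormalSum K} (h : ∀ i, x i ∈ xFinite K) (s : Finset ℕ) :
    ordProd x s ∈ xFinite K :=
  Subalgebra.list_prod_mem _ fun y hy => by
    obtain ⟨i, -, rfl⟩ := List.mem_map.1 hy
    exact h i

end FormalSum

open FormalSum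

theorem quant_xFinite {z : FormalSum K × OpT K} (hz : z ∈ Quant K) : z.1 ∈ xFinite K := by
  induction hz using Submodule.span_induction with
  | mem z hz =>
    obtain ⟨α, β, rfl⟩ := hz
    rw [mono_pair_fst]
    exact mul_mem (ordProd_mem_xFinite fx_mem_xFinite α) (ordProd_mem_xFinite V_mem_xFinite β)
  | zero => exact zero_mem _
  | add z w _ _ hz hw => exact add_mem hz hw
  | smul r z _ hz => exact Subalgebra.smul_mem _ hz (r.eval 0)

/-! ### Commutators and brackets -/

/-- The sign of `sgn` as an integer. -/
def zsgn (p q : ZMod 2) : ℤ := (-1) ^ (p.val * q.val)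

theorem sgn_smul {E : Type*} [AddCommGroup E] [Module K E] (p q : ZMod 2) (a : E) :
    sgn K p q • a = zsgn p q • a := by
  rcases zmod_two_cases p with rfl | rfl <;> rcases zmod_two_cases q with rfl | rfl <;>
    simp [sgn, zsgn, ZMod.val_one]

theorem supercommutator_mul {B : Type*} [Ring B] (p q r : ZMod 2) (a b c : B) :
    a * (b * c) - zsgn p (q + r) • (b * c * a) = (a * b - zsgn p q • (b * a)) * c +
      zsgn p q • (b * (a * c - zsgn p r • (c * a))) := by
  rcases zmod_two_cases p with rfl | rfl <;> rcases zmod_two_cases q with rfl | rfl <;>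
    rcases zmod_two_cases r with rfl | rfl <;>
    simp [zsgn, ZMod.val_one, CharTwo.add_self_eq_zero] <;> noncomm_ring

/-- An element of `Quant K` of parity `p`. -/
structure QuantParity (p : ZMod 2) (z : FormalSum K × OpT K) : Prop where
  mem : z ∈ Quant K
  parity : HasParity p z.1

theorem QuantParity.xFinite {p : ZMod 2} {z : FormalSum K × OpT K} (hz : QuantParity p z) :
    z.1 ∈ xFinite K := quant_xFinite hz.mem

/-- The supercommutator of the operators is `t` times an operator that corresponds to the bracket
of the formal sums. -/
def Brackets (p q : ZMod 2) (z w : FormalSum K × OpT K) : Prop :=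
  ∃ h : OpT K, z.2 * w.2 - zsgn p q • (w.2 * z.2) = (Polynomial.X : K[X]) • h ∧
    (bracket z.1 w.1, h) ∈ Quant K

/-- The operators and the formal sums supercommute. -/
structure Null (p q : ZMod 2) (z w : FormalSum K × OpT K) : Prop where
  comm : z.2 * w.2 = zsgn p q • (w.2 * z.2)
  bracket_eq : bracket z.1 w.1 = 0

theorem Null.brackets {p q : ZMod 2} {z w : FormalSum K × OpT K} (h : Null p q z w) :
    Brackets p q z w :=
  ⟨0, by rw [h.comm, sub_self, smul_zero], h.bracket_eq ▸ zero_mem _⟩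

theorem QuantParity.mul {p q : ZMod 2} {z w : FormalSum K × OpT K} (hz : QuantParity p z)
    (hw : QuantParity q w) : QuantParity (p + q) (z * w) :=
  ⟨quant_mul hz.mem hw.mem, hz.parity.mul hw.parity⟩

theorem quantParity_X (i : ℕ) : QuantParity 1 (pairX K i) := ⟨quant_X i, hasParity_fx i⟩

theorem quantParity_V (i : ℕ) : QuantParity 1 (pairV K i) := ⟨quant_V i, hasParity_V i⟩

theorem quantParity_D (i : ℕ) : QuantParity 1 (pairD K i) := ⟨quant_D i, hasParity_fy i⟩

theorem quantParity_one : QuantParity 0 (1 : FormalSum K × OpT K) := ⟨quant_one, hasParity_one⟩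

namespace Brackets

variable {p q r : ZMod 2} {z w w' : FormalSum K × OpT K}

theorem symm (hz : QuantParity p z) (hw : QuantParity q w) (h : Brackets p q z w) :
    Brackets q p w z := by
  obtain ⟨H, e, hH⟩ := h
  refine ⟨-(zsgn p q • H), ?_, ?_⟩
  · rw [smul_neg, smul_comm, ← e]
    rcases zmod_two_cases p with rfl | rfl <;> rcases zmod_two_cases q with rfl | rfl <;>
      simp [zsgn, ZMod.val_one, add_comm]
  · rw [bracket_anticomm hw.parity hz.parity, sgn_smul]
    have := neg_mem (zsmul_mem hH (zsgn p q))
    rcases zmod_two_cases p with rfl | rfl <;> rcases zmod_two_cases q with rfl | rfl <;>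
      simpa [zsgn, ZMod.val_one] using this

/-- The supercommutator and the Poisson bracket are derivations with the same signs, so the
correspondence passes from factors to products. -/
theorem mul (hz : QuantParity p z) (hw : QuantParity q w) (hw' : QuantParity r w')
    (h : Brackets p q z w) (h' : Brackets p r z w') : Brackets p (q + r) z (w * w') := by
  obtain ⟨H, e, hH⟩ := h
  obtain ⟨H', e', hH'⟩ := h'
  refine ⟨H * w'.2 + zsgn p q • (w.2 * H'), ?_, ?_⟩
  · rw [smul_add, smul_comm _ (zsgn p q), ← smul_mul_assoc (Polynomial.X : K[X]) H, ← e,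
      ← mul_smul_comm (Polynomial.X : K[X]) w.2 H', ← e']
    exact supercommutator_mul p q r _ _ _
  · rw [Prod.fst_mul, bracket_mul hz.parity hw.parity hz.xFinite hw.xFinite hw'.xFinite,
      sgn_smul]
    exact add_mem (quant_mul hH hw'.mem) (zsmul_mem (quant_mul hw.mem hH') _)

theorem add (hz : QuantParity p z) (hw : QuantParity q w) (hw' : QuantParity q w')
    (h : Brackets p q z w) (h' : Brackets p q z w') : Brackets p q z (w + w') := by
  obtain ⟨H, e, hH⟩ := h
  obtain ⟨H', e', hH'⟩ := h'
  refine ⟨H + H', ?_, ?_⟩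
  · rw [smul_add, ← e, ← e', Prod.snd_add, mul_add, add_mul, smul_add]
    abel
  · rw [Prod.fst_add, bracket_add_right hz.xFinite hw.xFinite hw'.xFinite]
    exact add_mem hH hH'

theorem smul (c : K[X]) (h : Brackets p q z w) : Brackets p q z (c • w) := by
  obtain ⟨H, e, hH⟩ := h
  refine ⟨c • H, ?_, ?_⟩
  · rw [smul_comm, ← e, Prod.smul_snd, smul_mul_assoc, mul_smul_comm, smul_sub, smul_comm c]
  · rw [Prod.smul_fst, poly_smul_formal, bracket_smul_right]
    exact Submodule.smul_mem _ c hH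

theorem mul_left (hz : QuantParity p z) (hw : QuantParity q w) (hw' : QuantParity r w')
    (h : Brackets p r z w') (h' : Brackets q r w w') : Brackets (p + q) r (z * w) w' :=
  symm hw' (hz.mul hw) (mul hw' hz hw (symm hz hw' h) (symm hw hw' h'))

theorem add_left {z' : FormalSum K × OpT K} (hz : QuantParity p z) (hz' : QuantParity p z')
    (hw : QuantParity q w) (h : Brackets p q z w) (h' : Brackets p q z' w) :
    Brackets p q (z + z') w :=
  symm hw ⟨add_mem hz.mem hz'.mem, hz.parity.add hz'.parity⟩
    (add hw hz hz' (symm hz hw h) (symm hz' hw h'))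

end Brackets

/-! ### Pairs that supercommute and have zero bracket. -/

section Null

variable {p q r : ZMod 2} {z w w' : FormalSum K × OpT K}

theorem Null.one : Null p 0 z 1 := by
  refine ⟨?_, ?_⟩
  · simp [zsgn]
  · refine FormalSum.ext fun S => finsum_eq_zero_of_forall_eq_zero fun i => ?_
    have h (s : Letter) : pd s (1 : FormalSum K) = 0 :=
      (avoids_single (Finset.notMem_empty s)).pd_eq
    change (pd (ix i) (twist z.1) * pd (iy i) 1 + pd (iy i) (twist z.1) * pd (ix i) 1 :
      FormalSum K) S = 0
    rw [h, h, mul_zero, mul_zero, add_zero, FormalSum.zero_apply]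

theorem Null.symm (hz : QuantParity p z) (hw : QuantParity q w) (h : Null p q z w) :
    Null q p w z where
  comm := by
    rw [h.comm]
    rcases zmod_two_cases p with rfl | rfl <;> rcases zmod_two_cases q with rfl | rfl <;>
      simp [zsgn, ZMod.val_one]
  bracket_eq := by
    rw [bracket_anticomm hw.parity hz.parity, h.bracket_eq, smul_zero, neg_zero]

theorem Null.mul (hz : QuantParity p z) (hw : QuantParity q w) (hw' : QuantParity r w')
    (h : Null p q z w) (h' : Null p r z w') : Null p (q + r) z (w * w') where
  comm := by
    have := supercommutator_mul p q r z.2 w.2 w'.2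
    rw [h.comm, h'.comm, sub_self, sub_self, zero_mul, mul_zero, smul_zero, add_zero,
      sub_eq_zero] at this
    exact this
  bracket_eq := by
    rw [Prod.fst_mul, bracket_mul hz.parity hw.parity hz.xFinite hw.xFinite hw'.xFinite,
      h.bracket_eq, h'.bracket_eq, zero_mul, mul_zero, smul_zero, add_zero]

theorem Null.mul_left (hz : QuantParity p z) (hw : QuantParity q w) (hw' : QuantParity r w')
    (h : Null p r z w') (h' : Null q r w w') : Null (p + q) r (z * w) w' :=
  symm hw' (hz.mul hw) (mul hw' hz hw (symm hz hw' h) (symm hw hw' h'))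

/-- Two multiples of an odd element of square zero supercommute. -/
theorem null_mul_mul (hz : QuantParity p z) (hw : QuantParity q w) (hx : QuantParity 1 w')
    (h : Null p 1 z w') (h' : Null q 1 w w') (hw' : Null 1 1 w' w') (h0 : w' * w' = 0) :
    Null (1 + p) (1 + q) (w' * z) (w' * w) where
  comm := by
    have h2 : w'.2 * w'.2 = 0 := congrArg Prod.snd h0
    have key (z : FormalSum K × OpT K) (p : ZMod 2) (h : Null p 1 z w') (b : OpT K) :
        w'.2 * z.2 * (w'.2 * b) = 0 := by
      rw [← mul_assoc, mul_assoc w'.2, h.comm, mul_smul_comm, ← mul_assoc, h2, zero_mul, smul_zero,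
        zero_mul]
    rw [Prod.snd_mul, Prod.snd_mul, key z p h, key w q h', smul_zero]
  bracket_eq := by
    have h2 : w'.1 * w'.1 = 0 := congrArg Prod.fst h0
    have e1 : bracket (w'.1 * z.1) w'.1 = 0 := (hw'.mul_left hx hz hx h).bracket_eq
    -- As `w'` has zero bracket with `w`, the bracket is a multiple of `w'.1`, whose square is zero.
    have e2 : w'.1 * bracket (w'.1 * z.1) w.1 = 0 := by
      rw [bracket_anticomm (hx.parity.mul hz.parity) hw.parity,
        bracket_mul hw.parity hx.parity hw.xFinite hx.xFinite hz.xFinite, h'.bracket_eq, zero_mul,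
        zero_add, mul_neg, mul_smul_comm, mul_smul_comm, ← mul_assoc, h2, zero_mul, smul_zero,
        smul_zero, neg_zero]
    have := bracket_mul (hx.parity.mul hz.parity) hx.parity
      (mul_mem hx.xFinite hz.xFinite) hx.xFinite hw.xFinite
    rw [e1, e2, zero_mul, smul_zero, add_zero] at this
    exact this

end Null

/-! ### The brackets of the generators -/

theorem bracket_eq_zero {f g : FormalSum K} (h : ∀ i, (Avoids (ix i) f ∨ Avoids (iy i) g) ∧
    (Avoids (iy i) f ∨ Avoids (ix i) g)) : bracket f g = 0 := by
  have key (s : Letter) (hs : Avoids s f) : pd s (twist f) = 0 :=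
    Avoids.pd_eq fun S hS => by rw [twist, hs S hS, mul_zero]
  refine FormalSum.ext fun S => finsum_eq_zero_of_forall_eq_zero fun i => ?_
  have h1 : pd (ix i) (twist f) * pd (iy i) g = 0 := by
    rcases (h i).1 with h | h
    · rw [key _ h, zero_mul]
    · rw [h.pd_eq, mul_zero]
  have h2 : pd (iy i) (twist f) * pd (ix i) g = 0 := by
    rcases (h i).2 with h | h
    · rw [key _ h, zero_mul]
    · rw [h.pd_eq, mul_zero]
  rw [h1, h2, add_zero, FormalSum.zero_apply]

theorem avoids_iy_fx (i j : ℕ) : Avoids (iy i) (fx K j) :=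
  avoids_single fun h => ix_ne_iy _ _ (Finset.mem_singleton.1 h).symm

theorem avoids_ix_fy (i j : ℕ) : Avoids (ix i) (fy K j) :=
  avoids_single fun h => ix_ne_iy _ _ (Finset.mem_singleton.1 h)

theorem avoids_ix_fx {i j : ℕ} (h : i ≠ j) : Avoids (ix i) (fx K j) :=
  avoids_single fun h' => h (ix_inj.1 (Finset.mem_singleton.1 h'))

theorem avoids_iy_fy {i j : ℕ} (h : i ≠ j) : Avoids (iy i) (fy K j) :=
  avoids_single fun h' => h (iy_inj.1 (Finset.mem_singleton.1 h'))

theorem avoids_V {i j : ℕ} (h : i < j) : Avoids (ix i) (V K j) ∧ Avoids (iy i) (V K j) := by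
  constructor <;>
  · intro S hS
    by_contra h'
    obtain ⟨l, rfl⟩ := V_ne_zero h'
    rcases mem_pivotTerm hS with h1 | ⟨k, hk, -, h1⟩ <;> simp [ix, iy] at h1
    omega

theorem comm_of_anti {a b : OpT K} (h : a * b = -(b * a)) : a * b = zsgn 1 1 • (b * a) := by
  rw [h]
  simp [zsgn, ZMod.val_one]

theorem null_XX (i j : ℕ) : Null 1 1 (pairX K i) (pairX K j) where
  comm := comm_of_anti ((pivot_op _).XX i j)
  bracket_eq := bracket_eq_zero fun _ => ⟨Or.inr (avoids_iy_fx _ _), Or.inl (avoids_iy_fx _ _)⟩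

theorem null_DX {i j : ℕ} (h : i ≠ j) : Null 1 1 (pairD K i) (pairX K j) where
  comm := comm_of_anti ((pivot_op _).DX i j h)
  bracket_eq := bracket_eq_zero fun k => ⟨Or.inr (avoids_iy_fx _ _), by
    by_cases hk : k = i
    · exact Or.inr (avoids_ix_fx (hk.trans_ne h))
    · exact Or.inl (avoids_iy_fy hk)⟩

theorem null_VX {i j : ℕ} (h : i < j) : Null 1 1 (pairV K j) (pairX K i) where
  comm := comm_of_anti ((pivot_op _).vX i j h)
  bracket_eq := bracket_eq_zero fun k => ⟨Or.inr (avoids_iy_fx _ _), by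
    by_cases hk : k = i
    · exact Or.inl (hk ▸ (avoids_V h).2)
    · exact Or.inr (avoids_ix_fx hk)⟩

theorem null_DV {i j : ℕ} (h : i < j) : Null 1 1 (pairD K i) (pairV K j) where
  comm := comm_of_anti ((pivot_op _).Dv i j h)
  bracket_eq := bracket_eq_zero fun k => ⟨Or.inl (avoids_ix_fy _ _), by
    by_cases hk : k = i
    · exact Or.inr (hk ▸ (avoids_V h).1)
    · exact Or.inl (avoids_iy_fy hk)⟩

theorem anti_of_sq_eq_zero {B : Type*} [Ring B] {a : B} (h : a * a = 0) : a * a = -(a * a) := by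
  rw [h, neg_zero]

theorem null_DD (i : ℕ) : Null 1 1 (pairD K i) (pairD K i) where
  comm := comm_of_anti (anti_of_sq_eq_zero ((pivot_op (Polynomial.X : K[X])).D_sq i))
  bracket_eq := bracket_eq_zero fun _ => ⟨Or.inl (avoids_ix_fy _ _), Or.inr (avoids_ix_fy _ _)⟩

/-- The basic nontrivial relation: the anticommutator of `∂_i` and `t x_i` is `t`, and `{y_i, x_i} =
1`, so `h = 1`. -/
theorem brackets_DX (i j : ℕ) : Brackets 1 1 (pairD K i) (pairX K j) := by
  by_cases h : i = j
  · subst h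
    refine ⟨1, ?_, ?_⟩
    · change gd K[X] i * opX Polynomial.X i - zsgn 1 1 • (opX Polynomial.X i * gd K[X] i) = _
      rw [(pivot_op (Polynomial.X : K[X])).DX_self i]
      simp [zsgn, ZMod.val_one]
    · have e : bracket (pairD K i).1 (pairX K i).1 = 1 := by
        refine FormalSum.ext fun S => ?_
        rw [bracket_apply, finsum_eq_single _ i]
        · change bracketTerm i (fy K i) (fx K i) S = (1 : FormalSum K) S
          rw [bracketTerm, (hasParity_fy i).twist, pd_smul, pd_smul, (avoids_ix_fy i i).pd_eq, fy,
            fx, pd_single_self, pd_single_self]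
          simp [ZMod.val_one]
        · intro k hk
          change bracketTerm k (fy K i) (fx K i) S = 0
          rw [bracketTerm, (hasParity_fy i).twist, pd_smul, pd_smul, (avoids_ix_fy k i).pd_eq,
            (avoids_iy_fy hk).pd_eq]
          simp [FormalSum.zero_apply]
      rw [e]
      exact quant_one
  · exact (null_DX h).brackets

theorem pairV_eq (i : ℕ) :
    pairV K i = pairD K i + pairX K i * pairX K (i + 1) * pairV K (i + 3) := pivot_pair.v_eq i

theorem quantParity_XXV (i : ℕ) :
    QuantParity 1 (pairX K i * pairX K (i + 1) * pairV K (i + 3)) :=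
  ((quantParity_X i).mul (quantParity_X (i + 1))).mul (quantParity_V (i + 3))

theorem brackets_pairV {p : ZMod 2} {w : FormalSum K × OpT K} (hw : QuantParity p w) (i : ℕ)
    (hD : Brackets 1 p (pairD K i) w)
    (h : Brackets 1 p (pairX K i * pairX K (i + 1) * pairV K (i + 3)) w) :
    Brackets 1 p (pairV K i) w := by
  rw [pairV_eq]
  exact hD.add_left (quantParity_D i) (quantParity_XXV i) hw h

theorem brackets_XXV {p : ZMod 2} {w : FormalSum K × OpT K} (hw : QuantParity p w) (i : ℕ)
    (h1 : Brackets 1 p (pairX K i) w) (h2 : Brackets 1 p (pairX K (i + 1)) w)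
    (h3 : Brackets 1 p (pairV K (i + 3)) w) :
    Brackets 1 p (pairX K i * pairX K (i + 1) * pairV K (i + 3)) w := by
  have e : (1 + 1 + 1 : ZMod 2) = 1 := rfl
  have := (h1.mul_left (quantParity_X i) (quantParity_X _) hw h2).mul_left
    ((quantParity_X i).mul (quantParity_X _)) (quantParity_V _) hw h3
  rwa [e] at this

theorem brackets_VX (i j : ℕ) : Brackets 1 1 (pairV K i) (pairX K j) := by
  rcases lt_or_ge j i with h | h
  · exact (null_VX h).brackets
  obtain ⟨d, rfl⟩ := Nat.exists_eq_add_of_le h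
  clear h
  induction d using Nat.strong_induction_on generalizing i with
  | _ d ih =>
    refine brackets_pairV (quantParity_X _) i (brackets_DX _ _) (brackets_XXV (quantParity_X _) i
      (null_XX _ _).brackets (null_XX _ _).brackets ?_)
    rcases lt_or_ge d 3 with hd | hd
    · exact (null_VX (by omega)).brackets
    · have := ih (d - 3) (by omega) (i + 3)
      rwa [show i + 3 + (d - 3) = i + d by omega] at this

theorem brackets_XV (i j : ℕ) : Brackets 1 1 (pairX K i) (pairV K j) :=
  (brackets_VX j i).symm (quantParity_V j) (quantParity_X i)

/-- Reduction to the bracket of `V_{i+3}` with `V_i` would not terminate. Instead both copies are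
expanded once, and the product of the two tails is harmless because both contain the factor `x_i` of
square zero. -/
theorem brackets_VV_self (i : ℕ) : Brackets 1 1 (pairV K i) (pairV K i) := by
  have h1 : Brackets 1 1 (pairD K i) (pairX K i * pairX K (i + 1) * pairV K (i + 3)) :=
    Brackets.symm (quantParity_XXV i) (quantParity_D i) (brackets_XXV (quantParity_D i) i
      ((brackets_DX i i).symm (quantParity_D i) (quantParity_X i))
      ((brackets_DX i _).symm (quantParity_D i) (quantParity_X _))
      ((null_DV (by omega)).brackets.symm (quantParity_D i) (quantParity_V _)))
  have h2 : Null 0 1 (pairX K (i + 1) * pairV K (i + 3)) (pairX K i) :=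
    (null_XX _ _).mul_left (quantParity_X _) (quantParity_V _) (quantParity_X _)
      (null_VX (by omega))
  have hq : QuantParity 0 (pairX K (i + 1) * pairV K (i + 3)) :=
    (quantParity_X _).mul (quantParity_V _)
  have h3 : Brackets 1 1 (pairX K i * pairX K (i + 1) * pairV K (i + 3))
      (pairX K i * pairX K (i + 1) * pairV K (i + 3)) := by
    rw [mul_assoc]
    exact (null_mul_mul hq hq (quantParity_X i) h2 h2 (null_XX i i) (pivot_pair.X_sq i)).brackets
  have hV := quantParity_V (K := K) i
  refine brackets_pairV hV i (Brackets.symm hV (quantParity_D i) ?_)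
    (Brackets.symm hV (quantParity_XXV i) ?_)
  · exact brackets_pairV (quantParity_D i) i (null_DD i).brackets
      (h1.symm (quantParity_D i) (quantParity_XXV i))
  · exact brackets_pairV (quantParity_XXV i) i h1 h3

/-- Here too the plain recursion would return to neighbouring indices. The tails of `V_i` and
`V_{i+1}` share the factor `x_{i+1}`, which is brought to the front so that `null_mul_mul` applies.
-/
theorem brackets_VV_succ (i : ℕ) : Brackets 1 1 (pairV K i) (pairV K (i + 1)) := by
  refine brackets_pairV (quantParity_V _) i (null_DV (by omega)).brackets
    (Brackets.symm (quantParity_V _) (quantParity_XXV i)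
      (brackets_pairV (quantParity_XXV i) (i + 1) ?_ ?_))
  · exact Brackets.symm (quantParity_XXV i) (quantParity_D _) (brackets_XXV (quantParity_D _) i
      ((brackets_DX _ i).symm (quantParity_D _) (quantParity_X i))
      ((brackets_DX _ _).symm (quantParity_D _) (quantParity_X _))
      ((null_DV (by omega)).brackets.symm (quantParity_D _) (quantParity_V _)))
  · have h2 : Null 0 1 (pairX K i * pairV K (i + 3)) (pairX K (i + 1)) :=
      (null_XX _ _).mul_left (quantParity_X _) (quantParity_V _) (quantParity_X _)
        (null_VX (by omega))
    have h3 : Null 0 1 (pairX K (i + 1 + 1) * pairV K (i + 1 + 3)) (pairX K (i + 1)) :=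
      (null_XX _ _).mul_left (quantParity_X _) (quantParity_V _) (quantParity_X _)
        (null_VX (by omega))
    have hq : QuantParity 0 (pairX K i * pairV K (i + 3)) :=
      (quantParity_X _).mul (quantParity_V _)
    have hq' : QuantParity 0 (pairX K (i + 1 + 1) * pairV K (i + 1 + 3)) :=
      (quantParity_X _).mul (quantParity_V _)
    have e : pairX K i * pairX K (i + 1) * pairV K (i + 3) =
        (-1 : K[X]) • (pairX K (i + 1) * (pairX K i * pairV K (i + 3))) := by
      exact pivot_pair.XX_mul _ _ _
    rw [e, mul_assoc (pairX K (i + 1))]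
    exact (null_mul_mul hq' hq (quantParity_X (i + 1)) h3 h2 (null_XX _ _)
      (pivot_pair.X_sq _)).brackets.smul _

/-- Expanding the smaller pivot turns distance `d ≥ 3` into `d - 3`, and distance `2` into
neighbours in the opposite order. -/
theorem brackets_VV (i j : ℕ) : Brackets 1 1 (pairV K i) (pairV K j) := by
  wlog h : i ≤ j generalizing i j
  · exact (this j i (by omega)).symm (quantParity_V j) (quantParity_V i)
  obtain ⟨d, rfl⟩ := Nat.exists_eq_add_of_le h
  clear h
  induction d using Nat.strong_induction_on generalizing i with
  | _ d ih =>
    match d with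
    | 0 => exact brackets_VV_self i
    | 1 => exact brackets_VV_succ i
    | d + 2 =>
      refine brackets_pairV (quantParity_V _) i (null_DV (by omega)).brackets
        (brackets_XXV (quantParity_V _) i (brackets_XV _ _) (brackets_XV _ _) ?_)
      match d with
      | 0 => exact (brackets_VV_succ (i + 2)).symm (quantParity_V _) (quantParity_V _)
      | d + 1 =>
        have := ih d (by omega) (i + 3)
        rwa [show i + 3 + d = i + (d + 1 + 2) by omega] at this

end FractalSuper

namespace FractalSuper

variable {K : Type*} [Field K]

open FormalSum

/-! ### Brackets of monomials -/

theorem quantParity_ordProd {x : ℕ → FormalSum K × OpT K} (h : ∀ i, QuantParity 1 (x i))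
    (s : Finset ℕ) : QuantParity (s.card : ZMod 2) (ordProd x s) := by
  induction s using Finset.induction_on_min with
  | empty =>
    rw [ordProd_empty, Finset.card_empty, Nat.cast_zero]
    exact quantParity_one
  | insert a s hs ih =>
    rw [ordProd_insert _ hs, Finset.card_insert_of_notMem fun ha => lt_irrefl _ (hs a ha),
      Nat.cast_add, Nat.cast_one, add_comm]
    exact (h a).mul ih

theorem quantParity_mono (α β : Finset ℕ) :
    QuantParity ((α.card + β.card : ℕ) : ZMod 2) (Pivot.mono (pairX K) (pairV K) α β) := by
  rw [Nat.cast_add]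
  exact (quantParity_ordProd quantParity_X α).mul (quantParity_ordProd quantParity_V β)

theorem Brackets.ordProd {p : ZMod 2} {z : FormalSum K × OpT K} (hz : QuantParity p z)
    {x : ℕ → FormalSum K × OpT K} (hx : ∀ i, QuantParity 1 (x i))
    (h : ∀ i, Brackets p 1 z (x i)) (s : Finset ℕ) :
    Brackets p (s.card : ZMod 2) z (ordProd x s) := by
  induction s using Finset.induction_on_min with
  | empty =>
    rw [ordProd_empty, Finset.card_empty, Nat.cast_zero]
    exact Null.one.brackets
  | insert a s hs ih =>
    rw [ordProd_insert _ hs, Finset.card_insert_of_notMem fun ha => lt_irrefl _ (hs a ha),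
      Nat.cast_add, Nat.cast_one, add_comm]
    exact (h a).mul hz (hx a) (quantParity_ordProd hx s) ih

theorem Brackets.mono {p : ZMod 2} {z : FormalSum K × OpT K} (hz : QuantParity p z)
    (hX : ∀ i, Brackets p 1 z (pairX K i)) (hV : ∀ i, Brackets p 1 z (pairV K i))
    (α β : Finset ℕ) :
    Brackets p ((α.card + β.card : ℕ) : ZMod 2) z (Pivot.mono (pairX K) (pairV K) α β) := by
  rw [Nat.cast_add]
  exact (Brackets.ordProd hz quantParity_X hX α).mul hz (quantParity_ordProd quantParity_X α)
    (quantParity_ordProd quantParity_V β) (Brackets.ordProd hz quantParity_V hV β)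

theorem brackets_mono_mono (α β γ δ : Finset ℕ) :
    Brackets ((α.card + β.card : ℕ) : ZMod 2) ((γ.card + δ.card : ℕ) : ZMod 2)
      (Pivot.mono (pairX K) (pairV K) α β) (Pivot.mono (pairX K) (pairV K) γ δ) := by
  refine Brackets.mono (quantParity_mono α β) (fun i => ?_) (fun i => ?_) γ δ
  · refine Brackets.symm (quantParity_X i) (quantParity_mono α β) ?_
    exact Brackets.mono (quantParity_X i) (fun j => (null_XX i j).brackets)
      (fun j => brackets_XV i j) α β
  · refine Brackets.symm (quantParity_V i) (quantParity_mono α β) ?_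
    exact Brackets.mono (quantParity_V i) (fun j => brackets_VX i j)
      (fun j => brackets_VV i j) α β

variable (K) in
/-- The span of the pairs of monomials of parity `p` with indices in `I`. -/
def quantSpan (I : Finset ℕ → Finset ℕ → Prop) (p : ZMod 2) : Submodule K[X] (FormalSum K × OpT K) :=
  Submodule.span K[X] {b | ∃ α β, (I α β ∧ ((α.card + β.card : ℕ) : ZMod 2) = p) ∧
    b = Pivot.mono (pairX K) (pairV K) α β}

theorem quantParity_of_mem {I : Finset ℕ → Finset ℕ → Prop} {p : ZMod 2}
    {z : FormalSum K × OpT K} (hz : z ∈ quantSpan K I p) : QuantParity p z := by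
  induction hz using Submodule.span_induction with
  | mem z hz =>
    obtain ⟨α, β, ⟨-, rfl⟩, rfl⟩ := hz
    exact quantParity_mono α β
  | zero => exact ⟨zero_mem _, hasParity_zero p⟩
  | add z w _ _ hz hw => exact ⟨add_mem hz.mem hw.mem, hz.parity.add hw.parity⟩
  | smul r z _ hz => exact ⟨Submodule.smul_mem _ r hz.mem, hz.parity.smul _⟩

theorem brackets_of_mem {I : Finset ℕ → Finset ℕ → Prop} {p q : ZMod 2}
    {z w : FormalSum K × OpT K} (hz : z ∈ quantSpan K I p) (hw : w ∈ quantSpan K I q) :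
    Brackets p q z w := by
  have key : ∀ α β, (((α.card + β.card : ℕ) : ZMod 2) = p) →
      Brackets p q (Pivot.mono (pairX K) (pairV K) α β) w := by
    intro α β hp
    have hm := quantParity_mono (K := K) α β
    rw [hp] at hm
    induction hw using Submodule.span_induction with
    | mem w hw =>
      obtain ⟨γ, δ, ⟨-, rfl⟩, rfl⟩ := hw
      rw [← hp]
      exact brackets_mono_mono _ _ _ _
    | zero =>
      refine ⟨0, by simp, ?_⟩
      have e : bracket (Pivot.mono (pairX K) (pairV K) α β).1 (0 : FormalSum K × OpT K).1 = 0 := by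
        have := bracket_smul_right (0 : K) (Pivot.mono (pairX K) (pairV K) α β).1 0
        rwa [zero_smul, zero_smul] at this
      rw [e]
      exact zero_mem _
    | add w w' h1 h2 h3 h4 =>
      exact h3.add hm (quantParity_of_mem h1) (quantParity_of_mem h2) h4
    | smul r w _ h => exact h.smul r
  have hw' := quantParity_of_mem hw
  refine Brackets.symm hw' (quantParity_of_mem hz) ?_
  induction hz using Submodule.span_induction with
  | mem z hz =>
    obtain ⟨α, β, ⟨-, hp⟩, rfl⟩ := hz
    have hm := quantParity_mono (K := K) α β
    rw [hp] at hm
    exact (key α β hp).symm hm hw'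
  | zero =>
    refine ⟨0, by simp, ?_⟩
    have e : bracket w.1 (0 : FormalSum K × OpT K).1 = 0 := by
      have := bracket_smul_right (0 : K) w.1 0
      rwa [zero_smul, zero_smul] at this
    rw [e]
    exact zero_mem _
  | add z z' h1 h2 h3 h4 =>
    exact h3.add hw' (quantParity_of_mem h1) (quantParity_of_mem h2) h4
  | smul r z _ h => exact h.smul r

/-! ### Expansions in monomials -/

variable (K) in
/-- The monomials as formal sums. -/
abbrev monoF (s : Finset ℕ × Finset ℕ) : FormalSum K := Pivot.mono (fx K) (V K) s.1 s.2

variable (K) in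
/-- The monomials as operators on `K[t] ⊗ Λ`. -/
abbrev monoT (s : Finset ℕ × Finset ℕ) : OpT K :=
  Pivot.mono (opX (Polynomial.X : K[X])) (opV Polynomial.X) s.1 s.2

theorem monoT_linearIndependent : LinearIndependent K[X] (monoT K) :=
  mono_op_linearIndependent Polynomial.X_ne_zero

theorem mono_pair_eq (s : Finset ℕ × Finset ℕ) :
    Pivot.mono (pairX K) (pairV K) s.1 s.2 = (monoF K s, monoT K s) :=
  Prod.ext (mono_pair_fst _ _) (mono_pair_snd _ _)

/-- The span of the monomials with indices in a set, in terms of coefficients. -/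
theorem mem_span_mono_iff {R B : Type*} [CommRing R] [Ring B] [Algebra R B] {x w : ℕ → B}
    {I : Finset ℕ → Finset ℕ → Prop} {b : B} :
    b ∈ Submodule.span R {b | ∃ α β, I α β ∧ b = Pivot.mono x w α β} ↔
      ∃ c ∈ Finsupp.supported R R {s : Finset ℕ × Finset ℕ | I s.1 s.2},
        Finsupp.linearCombination R (fun s => Pivot.mono x w s.1 s.2) c = b := by
  rw [← Finsupp.mem_span_image_iff_linearCombination]
  have e : {b | ∃ α β, I α β ∧ b = Pivot.mono x w α β} =
      (fun s : Finset ℕ × Finset ℕ => Pivot.mono x w s.1 s.2) '' {s | I s.1 s.2} := by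
    ext b
    constructor
    · rintro ⟨α, β, h, rfl⟩
      exact ⟨(α, β), h, rfl⟩
    · rintro ⟨s, h, rfl⟩
      exact ⟨s.1, s.2, h, rfl⟩
  rw [e]

theorem linearCombination_pair (c : (Finset ℕ × Finset ℕ) →₀ K[X]) :
    Finsupp.linearCombination K[X]
      (fun s : Finset ℕ × Finset ℕ => Pivot.mono (pairX K) (pairV K) s.1 s.2) c =
    (Finsupp.linearCombination K (monoF K) (c.mapRange (Polynomial.eval 0) Polynomial.eval_zero),
      Finsupp.linearCombination K[X] (monoT K) c) := by
  induction c using Finsupp.induction_linear with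
  | zero =>
    simp
    rfl
  | add c d hc hd =>
    rw [map_add, hc, hd, map_add, Finsupp.mapRange_add fun _ _ => Polynomial.eval_add, map_add]
    rfl
  | single s r =>
    rw [Finsupp.linearCombination_single, Finsupp.linearCombination_single,
      Finsupp.mapRange_single, Finsupp.linearCombination_single, mono_pair_eq]
    rfl

variable (K) in
/-- The span of the pairs of monomials with indices in `I`. -/
def quantIndex (I : Finset ℕ → Finset ℕ → Prop) : Submodule K[X] (FormalSum K × OpT K) :=
  Submodule.span K[X] {b | ∃ α β, I α β ∧ b = Pivot.mono (pairX K) (pairV K) α β}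

variable {I : Finset ℕ → Finset ℕ → Prop}

theorem mem_quantIndex_iff {z : FormalSum K × OpT K} : z ∈ quantIndex K I ↔
    ∃ c ∈ Finsupp.supported K[X] K[X] {s : Finset ℕ × Finset ℕ | I s.1 s.2},
      Finsupp.linearCombination K (monoF K)
        (c.mapRange (Polynomial.eval 0) Polynomial.eval_zero) = z.1 ∧
      Finsupp.linearCombination K[X] (monoT K) c = z.2 := by
  rw [quantIndex, mem_span_mono_iff]
  refine exists_congr fun c => and_congr_right fun _ => ?_
  rw [linearCombination_pair, Prod.ext_iff]

theorem quantIndex_le : quantIndex K I ≤ Quant K :=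
  Submodule.span_mono fun _ ⟨α, β, _, h⟩ => ⟨α, β, h⟩

theorem quantSpan_le (p : ZMod 2) : quantSpan K I p ≤ quantIndex K I :=
  Submodule.span_mono fun _ ⟨α, β, h, h'⟩ => ⟨α, β, h.1, h'⟩

theorem mem_quant_iff {z : FormalSum K × OpT K} : z ∈ Quant K ↔
    ∃ c : (Finset ℕ × Finset ℕ) →₀ K[X], Finsupp.linearCombination K (monoF K)
        (c.mapRange (Polynomial.eval 0) Polynomial.eval_zero) = z.1 ∧
      Finsupp.linearCombination K[X] (monoT K) c = z.2 := by
  have e : Quant K = quantIndex K fun _ _ => True := by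
    simp [Quant, quantIndex]
  rw [e, mem_quantIndex_iff]
  refine exists_congr fun c => ?_
  rw [and_iff_right]
  exact fun _ _ => trivial

/-- Operator monomials are independent over `K[t]`, so an operator determines its coefficients, and
the formal sum is their value at `t = 0`. -/
theorem fst_eq_of_snd_eq {z w : FormalSum K × OpT K} (hz : z ∈ Quant K) (hw : w ∈ Quant K)
    (h : z.2 = w.2) : z.1 = w.1 := by
  obtain ⟨c, h1, h2⟩ := mem_quant_iff.1 hz
  obtain ⟨d, h3, h4⟩ := mem_quant_iff.1 hw
  rw [← h2, ← h4] at h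
  rw [← h1, ← h3, monoT_linearIndependent h]

theorem eq_of_smul_eq {z w : FormalSum K × OpT K} (hz : z ∈ Quant K) (hw : w ∈ Quant K)
    (h : (Polynomial.X : K[X]) • z.2 = (Polynomial.X : K[X]) • w.2) : z.2 = w.2 := by
  obtain ⟨c, -, h2⟩ := mem_quant_iff.1 hz
  obtain ⟨d, -, h4⟩ := mem_quant_iff.1 hw
  rw [← h2, ← h4, ← map_smul, ← map_smul] at h
  have h5 := monoT_linearIndependent h
  have h6 : c = d := by
    ext1 s
    exact mul_left_cancel₀ Polynomial.X_ne_zero (DFunLike.congr_fun h5 s)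
  rw [← h2, ← h4, h6]

/-- Multiplication by `t` does not change which monomials occur. This transfers a restriction on
indices from a supercommutator `t h` to `h`, and hence to the Poisson bracket. -/
theorem mem_quantIndex_of_smul_mem {z : FormalSum K × OpT K} (hz : z ∈ Quant K)
    (h : (Polynomial.X : K[X]) • z.2 ∈ Submodule.span K[X] {b | ∃ α β, I α β ∧
      b = Pivot.mono (opX (Polynomial.X : K[X])) (opV Polynomial.X) α β}) :
    z ∈ quantIndex K I := by
  obtain ⟨c, h1, h2⟩ := mem_quant_iff.1 hz
  obtain ⟨d, hd, h3⟩ := mem_span_mono_iff.1 h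
  rw [← h2, ← map_smul] at h3
  have h4 := monoT_linearIndependent h3
  refine mem_quantIndex_iff.2 ⟨c, fun s hs => hd ?_, h1, h2⟩
  rw [h4]
  rw [Finset.mem_coe, Finsupp.mem_support_iff] at hs ⊢
  rw [Finsupp.smul_apply, smul_eq_mul]
  exact mul_ne_zero Polynomial.X_ne_zero hs

theorem snd_mem {z : FormalSum K × OpT K} (hz : z ∈ quantIndex K I) :
    z.2 ∈ Submodule.span K[X] {b | ∃ α β, I α β ∧
      b = Pivot.mono (opX (Polynomial.X : K[X])) (opV Polynomial.X) α β} := by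
  obtain ⟨c, hc, h1, h2⟩ := mem_quantIndex_iff.1 hz
  exact mem_span_mono_iff.2 ⟨c, hc, h2⟩

theorem fst_mem {z : FormalSum K × OpT K} (hz : z ∈ quantIndex K I) :
    z.1 ∈ Submodule.span K {b | ∃ α β, I α β ∧ b = Pivot.mono (fx K) (V K) α β} := by
  obtain ⟨c, hc, h1, h2⟩ := mem_quantIndex_iff.1 hz
  refine mem_span_mono_iff.2 ⟨_, fun s hs => hc ?_, h1⟩
  rw [Finset.mem_coe, Finsupp.mem_support_iff] at hs ⊢
  rw [Finsupp.mapRange_apply] at hs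
  exact fun h => hs (by rw [h, Polynomial.eval_zero])

/-! ### The Poisson superalgebra -/

theorem span_assocIndex_mul_mem {R B : Type*} [CommRing R] [Ring B] [Algebra R B] {τ : R}
    {x d w : ℕ → B} (h : Pivot τ x d w) {a b : B}
    (ha : a ∈ Submodule.span R {b | ∃ α β, AssocIndex α β ∧ b = Pivot.mono x w α β})
    (hb : b ∈ Submodule.span R {b | ∃ α β, AssocIndex α β ∧ b = Pivot.mono x w α β}) :
    a * b ∈ Submodule.span R {b | ∃ α β, AssocIndex α β ∧ b = Pivot.mono x w α β} := by
  rw [← h.adjoin_eq_span closed_index fun _ h => h.eq_empty] at ha hb ⊢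
  exact mul_mem (S := Subalgebra R B) ha hb

/-- No bracket is computed: the supercommutator of the two operators lies in the span of the
`AssocIndex` monomials, because that span is closed under products, and `t` can be divided out. -/
theorem bracket_mem_span {α β γ δ : Finset ℕ} (h : AssocIndex α β) (h' : AssocIndex γ δ) :
    bracket (Pivot.mono (fx K) (V K) α β) (Pivot.mono (fx K) (V K) γ δ) ∈
      Submodule.span K {b | ∃ α β, AssocIndex α β ∧ b = Pivot.mono (fx K) (V K) α β} := by
  obtain ⟨H, e, hH⟩ := brackets_mono_mono (K := K) α β γ δ
  rw [mono_pair_fst, mono_pair_fst] at hH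
  refine fst_mem (mem_quantIndex_of_smul_mem hH ?_)
  rw [← e, mono_pair_snd, mono_pair_snd]
  have h1 : Pivot.mono (opX (Polynomial.X : K[X])) (opV Polynomial.X) α β ∈ Submodule.span K[X]
      {b | ∃ α β, AssocIndex α β ∧
        b = Pivot.mono (opX (Polynomial.X : K[X])) (opV Polynomial.X) α β} :=
    Submodule.subset_span ⟨α, β, h, rfl⟩
  have h2 : Pivot.mono (opX (Polynomial.X : K[X])) (opV Polynomial.X) γ δ ∈ Submodule.span K[X]
      {b | ∃ α β, AssocIndex α β ∧
        b = Pivot.mono (opX (Polynomial.X : K[X])) (opV Polynomial.X) α β} :=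
    Submodule.subset_span ⟨γ, δ, h', rfl⟩
  exact sub_mem (span_assocIndex_mul_mem (pivot_op _) h1 h2)
    (zsmul_mem (span_assocIndex_mul_mem (pivot_op _) h2 h1) _)

theorem isPoissonSubalgebra_P : IsPoissonSubalgebra (P K) where
  le := sInf_le isPoissonSubalgebra_HH
  one_mem := Submodule.mem_sInf.2 fun _ hM => hM.one_mem
  gen_mem i hi := Submodule.mem_sInf.2 fun _ hM => hM.gen_mem i hi
  mul_mem _ hf _ hg := Submodule.mem_sInf.2 fun M hM =>
    hM.mul_mem _ (Submodule.mem_sInf.1 hf M hM) _ (Submodule.mem_sInf.1 hg M hM)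
  bracket_mem _ hf _ hg := Submodule.mem_sInf.2 fun M hM =>
    hM.bracket_mem _ (Submodule.mem_sInf.1 hf M hM) _ (Submodule.mem_sInf.1 hg M hM)

theorem isUnit_two (hK : (2 : K) ≠ 0) : IsUnit (2 : K[X]) := by
  have := (isUnit_iff_ne_zero.2 hK).map (Polynomial.C : K →+* K[X])
  rwa [map_ofNat] at this

theorem neg_one_pow_val {R : Type*} [Ring R] (a b : ℕ) :
    (-1 : R) ^ ((a : ZMod 2).val * (b : ZMod 2).val) = (-1) ^ (a * b) := by
  rw [neg_one_pow_eq_pow_mod_two, neg_one_pow_eq_pow_mod_two (n := a * b), ZMod.val_natCast,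
    ZMod.val_natCast, ← Nat.mul_mod]

theorem zsgn_smul {R E : Type*} [Ring R] [AddCommGroup E] [Module R E] (a b : ℕ) (x : E) :
    zsgn (a : ZMod 2) (b : ZMod 2) • x = (-1 : R) ^ (a * b) • x := by
  rw [zsgn, neg_one_pow_val]
  rcases Nat.even_or_odd (a * b) with h | h
  · rw [h.neg_one_pow, h.neg_one_pow, one_smul, one_smul]
  · rw [h.neg_one_pow, h.neg_one_pow, neg_one_smul, neg_one_smul]

/-- An operator identity with supercommutator `u t x^γ v_k` gives the Poisson bracket `u(0) x^γ V_k`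
after division by `t`. Since `u` is a unit of `K[t]`, the scalar `u(0)` is not zero. So the brackets
of operators also produce elements of `P`. -/
theorem generating_P (hK : (2 : K) ≠ 0) :
    Generating fun α n => Pivot.elt (fx K) (V K) α n ∈ P K := by
  refine (pivot_op (Polynomial.X : K[X])).generating (isUnit_two hK) ?_ ?_
  · intro i hi
    rw [Pivot.elt, ordProd_empty, one_mul]
    exact isPoissonSubalgebra_P.gen_mem i hi
  · intro α β γ m n k u hu hα hβ he
    obtain ⟨H, e, hH⟩ := brackets_mono_mono (K := K) α {m} β {n}
    have h1 (α : Finset ℕ) (n : ℕ) : Pivot.mono (pairX K) (pairV K) α {n} =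
        (Pivot.elt (fx K) (V K) α n, Pivot.elt (opX (Polynomial.X : K[X])) (opV Polynomial.X) α n) := by
      rw [mono_pair_eq (α, {n}), monoF, monoT, Pivot.mono, Pivot.mono, ordProd_singleton,
        ordProd_singleton]
    rw [h1, h1] at e hH
    rw [zsgn_smul (R := K[X]), Finset.card_singleton, Finset.card_singleton, he, mul_comm,
      mul_smul] at e
    have h2 : u • (Pivot.mono (pairX K) (pairV K) γ {k}) ∈ Quant K :=
      Submodule.smul_mem _ _ (quant_mono _ _)
    rw [h1] at h2
    have h3 := fst_eq_of_snd_eq hH h2 (eq_of_smul_eq hH h2 e.symm)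
    have h4 : IsUnit (u.eval 0) := hu.map (Polynomial.evalRingHom (0 : K))
    have h5 := isPoissonSubalgebra_P.bracket_mem _ hα _ hβ
    have h6 : bracket (Pivot.elt (fx K) (V K) α m) (Pivot.elt (fx K) (V K) β n) =
        u.eval 0 • Pivot.elt (fx K) (V K) γ k := h3
    rw [h6] at h5
    exact (Submodule.smul_mem_iff _ h4.ne_zero).1 h5

theorem mono_mem_P (hK : (2 : K) ≠ 0) {α β : Finset ℕ} (h : AssocIndex α β) :
    Pivot.mono (fx K) (V K) α β ∈ P K := by
  let S : Subalgebra K (FormalSum K) := (P K).toSubalgebra isPoissonSubalgebra_P.one_mem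
    fun f g hf hg => isPoissonSubalgebra_P.mul_mem f hf g hg
  have h1 : Algebra.adjoin K {b | ∃ α n, LieIndex α n ∧ b = Pivot.elt (fx K) (V K) α n} ≤ S := by
    refine Algebra.adjoin_le ?_
    rintro _ ⟨α, n, hα, rfl⟩
    exact (generating_P hK).of_lieIndex hα
  exact h1 (pivot_formal.mono_mem_adjoin closed_index (fun _ h => h.eq_empty) _ le_rfl h)

variable (K) in
/-- The span of the basis monomials. -/
def spanP : Submodule K (FormalSum K) :=
  Submodule.span K {b | ∃ α β, AssocIndex α β ∧ b = Pivot.mono (fx K) (V K) α β}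

theorem spanP_le (hK : (2 : K) ≠ 0) : spanP K ≤ P K := by
  refine Submodule.span_le.2 ?_
  rintro _ ⟨α, β, h, rfl⟩
  exact mono_mem_P hK h

/-- If `x_i T` is admissible, some `y_j` in `T` has `i < j`, which bounds `i` in terms of `T`. -/
theorem HH_le_xFinite {f : FormalSum K} (hf : f ∈ HH K) : f ∈ xFinite K := by
  intro T
  refine (Finset.finite_toSet (Finset.range (ySum T + 1))).subset fun i hi => ?_
  rcases hf.1 _ hi with h | ⟨j, hj, h⟩
  · exact absurd h (Finset.insert_ne_empty _ _)
  · have h1 : iy j ∈ T := (Finset.mem_insert.1 hj).resolve_left (ix_ne_iy _ _).symm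
    have h2 := le_ySum h1
    have := h i (Finset.mem_insert_self _ _)
    rw [Finset.mem_coe, Finset.mem_range]
    omega

theorem bracket_mem_of_span {M N : Submodule K (FormalSum K)} {S : Set (FormalSum K)}
    (hS : Submodule.span K S ≤ M) (hM : ∀ f ∈ M, f ∈ xFinite K)
    (h : ∀ f ∈ S, ∀ g ∈ S, bracket f g ∈ N) {f g : FormalSum K} (hf : f ∈ Submodule.span K S)
    (hg : g ∈ Submodule.span K S) : bracket f g ∈ N := by
  have hz (f : FormalSum K) : bracket f 0 = 0 := by
    have := bracket_smul_right (0 : K) f 0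
    rwa [zero_smul, zero_smul] at this
  have hz' (f : FormalSum K) : bracket 0 f = 0 := by
    have := bracket_smul_left (0 : K) 0 f
    rwa [zero_smul, zero_smul] at this
  have key : ∀ f ∈ S, bracket f g ∈ N := by
    intro f hf
    induction hg using Submodule.span_induction with
    | mem g hg => exact h f hf g hg
    | zero => rw [hz]; exact zero_mem _
    | add g g' h1 h2 h3 h4 =>
      rw [bracket_add_right (hM _ (hS (Submodule.subset_span hf))) (hM _ (hS h1)) (hM _ (hS h2))]
      exact add_mem h3 h4
    | smul c g _ h =>
      rw [bracket_smul_right]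
      exact Submodule.smul_mem _ _ h
  induction hf using Submodule.span_induction with
  | mem f hf => exact key f hf
  | zero => rw [hz']; exact zero_mem _
  | add f f' h1 h2 h3 h4 =>
    rw [bracket_add_left (hM _ (hS h1)) (hM _ (hS h2)) (hM _ (hS hg))]
    exact add_mem h3 h4
  | smul c f _ h =>
    rw [bracket_smul_left]
    exact Submodule.smul_mem _ _ h

theorem isPoissonSubalgebra_spanP (hK : (2 : K) ≠ 0) : IsPoissonSubalgebra (spanP K) where
  le := (spanP_le hK).trans isPoissonSubalgebra_P.le
  one_mem := by
    have : (1 : FormalSum K) = Pivot.mono (fx K) (V K) ∅ ∅ := by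
      rw [Pivot.mono, ordProd_empty, ordProd_empty, mul_one]
    rw [this]
    exact Submodule.subset_span ⟨∅, ∅, closed_index.nil, rfl⟩
  gen_mem i hi := by
    have : V K i = Pivot.mono (fx K) (V K) ∅ {i} := by
      rw [Pivot.mono, ordProd_empty, ordProd_singleton, one_mul]
    rw [this]
    refine Submodule.subset_span ⟨∅, {i}, ⟨fun _ => ∅, fun b _ => ?_, Finset.empty_subset _⟩, rfl⟩
    exact ⟨Or.inl (by simp), by simp⟩
  mul_mem _ hf _ hg := span_assocIndex_mul_mem pivot_formal hf hg
  bracket_mem _ hf _ hg := by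
    refine bracket_mem_of_span (spanP_le hK)
      (fun f hf => HH_le_xFinite (isPoissonSubalgebra_P.le hf)) ?_ hf hg
    rintro _ ⟨α, β, h, rfl⟩ _ ⟨γ, δ, h', rfl⟩
    exact bracket_mem_span h h'

theorem P_eq_span (hK : (2 : K) ≠ 0) : P K = spanP K :=
  le_antisymm (sInf_le (isPoissonSubalgebra_spanP hK)) (spanP_le hK)

end FractalSuper

namespace FractalSuper

variable {K : Type*} [Field K]

/-! ### The Lie superalgebra and its associative hulls -/

theorem lieIndex_empty (i : ℕ) : LieIndex ∅ i := ⟨Or.inl (by simp), by simp⟩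

variable (K) in
/-- The elements of the basis of the Lie superalgebra. -/
abbrev eltQ (α : Finset ℕ) (n : ℕ) : Module.End K (Grassmann K) :=
  Pivot.elt (opX (1 : K)) (opV (1 : K)) α n

theorem eltQ_empty (i : ℕ) : eltQ K ∅ i = v K i := by
  rw [v_eq_opV]
  exact (congrArg (· * opV (1 : K) i) (ordProd_empty _)).trans (one_mul _)

theorem eltQ_eq_mono (α : Finset ℕ) (n : ℕ) :
    eltQ K α n = Pivot.mono (opX (1 : K)) (opV (1 : K)) α {n} := by
  rw [Pivot.mono, ordProd_singleton]

theorem eltQ_ne_zero (α : Finset ℕ) (n : ℕ) : eltQ K α n ≠ 0 := by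
  rw [eltQ_eq_mono]
  exact (mono_op_linearIndependent (R := K) one_ne_zero).ne_zero (α, {n})

theorem eltQ_homogeneous (α : Finset ℕ) (n : ℕ) :
    IsHomogeneousEnd K ((α.card + 1 : ℕ) : ZMod 2) (eltQ K α n) := by
  rw [eltQ_eq_mono]
  exact mono_homogeneous 1 α {n}

theorem v_homogeneous (i : ℕ) : IsHomogeneousEnd K 1 (v K i) := by
  have := eltQ_homogeneous (K := K) ∅ i
  rw [eltQ_empty] at this
  simpa using this

theorem isLieMonomial_homogeneous {p : ZMod 2} {a : Module.End K (Grassmann K)}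
    (h : IsLieMonomial K p a) : IsHomogeneousEnd K p a := by
  induction h with
  | gen i _ => exact v_homogeneous i
  | bracket p q a b _ _ ha hb =>
    have h := hb.mul ha
    rw [add_comm] at h
    exact (ha.mul hb).sub (h.smul _)

theorem span_homogeneous {R : Type*} [CommRing R] {p : ZMod 2}
    {S : Set (Module.End R (Grassmann R))} (hS : ∀ a ∈ S, IsHomogeneousEnd R p a)
    {a : Module.End R (Grassmann R)} (ha : a ∈ Submodule.span R S) : IsHomogeneousEnd R p a := by
  induction ha using Submodule.span_induction with
  | mem a ha => exact hS a ha
  | zero => exact isHomogeneousEnd_zero _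
  | add a b _ _ ha hb => exact ha.add hb
  | smul r a _ ha => exact ha.smul r

variable (K) in
/-- The homogeneous part of parity `p` of the Lie superalgebra. -/
def lieSpan (p : ZMod 2) : Submodule K (Module.End K (Grassmann K)) :=
  Submodule.span K {a | IsLieMonomial K p a}

theorem lieSpan_le (p : ZMod 2) : lieSpan K p ≤ Q K := Submodule.span_mono fun _ h => ⟨p, h⟩

theorem bracket_mem_lieSpan {p q : ZMod 2} {a b : Module.End K (Grassmann K)}
    (ha : a ∈ lieSpan K p) (hb : b ∈ lieSpan K q) :
    a * b - (-1 : K) ^ (p.val * q.val) • (b * a) ∈ lieSpan K (p + q) := by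
  induction ha using Submodule.span_induction with
  | mem a ha =>
    induction hb using Submodule.span_induction with
    | mem b hb => exact Submodule.subset_span (IsLieMonomial.bracket p q a b ha hb)
    | zero => simp
    | add b b' _ _ h h' =>
      have := add_mem h h'
      convert this using 1
      rw [mul_add, add_mul, smul_add]
      abel
    | smul r b _ h =>
      have := Submodule.smul_mem _ r h
      convert this using 1
      rw [mul_smul_comm, smul_mul_assoc, smul_sub, smul_comm r]
  | zero => simp
  | add a a' _ _ h h' =>
    have := add_mem h h'
    convert this using 1
    rw [mul_add, add_mul, smul_add]
    abel
  | smul r a _ h =>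
    have := Submodule.smul_mem _ r h
    convert this using 1
    rw [mul_smul_comm, smul_mul_assoc, smul_sub, smul_comm r]

/-- The parity is part of the statement, because the sign in the supercommutator of Lie monomials
depends on it. -/
theorem generating_Q (hK : (2 : K) ≠ 0) :
    Generating fun α n => eltQ K α n ∈ lieSpan K ((α.card + 1 : ℕ) : ZMod 2) := by
  refine (pivot_op (1 : K)).generating (isUnit_iff_ne_zero.2 hK) ?_ ?_
  · intro i hi
    rw [eltQ_empty]
    exact Submodule.subset_span (by simpa using IsLieMonomial.gen (K := K) i hi)
  · intro α β γ m n k u hu hα hβ he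
    have h1 := bracket_mem_lieSpan hα hβ
    rw [neg_one_pow_val, he, mul_one] at h1
    have h2 := (Submodule.smul_mem_iff _ hu.ne_zero).1 h1
    have h3 : IsHomogeneousEnd K _ (eltQ K γ k) :=
      span_homogeneous (fun _ h => isLieMonomial_homogeneous h) h2
    have h4 := eltQ_homogeneous (K := K) γ k
    -- The parities must match, since otherwise the nonzero element `eltQ K γ k` would be
    -- homogeneous of both parities.
    by_cases h5 : ((α.card + 1 : ℕ) : ZMod 2) + ((β.card + 1 : ℕ) : ZMod 2) =
        ((γ.card + 1 : ℕ) : ZMod 2)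
    · rwa [h5] at h2
    · exact absurd (eq_zero_of_homogeneous h5 h3 h4) (eltQ_ne_zero γ k)

theorem eltQ_mem (hK : (2 : K) ≠ 0) {α : Finset ℕ} {n : ℕ} (h : LieIndex α n) :
    eltQ K α n ∈ Q K :=
  lieSpan_le _ ((generating_Q hK).of_lieIndex h)

variable (K) in
/-- The span of the basis elements of parity `p`. -/
def eltSpanParity (p : ZMod 2) : Submodule K (Module.End K (Grassmann K)) :=
  Submodule.span K {b | ∃ α n, (LieIndex α n ∧ ((α.card + 1 : ℕ) : ZMod 2) = p) ∧ b = eltQ K α n}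

theorem eltSpanParity_homogeneous {p : ZMod 2} {a : Module.End K (Grassmann K)}
    (ha : a ∈ eltSpanParity K p) : IsHomogeneousEnd K p a := by
  refine span_homogeneous ?_ ha
  rintro _ ⟨α, n, ⟨-, rfl⟩, rfl⟩
  exact eltQ_homogeneous α n

theorem zmod_two_eq_add_one {p q : ZMod 2} (h : ¬q = p) : q = p + 1 := by
  revert p q
  decide

theorem zmod_two_ne_add_one (p : ZMod 2) : p ≠ p + 1 := by
  revert p
  decide

theorem mem_eltSpanParity {p : ZMod 2} {a : Module.End K (Grassmann K)}
    (ha : a ∈ Pivot.eltSpan K (opX (1 : K)) (opV (1 : K)) LieIndex)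
    (hp : IsHomogeneousEnd K p a) : a ∈ eltSpanParity K p := by
  have h1 : Pivot.eltSpan K (opX (1 : K)) (opV (1 : K)) LieIndex ≤
      eltSpanParity K p ⊔ eltSpanParity K (p + 1) := by
    refine Submodule.span_le.2 ?_
    rintro _ ⟨α, n, h, rfl⟩
    by_cases hp : ((α.card + 1 : ℕ) : ZMod 2) = p
    · exact Submodule.mem_sup_left (Submodule.subset_span ⟨α, n, ⟨h, hp⟩, rfl⟩)
    · refine Submodule.mem_sup_right (Submodule.subset_span ⟨α, n, ⟨h, ?_⟩, rfl⟩)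
      exact zmod_two_eq_add_one hp
  obtain ⟨b, hb, c, hc, rfl⟩ := Submodule.mem_sup.1 (h1 ha)
  have h2 := hp.sub (eltSpanParity_homogeneous hb)
  rw [add_sub_cancel_left] at h2
  rw [eq_zero_of_homogeneous (zmod_two_ne_add_one p) h2 (eltSpanParity_homogeneous hc), add_zero]
  exact hb

theorem bracket_mem_eltSpanParity {p q : ZMod 2} {a b : Module.End K (Grassmann K)}
    (ha : a ∈ eltSpanParity K p) (hb : b ∈ eltSpanParity K q) :
    a * b - (-1 : K) ^ (p.val * q.val) • (b * a) ∈
      Pivot.eltSpan K (opX (1 : K)) (opV (1 : K)) LieIndex := by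
  induction ha using Submodule.span_induction with
  | mem a ha =>
    obtain ⟨α, n, ⟨hα, rfl⟩, rfl⟩ := ha
    induction hb using Submodule.span_induction with
    | mem b hb =>
      obtain ⟨β, m, ⟨hβ, rfl⟩, rfl⟩ := hb
      rw [neg_one_pow_val]
      rcases le_total n m with h | h
      · obtain ⟨d, rfl⟩ := Nat.exists_eq_add_of_le h
        exact (pivot_op (1 : K)).elt_bracket_mem closed_index hα hβ
      · obtain ⟨d, rfl⟩ := Nat.exists_eq_add_of_le h
        have := (pivot_op (1 : K)).elt_bracket_mem closed_index hβ hα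
        have h2 := Submodule.smul_mem _ (-(-1 : K) ^ ((α.card + 1) * (β.card + 1))) this
        convert h2 using 1
        rw [mul_comm (β.card + 1), smul_sub, smul_smul, neg_mul, ← mul_pow, neg_mul_neg, one_mul,
          one_pow, neg_smul, neg_smul, one_smul]
        abel
    | zero => simp
    | add b b' _ _ h h' =>
      have := add_mem h h'
      convert this using 1
      rw [mul_add, add_mul, smul_add]
      abel
    | smul r b _ h =>
      have := Submodule.smul_mem _ r h
      convert this using 1
      rw [mul_smul_comm, smul_mul_assoc, smul_sub, smul_comm r]
  | zero => simp
  | add a a' _ _ h h' =>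
    have := add_mem h h'
    convert this using 1
    rw [mul_add, add_mul, smul_add]
    abel
  | smul r a _ h =>
    have := Submodule.smul_mem _ r h
    convert this using 1
    rw [mul_smul_comm, smul_mul_assoc, smul_sub, smul_comm r]

theorem isLieMonomial_mem {p : ZMod 2} {a : Module.End K (Grassmann K)}
    (h : IsLieMonomial K p a) : a ∈ eltSpanParity K p := by
  induction h with
  | gen i _ =>
    rw [← eltQ_empty]
    exact Submodule.subset_span ⟨∅, i, ⟨lieIndex_empty i, by simp⟩, rfl⟩
  | bracket p q a b h h' ha hb =>
    exact mem_eltSpanParity (bracket_mem_eltSpanParity ha hb)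
      (isLieMonomial_homogeneous (IsLieMonomial.bracket p q a b h h'))

/-- With `eltQ_mem`, this means that `Q` is exactly the span of the elements given by `LieIndex`.
Applying `deform` to such a span again gives combinations of standard elements. -/
theorem Q_le : Q K ≤ Pivot.eltSpan K (opX (1 : K)) (opV (1 : K)) LieIndex := by
  refine Submodule.span_le.2 ?_
  rintro a ⟨p, ha⟩
  refine Submodule.span_mono ?_ (isLieMonomial_mem ha)
  rintro _ ⟨α, n, h, rfl⟩
  exact ⟨α, n, h.1, rfl⟩

theorem eltQ_mem_A (hK : (2 : K) ≠ 0) {α : Finset ℕ} {n : ℕ} (h : LieIndex α n) :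
    eltQ K α n ∈ A K := by
  have : Generating fun α n => eltQ K α n ∈ A K := by
    refine (pivot_op (1 : K)).generating (isUnit_iff_ne_zero.2 hK) ?_ ?_
    · intro i hi
      rw [eltQ_empty]
      refine Algebra.subset_adjoin ?_
      interval_cases i <;> simp
    · intro α β γ m n k u hu hα hβ he
      have h1 := sub_mem (mul_mem hα hβ) (Subalgebra.smul_mem _ (mul_mem hβ hα)
        ((-1 : K) ^ ((α.card + 1) * (β.card + 1))))
      rw [he, mul_one] at h1
      have := Subalgebra.smul_mem _ h1 u⁻¹
      rwa [smul_smul, inv_mul_cancel₀ hu.ne_zero, one_smul] at this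
  exact this.of_lieIndex h

theorem A_eq_span (hK : (2 : K) ≠ 0) : Subalgebra.toSubmodule (A K) =
    Submodule.span K {b | ∃ α β, AssocIndex α β ∧
      b = Pivot.mono (opX (1 : K)) (opV (1 : K)) α β} := by
  rw [← (pivot_op (1 : K)).adjoin_eq_span closed_index fun _ h => h.eq_empty]
  congr 1
  refine le_antisymm (Algebra.adjoin_le ?_) (Algebra.adjoin_le ?_)
  · have key (i : ℕ) : v K i ∈ Algebra.adjoin K
        {b | ∃ α n, LieIndex α n ∧ b = Pivot.elt (opX (1 : K)) (opV (1 : K)) α n} :=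
      Algebra.subset_adjoin ⟨∅, i, lieIndex_empty i, (eltQ_empty i).symm⟩
    rintro _ (rfl | rfl | rfl)
    · exact key 0
    · exact key 1
    · exact key 2
  · rintro _ ⟨α, n, h, rfl⟩
    exact eltQ_mem_A hK h

theorem deform_mem {a : Module.End K (Grassmann K)}
    (ha : a ∈ Pivot.eltSpan K (opX (1 : K)) (opV (1 : K)) LieIndex) :
    deform K a ∈ Algebra.adjoin K[X] {b | ∃ α n, LieIndex α n ∧
      b = Pivot.elt (opX (Polynomial.X : K[X])) (opV (Polynomial.X : K[X])) α n} := by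
  induction ha using Submodule.span_induction with
  | mem a ha =>
    obtain ⟨α, n, h, rfl⟩ := ha
    rw [deform_elt]
    exact Algebra.subset_adjoin ⟨α, n, h, rfl⟩
  | zero =>
    have := deform_smul (K := K) 0 0
    rw [zero_smul, map_zero, zero_smul] at this
    rw [this]
    exact zero_mem _
  | add a b _ _ ha hb =>
    rw [deform_add]
    exact add_mem ha hb
  | smul r a _ ha =>
    rw [deform_smul]
    exact Subalgebra.smul_mem _ ha _

/-- The operators of `Q` deform to combinations of the elements `x^α v_n` with parameter `t`, and
each such element is itself the deformation of an element of `Q`. The straightening theorem then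
applies with `τ = t`. -/
theorem At_eq_span (hK : (2 : K) ≠ 0) : Subalgebra.toSubmodule (At K) =
    Submodule.span K[X] {b | ∃ α β, AssocIndex α β ∧
      b = Pivot.mono (opX (Polynomial.X : K[X])) (opV (Polynomial.X : K[X])) α β} := by
  rw [← (pivot_op (Polynomial.X : K[X])).adjoin_eq_span closed_index fun _ h => h.eq_empty]
  congr 1
  refine le_antisymm (Algebra.adjoin_le ?_) (Algebra.adjoin_le ?_)
  · rintro _ ⟨a, ha, rfl⟩
    exact deform_mem (Q_le ha)
  · rintro _ ⟨α, n, h, rfl⟩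
    rw [← deform_elt]
    exact Algebra.subset_adjoin ⟨_, eltQ_mem hK h, rfl⟩

end FractalSuper

namespace FractalSuper

variable {K : Type*} [Field K]

open FormalSum

/-! ### Bases -/

/-- The basis of `E[t]` that consists of constants. -/
def polyBasis {E ι : Type*} [AddCommGroup E] [Module K E] (b : Module.Basis ι K E) :
    Module.Basis ι K[X] (PolynomialModule K E) :=
  Module.Basis.mk (v := fun i => const K (b i))
    (by
      rw [linearIndependent_iff]
      intro c hc
      ext1 i
      refine Polynomial.ext fun n => ?_
      -- A relation over `K[t]` is split into its coefficients at each power of `t`, which are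
      -- relations over `K`.
      have h1 : Finsupp.linearCombination K b (c.mapRange (fun p => p.coeff n)
          (Polynomial.coeff_zero n)) =
          (Finsupp.linearCombination K[X] (fun i => const K (b i)) c).coeff n := by
        clear hc
        induction c using Finsupp.induction_linear with
        | zero => simp
        | add c d hc hd =>
          rw [Finsupp.mapRange_add fun _ _ => Polynomial.coeff_add _ _ _, map_add, map_add, hc, hd]
          rfl
        | single i r =>
          rw [Finsupp.mapRange_single, Finsupp.linearCombination_single,
            Finsupp.linearCombination_single, PolynomialModule.smul_single_apply]
          simp
      rw [hc] at h1
      have h2 := b.linearIndependent (h1.trans (map_zero _).symm)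
      have := DFunLike.congr_fun h2 i
      rwa [Finsupp.mapRange_apply] at this)
    (by
      rintro f -
      induction f using PolynomialModule.induction_linear with
      | zero => exact zero_mem _
      | add f g hf hg => exact add_mem hf hg
      | single n m =>
        have h1 : PolynomialModule.single K n m = (Polynomial.monomial n 1 : K[X]) • const K m := by
          rw [PolynomialModule.monomial_smul_single, add_zero, one_smul]
        rw [h1]
        refine Submodule.smul_mem _ _ ?_
        have h2 := b.mem_span m
        induction h2 using Submodule.span_induction with
        | mem m hm =>
          obtain ⟨i, rfl⟩ := hm
          exact Submodule.subset_span ⟨i, rfl⟩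
        | zero =>
          rw [const, PolynomialModule.single_zero]
          exact zero_mem _
        | add m m' _ _ h h' =>
          rw [const, PolynomialModule.single_add]
          exact add_mem (h (by
            rw [PolynomialModule.monomial_smul_single, add_zero, one_smul])) (h' (by
            rw [PolynomialModule.monomial_smul_single, add_zero, one_smul]))
        | smul r m _ h =>
          rw [const, PolynomialModule.single_smul, ← algebraMap_smul K[X] r]
          exact Submodule.smul_mem _ _ (h (by
            rw [PolynomialModule.monomial_smul_single, add_zero, one_smul])))

theorem polyBasis_apply {E ι : Type*} [AddCommGroup E] [Module K E] (b : Module.Basis ι K E)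
    (i : ι) : polyBasis b i = const K (b i) := Module.Basis.mk_apply _ _ i

/-- The indices of the basis monomials. -/
def indexSet : Set (Finset ℕ × Finset ℕ) := {s | AssocIndex s.1 s.2}

section Basis

variable {R B : Type*} [CommRing R] [Ring B] [Algebra R B] {x w : ℕ → B}
  (hli : LinearIndependent R fun s : Finset ℕ × Finset ℕ => Pivot.mono x w s.1 s.2)
  (M : Submodule R B) (hM : M = Submodule.span R {b | ∃ α β, AssocIndex α β ∧ b = Pivot.mono x w α β})

/-- The basis of monomials. -/
def monoBasis : Module.Basis indexSet R M :=
  (Module.Basis.span (hli.comp (Subtype.val : indexSet → _) Subtype.val_injective)).map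
    (LinearEquiv.ofEq _ _ (by
      rw [hM]
      congr 1
      ext b
      constructor
      · rintro ⟨s, rfl⟩
        exact ⟨s.1.1, s.1.2, s.2, rfl⟩
      · rintro ⟨α, β, h, rfl⟩
        exact ⟨⟨(α, β), h⟩, rfl⟩))

theorem coe_monoBasis (s : indexSet) :
    (monoBasis hli M hM s : B) = Pivot.mono x w s.1.1 s.1.2 := by
  rw [monoBasis, Module.Basis.map_apply, LinearEquiv.coe_ofEq_apply, Module.Basis.span_apply]
  rfl

end Basis

/-- The basis of monomials of the Poisson superalgebra. -/
def basisP (hK : (2 : K) ≠ 0) : Module.Basis indexSet K (P K) :=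
  monoBasis (x := fx K) (w := V K) mono_formal_linearIndependent (P K) (P_eq_span hK)

/-- The basis of monomials of the associative hull. -/
def basisA (hK : (2 : K) ≠ 0) : Module.Basis indexSet K (A K) :=
  (monoBasis (x := opX (1 : K)) (w := opV (1 : K)) (mono_op_linearIndependent one_ne_zero)
    (Subalgebra.toSubmodule (A K))
    (A_eq_span hK)).map (Subalgebra.toSubmoduleEquiv (A K))

/-- The basis of monomials of the deformed superalgebra. -/
def basisAt (hK : (2 : K) ≠ 0) : Module.Basis indexSet K[X] (At K) :=
  (monoBasis (x := opX (Polynomial.X : K[X])) (w := opV (Polynomial.X : K[X]))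
    monoT_linearIndependent (Subalgebra.toSubmodule (At K))
    (At_eq_span hK)).map (Subalgebra.toSubmoduleEquiv (At K))

theorem coe_basisP (hK : (2 : K) ≠ 0) (s : indexSet) : (basisP hK s : FormalSum K) = monoF K s :=
  coe_monoBasis (x := fx K) (w := V K) mono_formal_linearIndependent (P K) (P_eq_span hK) s

theorem coe_basisA (hK : (2 : K) ≠ 0) (s : indexSet) :
    (basisA hK s : Module.End K (Grassmann K)) = monoA K s.1.1 s.1.2 := by
  rw [monoA_eq]
  exact coe_monoBasis (x := opX (1 : K)) (w := opV (1 : K))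
    (mono_op_linearIndependent one_ne_zero) _ (A_eq_span hK) s

theorem coe_basisAt (hK : (2 : K) ≠ 0) (s : indexSet) :
    (basisAt hK s : OpT K) = monoT K s :=
  coe_monoBasis monoT_linearIndependent _ (At_eq_span hK) s

/-! ### Parity -/

theorem quantSpan_snd_homogeneous {I : Finset ℕ → Finset ℕ → Prop} {p : ZMod 2}
    {z : FormalSum K × OpT K} (hz : z ∈ quantSpan K I p) : IsHomogeneousEnd K[X] p z.2 := by
  induction hz using Submodule.span_induction with
  | mem z hz =>
    obtain ⟨α, β, ⟨-, rfl⟩, rfl⟩ := hz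
    rw [mono_pair_snd]
    exact mono_homogeneous _ α β
  | zero => exact isHomogeneousEnd_zero _
  | add a b _ _ ha hb => exact ha.add hb
  | smul r a _ ha => exact ha.smul r

theorem quantIndex_le_sup (I : Finset ℕ → Finset ℕ → Prop) (p : ZMod 2) :
    quantIndex K I ≤ quantSpan K I p ⊔ quantSpan K I (p + 1) := by
  refine Submodule.span_le.2 ?_
  rintro _ ⟨α, β, h, rfl⟩
  by_cases hp : ((α.card + β.card : ℕ) : ZMod 2) = p
  · exact Submodule.mem_sup_left (Submodule.subset_span ⟨α, β, ⟨h, hp⟩, rfl⟩)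
  · exact Submodule.mem_sup_right (Submodule.subset_span ⟨α, β, ⟨h, zmod_two_eq_add_one hp⟩, rfl⟩)

theorem quantSpan_le_quant {I : Finset ℕ → Finset ℕ → Prop} {p : ZMod 2} :
    quantSpan K I p ≤ Quant K := (quantSpan_le p).trans quantIndex_le

theorem eq_zero_of_snd {z : FormalSum K × OpT K} (hz : z ∈ Quant K) (h : z.2 = 0) : z = 0 :=
  Prod.ext (fst_eq_of_snd_eq hz (zero_mem _) h) h

/-- Homogeneity is assumed only for the multiple by `t`, because it is the supercommutator `t h`
whose parity is known. The component of wrong parity is killed by `t`, hence zero. -/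
theorem mem_quantSpan {I : Finset ℕ → Finset ℕ → Prop} {p : ZMod 2} {z : FormalSum K × OpT K}
    (hz : z ∈ quantIndex K I)
    (h : IsHomogeneousEnd K[X] p ((Polynomial.X : K[X]) • z.2)) : z ∈ quantSpan K I p := by
  obtain ⟨a, ha, b, hb, rfl⟩ := Submodule.mem_sup.1 (quantIndex_le_sup I p hz)
  have h1 := h.sub ((quantSpan_snd_homogeneous ha).smul (Polynomial.X : K[X]))
  rw [Prod.snd_add, smul_add, add_sub_cancel_left] at h1
  have h2 := eq_zero_of_homogeneous (zmod_two_ne_add_one p) h1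
    ((quantSpan_snd_homogeneous hb).smul (Polynomial.X : K[X]))
  have h3 := eq_of_smul_eq (quantSpan_le_quant hb) (zero_mem _) (h2.trans (smul_zero _).symm)
  rw [eq_zero_of_snd (quantSpan_le_quant hb) h3, add_zero]
  exact ha

theorem snd_mem_At (hK : (2 : K) ≠ 0) {z : FormalSum K × OpT K}
    (hz : z ∈ quantIndex K AssocIndex) : z.2 ∈ At K := by
  have := snd_mem hz
  rwa [← At_eq_span hK] at this

theorem exists_pair (hK : (2 : K) ≠ 0) {a : OpT K} (ha : a ∈ At K) :
    ∃ f, (f, a) ∈ quantIndex K AssocIndex := by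
  have h : a ∈ Subalgebra.toSubmodule (At K) := ha
  rw [At_eq_span hK] at h
  obtain ⟨c, hc, h⟩ := mem_span_mono_iff.1 h
  exact ⟨_, mem_quantIndex_iff.2 ⟨c, hc, rfl, h⟩⟩

/-- The supercommutator of homogeneous elements and the bracket. -/
theorem exists_bracket (hK : (2 : K) ≠ 0) {p q : ZMod 2} {z w : FormalSum K × OpT K}
    (hz : z ∈ quantSpan K AssocIndex p) (hw : w ∈ quantSpan K AssocIndex q) :
    ∃ h : OpT K, z.2 * w.2 - zsgn p q • (w.2 * z.2) = (Polynomial.X : K[X]) • h ∧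
      (bracket z.1 w.1, h) ∈ quantSpan K AssocIndex (p + q) := by
  obtain ⟨h, e, hh⟩ := brackets_of_mem hz hw
  have hz' := quantSpan_snd_homogeneous hz
  have hw' := quantSpan_snd_homogeneous hw
  have h1 : IsHomogeneousEnd K[X] (p + q) ((Polynomial.X : K[X]) • h) := by
    have h2 := hw'.mul hz'
    rw [add_comm] at h2
    rw [← e]
    intro r f hf
    exact sub_mem (hz'.mul hw' r f hf) (zsmul_mem (h2 r f hf) _)
  refine ⟨h, e, mem_quantSpan (mem_quantIndex_of_smul_mem hh ?_) h1⟩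
  change (Polynomial.X : K[X]) • h ∈ _
  rw [← e, ← At_eq_span hK]
  have ha := snd_mem_At hK (quantSpan_le _ hz)
  have hb := snd_mem_At hK (quantSpan_le _ hw)
  exact sub_mem (mul_mem (S := Subalgebra K[X] (OpT K)) ha hb)
    (zsmul_mem (mul_mem (S := Subalgebra K[X] (OpT K)) hb ha) _)

theorem mem_Pparity {p : ZMod 2} {f : P K} : f ∈ Pparity K p ↔ HasParity p (f : FormalSum K) :=
  Iff.rfl

theorem eq_zero_of_parity {p q : ZMod 2} (h : p ≠ q) {f : P K} (hp : f ∈ Pparity K p)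
    (hq : f ∈ Pparity K q) : f = 0 := by
  refine Subtype.ext (FormalSum.ext fun S => ?_)
  by_contra hS
  exact h ((hp S hS).symm.trans (hq S hS))

/-! ### The quantization map -/

/-- The isomorphism of `P[t]` with the deformed superalgebra. -/
def quantize (hK : (2 : K) ≠ 0) : PolynomialModule K (P K) ≃ₗ[K[X]] At K :=
  (polyBasis (basisP hK)).equiv (basisAt hK) (Equiv.refl _)

theorem quantize_basis (hK : (2 : K) ≠ 0) (s : indexSet) :
    quantize hK (const K (basisP hK s)) = basisAt hK s := by
  rw [← polyBasis_apply, quantize, Module.Basis.equiv_apply]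
  rfl

theorem const_add (a b : P K) : const K (a + b) = const K a + const K b :=
  PolynomialModule.single_add _ _ _

theorem const_smul (c : K) (a : P K) : const K (c • a) = Polynomial.C c • const K a := by
  rw [const, PolynomialModule.single_smul, ← algebraMap_smul K[X] c]
  rfl

theorem const_mem_quantIndex (hK : (2 : K) ≠ 0) (a : P K) :
    ((a : FormalSum K), (quantize hK (const K a) : OpT K)) ∈ quantIndex K AssocIndex := by
  have h := (basisP hK).mem_span a
  induction h using Submodule.span_induction with
  | mem a ha =>
    obtain ⟨s, rfl⟩ := ha
    rw [quantize_basis, coe_basisP, coe_basisAt, ← mono_pair_eq]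
    exact Submodule.subset_span ⟨s.1.1, s.1.2, s.2, rfl⟩
  | zero =>
    rw [const, PolynomialModule.single_zero, map_zero]
    exact zero_mem _
  | add a b _ _ ha hb =>
    rw [const_add, map_add]
    exact add_mem ha hb
  | smul c a _ ha =>
    rw [const_smul, map_smul]
    have := Submodule.smul_mem _ (Polynomial.C c) ha
    have e : Polynomial.C c • (a : FormalSum K) = c • (a : FormalSum K) := by
      rw [poly_smul_formal, Polynomial.eval_C]
    rw [Prod.smul_mk, e] at this
    exact this

/-- The elements of the Poisson superalgebra that are mapped to operators of parity `p`. -/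
def constPart (hK : (2 : K) ≠ 0) (p : ZMod 2) : Submodule K (P K) where
  carrier := {a | ((a : FormalSum K), (quantize hK (const K a) : OpT K)) ∈ quantSpan K AssocIndex p}
  zero_mem' := by
    rw [Set.mem_ofPred_eq, const, PolynomialModule.single_zero, map_zero]
    exact zero_mem _
  add_mem' := by
    intro a b ha hb
    rw [Set.mem_ofPred_eq] at ha hb ⊢
    rw [const_add, map_add]
    exact add_mem ha hb
  smul_mem' := by
    intro c a ha
    rw [Set.mem_ofPred_eq] at ha ⊢
    rw [const_smul, map_smul]
    have := Submodule.smul_mem _ (Polynomial.C c) ha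
    have e : Polynomial.C c • (a : FormalSum K) = c • (a : FormalSum K) := by
      rw [poly_smul_formal, Polynomial.eval_C]
    rw [Prod.smul_mk, e] at this
    exact this

theorem constPart_le (hK : (2 : K) ≠ 0) (p : ZMod 2) : constPart hK p ≤ Pparity K p :=
  fun _ ha => (quantParity_of_mem ha).parity

theorem constPart_sup (hK : (2 : K) ≠ 0) (p : ZMod 2) :
    ⊤ ≤ constPart hK p ⊔ constPart hK (p + 1) := by
  rw [← (basisP hK).span_eq]
  refine Submodule.span_le.2 ?_
  rintro _ ⟨s, rfl⟩
  have hs (q : ZMod 2) (hq : ((s.1.1.card + s.1.2.card : ℕ) : ZMod 2) = q) :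
      basisP hK s ∈ constPart hK q := by
    change ((basisP hK s : FormalSum K), (quantize hK (const K (basisP hK s)) : OpT K)) ∈
      quantSpan K AssocIndex q
    rw [quantize_basis, coe_basisP, coe_basisAt, ← mono_pair_eq]
    exact Submodule.subset_span ⟨s.1.1, s.1.2, ⟨s.2, hq⟩, rfl⟩
  by_cases hp : ((s.1.1.card + s.1.2.card : ℕ) : ZMod 2) = p
  · exact Submodule.mem_sup_left (hs _ hp)
  · exact Submodule.mem_sup_right (hs _ (zmod_two_eq_add_one hp))

/-- The parts `constPart` span `P` and are contained in the parts `Pparity`, which meet only in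
zero. So the two gradings of `P`, by formal sums and by operators, coincide. -/
theorem const_mem_quantSpan (hK : (2 : K) ≠ 0) {p : ZMod 2} {a : P K} (ha : a ∈ Pparity K p) :
    ((a : FormalSum K), (quantize hK (const K a) : OpT K)) ∈ quantSpan K AssocIndex p := by
  obtain ⟨b, hb, c, hc, rfl⟩ := Submodule.mem_sup.1 (constPart_sup hK p (x := a) trivial)
  have h1 := sub_mem ha (constPart_le hK p hb)
  rw [add_sub_cancel_left] at h1
  rw [eq_zero_of_parity (zmod_two_ne_add_one p) h1 (constPart_le hK _ hc), add_zero]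
  exact hb

theorem Pparity_sup (hK : (2 : K) ≠ 0) (f : P K) (p : ZMod 2) :
    ∃ a ∈ Pparity K p, ∃ b ∈ Pparity K (p + 1), a + b = f := by
  obtain ⟨b, hb, c, hc, h⟩ := Submodule.mem_sup.1 (constPart_sup hK p (x := f) trivial)
  exact ⟨b, constPart_le hK p hb, c, constPart_le hK _ hc, h⟩

theorem exists_eq_const_add {E : Type*} [AddCommGroup E] [Module K E] (f : PolynomialModule K E) :
    ∃ r : PolynomialModule K E, f = const K (f.coeff 0) + (Polynomial.X : K[X]) • r := by
  induction f using PolynomialModule.induction_linear with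
  | zero => exact ⟨0, by simp [const]⟩
  | add f g hf hg =>
    obtain ⟨r, hr⟩ := hf
    obtain ⟨s, hs⟩ := hg
    refine ⟨r + s, ?_⟩
    rw [PolynomialModule.coeff_add, Finsupp.add_apply, const, PolynomialModule.single_add, smul_add]
    conv_lhs => rw [hr, hs]
    abel
  | single n m =>
    cases n with
    | zero => exact ⟨0, by simp [const]⟩
    | succ n =>
      refine ⟨PolynomialModule.single K n m, ?_⟩
      rw [← Polynomial.monomial_one_one_eq_X, PolynomialModule.monomial_smul_single, one_smul,
        add_comm 1 n]
      simp [const]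

/-- The part of `f` divisible by `t` contributes to the operator but is annihilated on the side of
formal sums, so the partner of `quantize hK f` is the constant coefficient. -/
theorem mem_quantIndex_quantize (hK : (2 : K) ≠ 0) (f : PolynomialModule K (P K)) :
    ((f.coeff 0 : FormalSum K), (quantize hK f : OpT K)) ∈ quantIndex K AssocIndex := by
  obtain ⟨r, hr⟩ := exists_eq_const_add f
  obtain ⟨g, hg⟩ := exists_pair hK (quantize hK r).2
  have h := add_mem (const_mem_quantIndex hK (f.coeff 0))
    (Submodule.smul_mem _ (Polynomial.X : K[X]) hg)
  have e1 : (Polynomial.X : K[X]) • g = 0 := by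
    rw [poly_smul_formal, Polynomial.eval_X, zero_smul]
  rw [Prod.smul_mk, e1, Prod.mk_add_mk, add_zero] at h
  have e2 : (quantize hK f : OpT K) = (quantize hK (const K (f.coeff 0)) : OpT K) +
      (Polynomial.X : K[X]) • (quantize hK r : OpT K) := by
    conv_lhs => rw [hr, map_add, map_smul]
    rfl
  rw [e2]
  exact h

/-- The constant coefficient of an element of `P[t]` is determined by its operator. -/
theorem coeff_zero_eq (hK : (2 : K) ≠ 0) {f : PolynomialModule K (P K)} {g : FormalSum K}
    (h : (g, (quantize hK f : OpT K)) ∈ Quant K) : (f.coeff 0 : FormalSum K) = g :=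
  fst_eq_of_snd_eq (quantIndex_le (mem_quantIndex_quantize hK f)) h rfl

theorem exists_quantize (hK : (2 : K) ≠ 0) {z : FormalSum K × OpT K}
    (hz : z ∈ quantIndex K AssocIndex) :
    ∃ f : PolynomialModule K (P K), (quantize hK f : OpT K) = z.2 ∧
      (f.coeff 0 : FormalSum K) = z.1 := by
  have e : (quantize hK ((quantize hK).symm ⟨z.2, snd_mem_At hK hz⟩) : OpT K) = z.2 := by
    rw [LinearEquiv.apply_symm_apply]
  exact ⟨_, e, coeff_zero_eq hK (by rw [e]; exact quantIndex_le hz)⟩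

theorem polyParity_split (hK : (2 : K) ≠ 0) (p : ZMod 2) (f : PolynomialModule K (P K)) :
    ∃ a b, a ∈ polyParity K (Pparity K) p ∧ b ∈ polyParity K (Pparity K) (p + 1) ∧
      IsHomogeneousEnd K[X] p (quantize hK a : OpT K) ∧
      IsHomogeneousEnd K[X] (p + 1) (quantize hK b : OpT K) ∧ f = a + b := by
  induction f using PolynomialModule.induction_linear with
  | zero =>
    refine ⟨0, 0, fun n => zero_mem _, fun n => zero_mem _, ?_, ?_, (add_zero 0).symm⟩ <;>
    · rw [map_zero]
      exact isHomogeneousEnd_zero _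
  | add f g hf hg =>
    obtain ⟨a, b, ha, hb, ha', hb', rfl⟩ := hf
    obtain ⟨c, d, hc, hd, hc', hd', rfl⟩ := hg
    refine ⟨a + c, b + d, fun n => add_mem (ha n) (hc n), fun n => add_mem (hb n) (hd n), ?_, ?_,
      by abel⟩
    · rw [map_add]
      exact ha'.add hc'
    · rw [map_add]
      exact hb'.add hd'
  | single n m =>
    have key (q : ZMod 2) (a : P K) (ha : a ∈ Pparity K q) :
        PolynomialModule.single K n a ∈ polyParity K (Pparity K) q ∧
        IsHomogeneousEnd K[X] q (quantize hK (PolynomialModule.single K n a) : OpT K) := by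
      constructor
      · intro k
        rw [PolynomialModule.coeff_single, Finsupp.single_apply]
        split_ifs
        · exact ha
        · exact zero_mem _
      · have e : PolynomialModule.single K n a = (Polynomial.monomial n 1 : K[X]) • const K a := by
          rw [PolynomialModule.monomial_smul_single, add_zero, one_smul]
        rw [e, map_smul]
        exact (quantSpan_snd_homogeneous (const_mem_quantSpan hK ha)).smul _
    obtain ⟨a, ha, b, hb, rfl⟩ := Pparity_sup hK m p
    exact ⟨_, _, (key _ a ha).1, (key _ b hb).1, (key _ a ha).2, (key _ b hb).2,
      PolynomialModule.single_add _ _ _⟩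

/-- Each `f` splits into two components homogeneous in both senses. Either condition forces the
component of the other parity to vanish. -/
theorem mem_polyParity_iff (hK : (2 : K) ≠ 0) (p : ZMod 2) (f : PolynomialModule K (P K)) :
    f ∈ polyParity K (Pparity K) p ↔ IsHomogeneousEnd K[X] p (quantize hK f : OpT K) := by
  obtain ⟨a, b, ha, hb, ha', hb', rfl⟩ := polyParity_split hK p f
  constructor
  · intro h
    have h1 : b = 0 := by
      refine PolynomialModule.coeff_injective (Finsupp.ext fun n => ?_)
      have h2 := sub_mem (h n) (ha n)
      rw [PolynomialModule.coeff_add, Finsupp.add_apply, add_sub_cancel_left] at h2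
      exact eq_zero_of_parity (zmod_two_ne_add_one p) h2 (hb n)
    rw [h1, add_zero]
    exact ha'
  · intro h
    have h1 : b = 0 := by
      rw [map_add] at h
      have h2 := h.sub ha'
      rw [Subalgebra.coe_add, add_sub_cancel_left] at h2
      exact (quantize hK).map_eq_zero_iff.1
        (Subtype.ext (eq_zero_of_homogeneous (zmod_two_ne_add_one p) h2 hb'))
    rw [h1, add_zero]
    exact ha

end FractalSuper

namespace FractalSuper

variable {K : Type*} [Field K]

open FormalSum

/-! ### The Poisson superalgebra axioms -/

theorem P_xFinite (f : P K) : (f : FormalSum K) ∈ xFinite K :=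
  HH_le_xFinite (isPoissonSubalgebra_P.le f.2)

theorem super_jacobi {B : Type*} [Ring B] (p q r : ZMod 2) (a b c : B) :
    (a * (b * c - zsgn q r • (c * b)) - zsgn p (q + r) • ((b * c - zsgn q r • (c * b)) * a)) =
    ((a * b - zsgn p q • (b * a)) * c - zsgn (p + q) r • (c * (a * b - zsgn p q • (b * a)))) +
    zsgn p q • (b * (a * c - zsgn p r • (c * a)) -
      zsgn q (p + r) • ((a * c - zsgn p r • (c * a)) * b)) := by
  rcases zmod_two_cases p with rfl | rfl <;> rcases zmod_two_cases q with rfl | rfl <;>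
    rcases zmod_two_cases r with rfl | rfl <;>
    simp [zsgn, ZMod.val_one, CharTwo.add_self_eq_zero] <;> noncomm_ring

theorem smul_supercommutator_right {R B : Type*} [CommRing R] [Ring B] [Algebra R B] (n : ℤ) (x : R)
    (a b : B) : a * (x • b) - n • ((x • b) * a) = x • (a * b - n • (b * a)) := by
  rw [mul_smul_comm, smul_mul_assoc, smul_sub, smul_comm n]

theorem smul_supercommutator_left {R B : Type*} [CommRing R] [Ring B] [Algebra R B] (n : ℤ) (x : R)
    (a b : B) : (x • a) * b - n • (b * (x • a)) = x • (a * b - n • (b * a)) := by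
  rw [mul_smul_comm, smul_mul_assoc, smul_sub, smul_comm n]

/-- The Jacobi identity for supercommutators of operators. Each nested supercommutator is `t²` times
an operator paired with the nested Poisson bracket, and `t²` is cancelled. -/
theorem bracket_jacobi (hK : (2 : K) ≠ 0) {p q r : ZMod 2} {a b c : FormalSum K × OpT K}
    (ha : a ∈ quantSpan K AssocIndex p) (hb : b ∈ quantSpan K AssocIndex q)
    (hc : c ∈ quantSpan K AssocIndex r) :
    bracket a.1 (bracket b.1 c.1) = bracket (bracket a.1 b.1) c.1 +
      sgn K p q • bracket b.1 (bracket a.1 c.1) := by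
  obtain ⟨Hbc, ebc, hbc⟩ := exists_bracket hK hb hc
  obtain ⟨Hab, eab, hab⟩ := exists_bracket hK ha hb
  obtain ⟨Hac, eac, hac⟩ := exists_bracket hK ha hc
  obtain ⟨H1, e1, h1⟩ := exists_bracket hK ha hbc
  obtain ⟨H2, e2, h2⟩ := exists_bracket hK hab hc
  obtain ⟨H3, e3, h3⟩ := exists_bracket hK hb hac
  have h4 := add_mem (quantSpan_le_quant h2) (zsmul_mem (quantSpan_le_quant h3) (zsgn p q))
  have j := super_jacobi p q r a.2 b.2 c.2
  dsimp only at e1 e2 e3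
  have k1 : a.2 * ((Polynomial.X : K[X]) • Hbc) -
      zsgn p (q + r) • (((Polynomial.X : K[X]) • Hbc) * a.2) = _ :=
    smul_supercommutator_right (zsgn p (q + r)) (Polynomial.X : K[X]) a.2 Hbc
  have k2 : ((Polynomial.X : K[X]) • Hab) * c.2 -
      zsgn (p + q) r • (c.2 * ((Polynomial.X : K[X]) • Hab)) = _ :=
    smul_supercommutator_left (zsgn (p + q) r) (Polynomial.X : K[X]) Hab c.2
  have k3 : b.2 * ((Polynomial.X : K[X]) • Hac) -
      zsgn q (p + r) • (((Polynomial.X : K[X]) • Hac) * b.2) = _ :=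
    smul_supercommutator_right (zsgn q (p + r)) (Polynomial.X : K[X]) b.2 Hac
  rw [ebc, eab, eac, k1, k2, k3, e1, e2, e3, smul_comm (zsgn p q), ← smul_add,
    smul_comm (zsgn p q), ← smul_add] at j
  -- First cancellation of `t`. The second follows, and then the formal sums are compared.
  have h5 := eq_of_smul_eq (Submodule.smul_mem _ (Polynomial.X : K[X]) (quantSpan_le_quant h1))
    (Submodule.smul_mem _ (Polynomial.X : K[X]) h4) j
  have h6 := fst_eq_of_snd_eq (quantSpan_le_quant h1) h4
    (eq_of_smul_eq (quantSpan_le_quant h1) h4 h5)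
  rw [sgn_smul]
  exact h6

theorem supercommutator_cube {B : Type*} [Ring B] (a : B) :
    a * (a * a - zsgn 1 1 • (a * a)) - zsgn 1 (1 + 1) • ((a * a - zsgn 1 1 • (a * a)) * a) = 0 := by
  have : (1 + 1 : ZMod 2) = 0 := rfl
  rw [this]
  simp [zsgn, ZMod.val_one, mul_add, add_mul, mul_assoc]

/-- In an associative algebra an odd element supercommutes with its own square, without division by
`3`. Cancelling `t²` gives the identity for the bracket, also in characteristic `3`. -/
theorem bracket_cube (hK : (2 : K) ≠ 0) {a : FormalSum K × OpT K}
    (ha : a ∈ quantSpan K AssocIndex 1) : bracket a.1 (bracket a.1 a.1) = 0 := by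
  obtain ⟨H, e, h⟩ := exists_bracket hK ha ha
  obtain ⟨H1, e1, h1⟩ := exists_bracket hK ha h
  dsimp only at e1
  have e2 : (Polynomial.X : K[X]) • (Polynomial.X : K[X]) • H1 = 0 := by
    have k1 : a.2 * ((Polynomial.X : K[X]) • H) -
        zsgn 1 (1 + 1) • (((Polynomial.X : K[X]) • H) * a.2) = _ :=
      smul_supercommutator_right (zsgn 1 (1 + 1)) (Polynomial.X : K[X]) a.2 H
    rw [← e1, ← k1, ← e]
    exact supercommutator_cube a.2
  have h0 := zero_mem (Quant K)
  have h3 := eq_of_smul_eq (Submodule.smul_mem _ (Polynomial.X : K[X]) (quantSpan_le_quant h1))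
    h0 (e2.trans (smul_zero _).symm)
  exact fst_eq_of_snd_eq (quantSpan_le_quant h1) h0
    (eq_of_smul_eq (quantSpan_le_quant h1) h0 (h3.trans (smul_zero _).symm))

theorem bracket_mul_left {p q r : ZMod 2} {f g h : FormalSum K} (hf : HasParity p f)
    (hg : HasParity q g) (hh : HasParity r h) (hf' : f ∈ xFinite K) (hg' : g ∈ xFinite K)
    (hh' : h ∈ xFinite K) :
    bracket (f * g) h = f * bracket g h + sgn K q r • (bracket f h * g) := by
  rw [bracket_anticomm (hf.mul hg) hh, bracket_mul hh hf hh' hf' hg', bracket_anticomm hg hh,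
    bracket_anticomm hf hh]
  rcases zmod_two_cases p with rfl | rfl <;> rcases zmod_two_cases q with rfl | rfl <;>
    rcases zmod_two_cases r with rfl | rfl <;>
    simp [sgn, ZMod.val_one, CharTwo.add_self_eq_zero, add_comm]

theorem coe_Pmul (f g : P K) : ((Pmul f g : P K) : FormalSum K) = (f : FormalSum K) * g := rfl

theorem coe_Pbracket (f g : P K) : ((Pbracket f g : P K) : FormalSum K) = bracket (f : FormalSum K) g :=
  rfl

theorem Pbracket_add_left (f g h : P K) : Pbracket (f + g) h = Pbracket f h + Pbracket g h :=
  Subtype.ext (bracket_add_left (P_xFinite f) (P_xFinite g) (P_xFinite h))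

theorem Pbracket_add_right (f g h : P K) : Pbracket f (g + h) = Pbracket f g + Pbracket f h :=
  Subtype.ext (bracket_add_right (P_xFinite f) (P_xFinite g) (P_xFinite h))

theorem Pmul_add_left (f g h : P K) : Pmul (f + g) h = Pmul f h + Pmul g h :=
  Subtype.ext (add_mul (f : FormalSum K) g h)

theorem Pmul_add_right (f g h : P K) : Pmul f (g + h) = Pmul f g + Pmul f h :=
  Subtype.ext (mul_add (f : FormalSum K) g h)

theorem Pmul_comm {p q : ZMod 2} {a b : P K} (ha : a ∈ Pparity K p) (hb : b ∈ Pparity K q) :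
    Pmul a b = sgn K p q • Pmul b a := by
  refine Subtype.ext ?_
  rw [Submodule.coe_smul, coe_Pmul, coe_Pmul]
  exact mul_comm_of_parity (mem_Pparity.1 ha) (mem_Pparity.1 hb)

theorem Pbracket_anticomm {p q : ZMod 2} {a b : P K} (ha : a ∈ Pparity K p)
    (hb : b ∈ Pparity K q) : Pbracket a b = -(sgn K p q • Pbracket b a) := by
  refine Subtype.ext ?_
  rw [Submodule.coe_neg, Submodule.coe_smul, coe_Pbracket, coe_Pbracket]
  exact bracket_anticomm (mem_Pparity.1 ha) (mem_Pparity.1 hb)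

theorem Pbracket_jacobi (hK : (2 : K) ≠ 0) {p q : ZMod 2} {a b : P K} (ha : a ∈ Pparity K p)
    (hb : b ∈ Pparity K q) (c : P K) : Pbracket a (Pbracket b c) =
      Pbracket (Pbracket a b) c + sgn K p q • Pbracket b (Pbracket a c) := by
  have key (r : ZMod 2) (c : P K) (hc : c ∈ Pparity K r) : Pbracket a (Pbracket b c) =
      Pbracket (Pbracket a b) c + sgn K p q • Pbracket b (Pbracket a c) := by
    refine Subtype.ext ?_
    rw [Submodule.coe_add, Submodule.coe_smul]
    simp only [coe_Pbracket]
    have := bracket_jacobi hK (const_mem_quantSpan hK ha) (const_mem_quantSpan hK hb)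
      (const_mem_quantSpan hK hc)
    exact this
  obtain ⟨c, hc, d, hd, rfl⟩ := Pparity_sup hK c 0
  simp only [Pbracket_add_right, key _ c hc, key _ d hd, smul_add]
  abel

theorem Pbracket_leibniz (hK : (2 : K) ≠ 0) {p q : ZMod 2} (a : P K) {b c : P K}
    (hb : b ∈ Pparity K p) (hc : c ∈ Pparity K q) : Pbracket (Pmul a b) c =
      Pmul a (Pbracket b c) + sgn K p q • Pmul (Pbracket a c) b := by
  have key (r : ZMod 2) (a : P K) (ha : a ∈ Pparity K r) : Pbracket (Pmul a b) c =
      Pmul a (Pbracket b c) + sgn K p q • Pmul (Pbracket a c) b := by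
    refine Subtype.ext ?_
    rw [Submodule.coe_add, Submodule.coe_smul]
    simp only [coe_Pbracket, coe_Pmul]
    exact bracket_mul_left (mem_Pparity.1 ha) (mem_Pparity.1 hb) (mem_Pparity.1 hc) (P_xFinite a)
      (P_xFinite b) (P_xFinite c)
  obtain ⟨a, ha, d, hd, rfl⟩ := Pparity_sup hK a 0
  simp only [Pbracket_add_left, Pmul_add_left, key _ a ha, key _ d hd, smul_add]
  abel

theorem Pbracket_cube (hK : (2 : K) ≠ 0) {a : P K} (ha : a ∈ Pparity K 1) :
    Pbracket a (Pbracket a a) = 0 := by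
  refine Subtype.ext ?_
  rw [coe_Pbracket, coe_Pbracket, Submodule.coe_zero]
  have := bracket_cube hK (const_mem_quantSpan hK ha)
  exact this

theorem isBilinearMap_Pmul : IsBilinearMap K (Pmul (K := K)) where
  add_left := Pmul_add_left
  smul_left c f g := Subtype.ext (smul_mul_assoc c (f : FormalSum K) (g : FormalSum K))
  add_right := Pmul_add_right
  smul_right c f g := Subtype.ext (mul_smul_comm c (f : FormalSum K) (g : FormalSum K))

theorem isBilinearMap_Pbracket : IsBilinearMap K (Pbracket (K := K)) where
  add_left := Pbracket_add_left
  smul_left c f g := Subtype.ext (bracket_smul_left c (f : FormalSum K) g)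
  add_right := Pbracket_add_right
  smul_right c f g := Subtype.ext (bracket_smul_right c (f : FormalSum K) g)

theorem Pmul_mem {p q : ZMod 2} {a b : P K} (ha : a ∈ Pparity K p) (hb : b ∈ Pparity K q) :
    Pmul a b ∈ Pparity K (p + q) :=
  mem_Pparity.2 ((mem_Pparity.1 ha).mul (mem_Pparity.1 hb))

theorem Pbracket_mem {p q : ZMod 2} {a b : P K} (ha : a ∈ Pparity K p) (hb : b ∈ Pparity K q) :
    Pbracket a b ∈ Pparity K (p + q) :=
  mem_Pparity.2 ((mem_Pparity.1 ha).bracket (mem_Pparity.1 hb))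

theorem Pparity_isCompl (hK : (2 : K) ≠ 0) : IsCompl (Pparity K 0) (Pparity K 1) := by
  constructor
  · rw [Submodule.disjoint_def]
    exact fun f h h' => eq_zero_of_parity zero_ne_one h h'
  · rw [codisjoint_iff_le_sup]
    intro f _
    obtain ⟨a, ha, b, hb, h⟩ := Pparity_sup hK f 0
    rw [zero_add] at hb
    exact Submodule.mem_sup.2 ⟨a, ha, b, hb, h⟩

theorem isPoissonSuperalgebra_P (hK : (2 : K) ≠ 0) :
    IsPoissonSuperalgebra K (Pparity K) Pone Pmul Pbracket where
  isCompl := Pparity_isCompl hK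
  mul_bilin := isBilinearMap_Pmul
  mul_mem _ _ _ ha _ hb := Pmul_mem ha hb
  one_mul a := Subtype.ext (one_mul (a : FormalSum K))
  mul_one a := Subtype.ext (mul_one (a : FormalSum K))
  mul_assoc a b c := Subtype.ext (mul_assoc (a : FormalSum K) b c)
  mul_comm _ _ _ ha _ hb := Pmul_comm ha hb
  br_bilin := isBilinearMap_Pbracket
  br_mem _ _ _ ha _ hb := Pbracket_mem ha hb
  br_anticomm _ _ _ ha _ hb := Pbracket_anticomm ha hb
  br_jacobi _ _ _ ha _ hb c := Pbracket_jacobi hK ha hb c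
  br_odd _ ha := Pbracket_cube hK ha
  leibniz _ _ a _ hb _ hc := Pbracket_leibniz hK a hb hc

/-! ### The quantization -/

theorem quantize_one (hK : (2 : K) ≠ 0) : quantize hK (const K Pone) = 1 := by
  let s : indexSet := ⟨(∅, ∅), closed_index.nil⟩
  have h1 : (Pone : P K) = basisP hK s := by
    refine Subtype.ext ?_
    rw [coe_basisP, monoF, Pivot.mono, ordProd_empty, ordProd_empty, mul_one]
    rfl
  rw [h1, quantize_basis]
  refine Subtype.ext ?_
  rw [coe_basisAt, monoT, Pivot.mono, ordProd_empty, ordProd_empty, mul_one]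
  rfl

variable (K) in
/-- The product of `P[t]` that is induced by the product of operators. -/
def star (hK : (2 : K) ≠ 0) (f g : PolynomialModule K (P K)) : PolynomialModule K (P K) :=
  (quantize hK).symm (quantize hK f * quantize hK g)

theorem quantize_star (hK : (2 : K) ≠ 0) (f g : PolynomialModule K (P K)) :
    quantize hK (star K hK f g) = quantize hK f * quantize hK g :=
  LinearEquiv.apply_symm_apply _ _

theorem isBilinearMap_star (hK : (2 : K) ≠ 0) : IsBilinearMap K (star K hK) where
  add_left f g h := by
    rw [star, map_add, add_mul, map_add]
    rfl
  smul_left c f g := by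
    rw [← algebraMap_smul K[X] c, star, map_smul, smul_mul_assoc, map_smul, algebraMap_smul]
    rfl
  add_right f g h := by
    rw [star, map_add, mul_add, map_add]
    rfl
  smul_right c f g := by
    rw [← algebraMap_smul K[X] c, star, map_smul, mul_smul_comm, map_smul, algebraMap_smul]
    rfl

theorem star_assoc (hK : (2 : K) ≠ 0) (f g h : PolynomialModule K (P K)) :
    star K hK (star K hK f g) h = star K hK f (star K hK g h) := by
  refine (quantize hK).injective ?_
  rw [quantize_star, quantize_star, quantize_star, quantize_star, mul_assoc]

theorem star_graded (hK : (2 : K) ≠ 0) {p q : ZMod 2} {f g : PolynomialModule K (P K)}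
    (hf : f ∈ polyParity K (Pparity K) p) (hg : g ∈ polyParity K (Pparity K) q) :
    star K hK f g ∈ polyParity K (Pparity K) (p + q) := by
  rw [mem_polyParity_iff hK] at hf hg ⊢
  rw [quantize_star]
  exact hf.mul hg

/-- The product of the two operators is paired in `Quant` with the product of the formal sums, and
the partner of an operator is the constant coefficient of its preimage in `P[t]`. -/
theorem star_mod_t (hK : (2 : K) ≠ 0) (a b : P K) : ∃ r : PolynomialModule K (P K),
    star K hK (const K a) (const K b) = const K (Pmul a b) + (Polynomial.X : K[X]) • r := by
  have h : ((star K hK (const K a) (const K b)).coeff 0 : FormalSum K) = Pmul a b := by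
    refine coeff_zero_eq hK ?_
    rw [quantize_star]
    exact quant_mul (quantIndex_le (const_mem_quantIndex hK a))
      (quantIndex_le (const_mem_quantIndex hK b))
  obtain ⟨r, hr⟩ := exists_eq_const_add (star K hK (const K a) (const K b))
  rw [Subtype.ext h] at hr
  exact ⟨r, hr⟩

/-- The supercommutator of the operators is `t h` with `h` in `At`. The preimage of `h` has constant
coefficient `{a, b}`, and its remaining part is divisible by `t`, which gives the error term with
`t²`. -/
theorem star_mod_t_sq (hK : (2 : K) ≠ 0) {p q : ZMod 2} {a b : P K} (ha : a ∈ Pparity K p)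
    (hb : b ∈ Pparity K q) : ∃ r : PolynomialModule K (P K),
    star K hK (const K a) (const K b) - sgn K p q • star K hK (const K b) (const K a) =
      (Polynomial.X : K[X]) • const K (Pbracket a b) + (Polynomial.X ^ 2 : K[X]) • r := by
  obtain ⟨H, e, h⟩ := exists_bracket hK (const_mem_quantSpan hK ha) (const_mem_quantSpan hK hb)
  obtain ⟨f, hf, hf'⟩ := exists_quantize hK (quantSpan_le _ h)
  obtain ⟨r, hr⟩ := exists_eq_const_add f
  have hf'' : f.coeff 0 = Pbracket a b := Subtype.ext hf'
  refine ⟨r, ?_⟩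
  rw [pow_two, mul_smul, ← smul_add, ← hf'', ← hr, sgn_smul]
  refine (quantize hK).injective (Subtype.ext ?_)
  rw [map_sub, map_zsmul, quantize_star, quantize_star, map_smul]
  dsimp only at e hf
  rw [← hf] at e
  exact e

theorem star_X (hK : (2 : K) ≠ 0) (f : PolynomialModule K (P K)) :
    star K hK f ((Polynomial.X : K[X]) • const K Pone) = (Polynomial.X : K[X]) • f := by
  refine (quantize hK).injective ?_
  rw [quantize_star, map_smul, map_smul, quantize_one, mul_smul_comm, mul_one]

theorem X_star (hK : (2 : K) ≠ 0) (f : PolynomialModule K (P K)) :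
    star K hK ((Polynomial.X : K[X]) • const K Pone) f = (Polynomial.X : K[X]) • f := by
  refine (quantize hK).injective ?_
  rw [quantize_star, map_smul, map_smul, quantize_one, smul_mul_assoc, one_mul]

theorem isAlgebraicQuantization_star (hK : (2 : K) ≠ 0) :
    IsAlgebraicQuantization K (Pparity K) Pone Pmul Pbracket (star K hK) where
  poisson := isPoissonSuperalgebra_P hK
  bilin := isBilinearMap_star hK
  assoc := star_assoc hK
  graded _ _ _ hf _ hg := star_graded hK hf hg
  mod_t := star_mod_t hK
  mod_t_sq _ _ _ ha _ hb := star_mod_t_sq hK ha hb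
  star_t := star_X hK
  t_star := X_star hK

end FractalSuper

end

/-! ### The theorem. -/

theorem mainTheorem11 (K : Type*) [Field K] (hK : ringChar K ≠ 2) :
    ∃ (I : Set (Finset ℕ × Finset ℕ))
      (bP : Module.Basis I K (FractalSuper.P K))
      (bA : Module.Basis I K (FractalSuper.A K))
      (Ψ : TensorProduct K (Polynomial K) (FractalSuper.A K) ≃ₗ[Polynomial K] FractalSuper.At K)
      (Φ : PolynomialModule K (FractalSuper.P K) ≃ₗ[Polynomial K] FractalSuper.At K),
      (∀ s : I, (bP s : FractalSuper.FormalSum K) = FractalSuper.monoP K s.1.1 s.1.2) ∧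
      (∀ s : I, (bA s : Module.End K (FractalSuper.Grassmann K)) =
        FractalSuper.monoA K s.1.1 s.1.2) ∧
      (∀ s : I, (Ψ (TensorProduct.tmul K 1 (bA s)) :
          Module.End (Polynomial K) (FractalSuper.Grassmann (Polynomial K))) =
        FractalSuper.monoAt K s.1.1 s.1.2) ∧
      (∀ s : I, (Φ (FractalSuper.const K (bP s)) :
          Module.End (Polynomial K) (FractalSuper.Grassmann (Polynomial K))) =
        FractalSuper.monoAt K s.1.1 s.1.2) ∧
      (∀ (p : ZMod 2) (f : PolynomialModule K (FractalSuper.P K)),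
        f ∈ FractalSuper.polyParity K (FractalSuper.Pparity K) p ↔
          FractalSuper.IsHomogeneousEnd (Polynomial K) p
            (Φ f : Module.End (Polynomial K) (FractalSuper.Grassmann (Polynomial K)))) ∧
      FractalSuper.IsAlgebraicQuantization K (FractalSuper.Pparity K) FractalSuper.Pone
        FractalSuper.Pmul FractalSuper.Pbracket (fun f g => Φ.symm (Φ f * Φ g)) := by
  have h2 : (2 : K) ≠ 0 := Ring.two_ne_zero hK
  refine ⟨FractalSuper.indexSet, FractalSuper.basisP h2, FractalSuper.basisA h2,
    -- Both isomorphisms match bases over `K[t]` that are indexed by the same set.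
    (Algebra.TensorProduct.basis (Polynomial K) (FractalSuper.basisA h2)).equiv
      (FractalSuper.basisAt h2) (Equiv.refl _), FractalSuper.quantize h2, fun s => ?_, fun s => ?_,
    fun s => ?_, fun s => ?_, FractalSuper.mem_polyParity_iff h2,
    FractalSuper.isAlgebraicQuantization_star h2⟩
  · rw [FractalSuper.coe_basisP, FractalSuper.monoP_eq]
  · exact FractalSuper.coe_basisA h2 s
  · rw [← Algebra.TensorProduct.basis_apply, Module.Basis.equiv_apply, Equiv.refl_apply,
      FractalSuper.coe_basisAt, FractalSuper.monoAt_eq]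
  · rw [FractalSuper.quantize_basis, FractalSuper.coe_basisAt, FractalSuper.monoAt_eq]
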